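/- **Setting.** Let $d\in\{2,3\}$, $0<\kappa_0\le\kappa_1$. Let $\Omega\subset\mathbb R^d$ be a bounded domain partitioned into finitely many non-overlapping axis-parallel rectangular elements $K^i$ ($\Omega$ is the interior of the union of the closed elements), with mesh size $H$ (the largest side length). Let $0=t_0<\dots<t_{N_T}=T$, $\Delta t=\max_n(t_{n+1}-t_n)$, $Q=(0,T)\times\Omega$. Let $\kappa$ be measurable on $Q$ with $\kappa_0\le\kappa\le\kappa_1$, $f\in L^2(Q)$, and let $D_1,\dots,D_m$ be disjoint measurable regions of space-time (the channels), whose complement is the matrix region. *Weight.* $\tilde\kappa=\sum_j\kappa|\nabla\chi_j|^2$, where the $\chi_j$ are attached to the coarse nodes $O_j$ and defined elementwise. Bilinear choice: $\chi_j=g_j$, the multilinear function on each element with $g_j(O_i)=\delta_{ij}$. Multiscale choice: for almost every $t$, $-\nabla\cdot(\kappa_c(t,\cdot)\nabla\chi_j)=0$ in $K$ and $\chi_j=g_j$ on $\partial K$ for each element $K$; here $\kappa_c=\kappa$ or, more generally, $\kappa_c$ is any measurable field on $Q$ with $\kappa_0\le\kappa_c\le\kappa_1$ (for instance a time-independent one).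 *Forms, norms and spaces.* Put $s(v,w)=\int_Q\tilde\kappa vw$, $$d(v,w)=\int_Q\partial_tv\,w+\int_Q\kappa\nabla v\cdot\nabla w+\sum_n\int_{t_n}^{t_{n+1}}\!\!\int_\Omega\tilde\kappa^{-1}\partial_tv\,\partial_tw,$$ $\|v\|_V^2=\int_Q\kappa|\nabla v|^2+\int_Q\tilde\kappa^{-1}|\partial_tv|^2$, $\|\cdot\|_{L^2}=\|\cdot\|_{L^2(Q)}$. $V_0$ is the set of $v\in L^2(0,T;H^1_0(\Omega))\cap H^1(0,T;L^2(\Omega))$ with $v(0,\cdot)=0$ and $\|\tilde\kappa^{-1/2}\partial_tv\|_{L^2}<\infty$. $V_d\supset V_0$ is the set of $v\in L^2(0,T;H^1_0(\Omega))$ that have, inside each coarse time interval, a weak time derivative, with $\partial_tv\in L^2(Q)$ and $\|\tilde\kappa^{-1/2}\partial_tv\|_{L^2}<\infty$ for this piecewise derivative. $V_{aux}$ is the span of the functions $\psi_j^{(n,i)}$, which are constant on the part of $(t_n,t_{n+1}]\times K^i$ in the $j$-th continuum (the matrix or one channel), zero elsewhere, and normalized by $\int\tilde\kappa\psi_j^{(n,i)}=1$.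 *Solutions.* $u$ is the weak solution of $\partial_tu-\nabla\cdot(\kappa\nabla u)=f$ with zero initial and boundary values: $u\in L^2(0,T;H_0^1(\Omega))\cap H^1(0,T;L^2(\Omega))$, $u(0,\cdot)=0$, and $\int_Q\partial_tu\,w+\int_Q\kappa\nabla u\cdot\nabla w=\int_Qfw$ for all $w\in L^2(0,T;H^1_0(\Omega))$. Fix any test set $S$ with $V_0\subseteq S\subseteq V_d$ (for example $S=V_0$ or $S=V_d$). The global downscale operator sends a vector $U$ to $(F_1(U),F_2(U))\in V_0\times V_{aux}$ with $d(F_1(U),w)-s(F_2(U),w)=0$ for all $w\in S$ and $s(F_1(U),\psi_j^{(n,i)})=U_j^{(n,i)}$. The global solution is $u_{glo}=F_1(U)$, where $s(F_2(U),\psi)=\int_Qf\psi$ for all the functions $\psi=\psi_j^{(n,i)}$. **Theorem.** (1) (Multiscale $\chi_j$.) For all $\gamma,M$ there is $C_0>0$, depending only on $d,\kappa_0,\kappa_1,\gamma,M$, such that in every setting as above in which all element sides are at least $H/\gamma$, and in which either $\Delta t\le MH^2$ or $\tilde\kappa(t,x)\le M\tilde\kappa(t',x)$ for almost all $x\in\Omega$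 and $t,t'$ in the same coarse time interval, $$\|u-u_{glo}\|_V\le C_0\Bigl(1+\bigl(\tfrac{\Delta t}{H^2}\bigr)^{1/2}\Bigr)\|\tilde\kappa^{-1/2}f\|_{L^2}+\|\tilde\kappa^{-1/2}\partial_tu\|_{L^2}.$$ (Every single discretization satisfies the condition with $M=\Delta t/H^2$. If $\kappa_c$ does not depend on time, it always holds with $M=\kappa_1/\kappa_0$, whatever $H$ and $\Delta t$.) (2) (Bilinear $\chi_j$.) For every $\gamma$ there is $C>0$, depending only on $d,\kappa_0,\kappa_1,\gamma$, such that in every setting as above in which the side lengths of each element differ at most by the factor $\gamma$, $$\|u-u_{glo}\|_V\le C\bigl(H+(\Delta t)^{1/2}\bigr)\|\kappa^{-1/2}f\|_{L^2}+CH\|\kappa^{-1/2}\partial_tu\|_{L^2}.$$ In both parts norms may take the value $+\infty$, in which case the inequality is understood in $[0,\infty]$. -/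

import Mathlib

open MeasureTheory Set
open scoped ENNReal RealInnerProductSpace

namespace SpaceTimeNLMC

noncomputable section

/-- Points `x` of `ℝ^d` with the Euclidean norm. -/
abbrev Pt (d : ℕ) := EuclideanSpace ℝ (Fin d)

/-- Points `(t, x)` of space-time. -/
abbrev STPt (d : ℕ) := ℝ × Pt d

/-- The space-time cylinder `(0,T) × ω`. -/
def cyl {d : ℕ} (T : ℝ) (ω : Set (Pt d)) : Set (STPt d) := Ioo 0 T ×ˢ ω

/-! ### Weak derivatives and Sobolev spaces on space-time -/

/-- `g` is the weak derivative of `v` on `Q` in the direction `e`, tested with the smooth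
compactly supported functions whose support lies in `A`.  For `A = Q` this is the usual weak
derivative on the open set `Q`.  For an open `A` larger than `Q` the identity is Green's formula
without boundary term, and says in addition that `v` vanishes on the part of the boundary
of `Q` that lies in `A` and is not parallel to `e`. -/
def HasWeakDeriv {d : ℕ} (Q A : Set (STPt d)) (e : STPt d) (v g : STPt d → ℝ) : Prop :=
  ∀ φ : STPt d → ℝ, ContDiff ℝ ((⊤ : ℕ∞) : WithTop ℕ∞) φ → HasCompactSupport φ → tsupport φ ⊆ A →
    ∫ z in Q, v z * fderiv ℝ φ z e = -∫ z in Q, g z * φ z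

/-- `v ∈ H^{1,0}_0((0,T) × ω) = L²(0,T; H¹₀(ω))` with weak spatial gradient `g`: both are
square integrable and `v` vanishes on the lateral boundary `(0,T) × ∂ω`. -/
structure MemH10Zero {d : ℕ} (T : ℝ) (ω : Set (Pt d)) (v : STPt d → ℝ)
    (g : STPt d → Pt d) : Prop where
  memLp_val : MemLp v 2 (volume.restrict (cyl T ω))
  memLp_grad : MemLp g 2 (volume.restrict (cyl T ω))
  weak_grad : ∀ y : Pt d,
    HasWeakDeriv (cyl T ω) (Ioo 0 T ×ˢ univ) (0, y) v (fun z => ⟪g z, y⟫)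

/-- A space-time function together with its spatial gradient and its time derivative
(the predicates below say in which sense these are weak derivatives). -/
structure STFun (d : ℕ) where
  val : STPt d → ℝ
  grad : STPt d → Pt d
  dt : STPt d → ℝ

instance {d : ℕ} : Sub (STFun d) where
  sub v w := ⟨v.val - w.val, v.grad - w.grad, v.dt - w.dt⟩

/-- `v ∈ H^{1,1}_{0,0}((0,T) × Ω)`: `v`, `∇v`, `∂ₜv` are square integrable, `v = 0` on
`(0,T) × ∂Ω`, and `v(0,·) = 0` on `Ω` (test functions in time need not vanish near `t = 0`). -/
structure MemH11ZeroZero {d : ℕ} (T : ℝ) (Ω : Set (Pt d)) (v : STFun d) : Prop where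
  memH10 : MemH10Zero T Ω v.val v.grad
  memLp_dt : MemLp v.dt 2 (volume.restrict (cyl T Ω))
  weak_dt : HasWeakDeriv (cyl T Ω) (Iio T ×ˢ Ω) (1, 0) v.val v.dt

/-! ### The parabolic problem -/

/-- The data: a bounded domain `Ω`, a final time `T`, a coefficient `κ` with
`κ₀ ≤ κ ≤ κ₁`, a source `f ∈ L²`, and the channels, which are disjoint regions of space-time
(the rest of space-time is the matrix region).  The coefficient may, but need not, be constant
on the matrix and on each channel. -/
structure Problem (d : ℕ) (κ₀ κ₁ : ℝ) where
  Ω : Set (Pt d)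
  isOpen : IsOpen Ω
  isConnected : IsConnected Ω
  isBounded : Bornology.IsBounded Ω
  T : ℝ
  T_pos : 0 < T
  κ : STPt d → ℝ
  aemeasurable_κ : AEMeasurable κ (volume.restrict (cyl T Ω))
  κ_mem : ∀ z ∈ cyl T Ω, κ z ∈ Icc κ₀ κ₁
  f : STPt d → ℝ
  memLp_f : MemLp f 2 (volume.restrict (cyl T Ω))
  numChannels : ℕ
  channel : Fin numChannels → Set (STPt d)
  measurableSet_channel : ∀ k, MeasurableSet (channel k)
  disjoint_channel : Pairwise fun k l => Disjoint (channel k) (channel l)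

variable {d : ℕ} {κ₀ κ₁ : ℝ}

/-- The space-time domain `(0,T) × Ω`. -/
def Problem.Q (P : Problem d κ₀ κ₁) : Set (STPt d) := cyl P.T P.Ω

/-- The continua: `none` is the matrix region, `some k` is the `k`-th channel. -/
def Problem.continuum (P : Problem d κ₀ κ₁) : Option (Fin P.numChannels) → Set (STPt d)
  | none => (⋃ k, P.channel k)ᶜ
  | some k => P.channel k

/-- `u` is the weak solution of `∂ₜu - ∇·(κ∇u) = f` with zero initial and boundary values. -/
structure Problem.IsWeakSolution (P : Problem d κ₀ κ₁) (u : STFun d) : Prop where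
  mem : MemH11ZeroZero P.T P.Ω u
  eq : ∀ (w : STPt d → ℝ) (gw : STPt d → Pt d), MemH10Zero P.T P.Ω w gw →
    (∫ z in P.Q, u.dt z * w z) + ∫ z in P.Q, P.κ z * ⟪u.grad z, gw z⟫ = ∫ z in P.Q, P.f z * w z

/-! ### Coarse meshes -/

/-- A partition of `Ω` into finitely many non-overlapping rectangular elements. -/
structure SpaceMesh (d : ℕ) (Ω : Set (Pt d)) where
  numCells : ℕ
  lo : Fin numCells → Pt d
  hi : Fin numCells → Pt d
  lo_lt_hi : ∀ i k, lo i k < hi i k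
  disjoint_cells : Pairwise fun i j =>
    Disjoint {x : Pt d | ∀ k, x k ∈ Ioo (lo i k) (hi i k)}
      {x : Pt d | ∀ k, x k ∈ Ioo (lo j k) (hi j k)}
  interior_union : interior (⋃ i, {x : Pt d | ∀ k, x k ∈ Icc (lo i k) (hi i k)}) = Ω

namespace SpaceMesh

variable {Ω : Set (Pt d)} (𝒯 : SpaceMesh d Ω)

/-- The (open) coarse element `K^i`. -/
def cell (i : Fin 𝒯.numCells) : Set (Pt d) := {x | ∀ k, x k ∈ Ioo (𝒯.lo i k) (𝒯.hi i k)}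

/-- The side length of `K^i` in the `k`-th coordinate direction. -/
def side (i : Fin 𝒯.numCells) (k : Fin d) : ℝ := 𝒯.hi i k - 𝒯.lo i k

/-- The mesh size `H`: the largest side length. -/
def H : ℝ := ⨆ i, ⨆ k, 𝒯.side i k

/-- Shape regularity: the side lengths of each element are comparable. -/
def ShapeRegular (γ : ℝ) : Prop := ∀ i k l, 𝒯.side i k ≤ γ * 𝒯.side i l

/-- Shape regularity with all elements of size comparable to `H`. -/
def QuasiUniform (γ : ℝ) : Prop := ∀ i k, 𝒯.H ≤ γ * 𝒯.side i k

/-- The multilinear (for `d = 2` bilinear) function on `K^i` that is `1` at the vertex of `K^i`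
labelled by `v` and `0` at the other vertices. -/
def hat (i : Fin 𝒯.numCells) (v : Fin d → Bool) (x : Pt d) : ℝ :=
  ∏ k, if v k then (x k - 𝒯.lo i k) / 𝒯.side i k else (𝒯.hi i k - x k) / 𝒯.side i k

/-- The gradients of the bilinear partition of unity functions. -/
def hatGrad (i : Fin 𝒯.numCells) (v : Fin d → Bool) (z : STPt d) : Pt d :=
  gradient (𝒯.hat i v) z.2

/-- The weight `κ̃ = ∑_j κ |∇χ_j|²`, where the family `G` holds the gradients of the partition of
unity functions: `G i v` is the gradient on `K^i` of the function attached to the vertex `v`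
of `K^i` (the functions attached to the other coarse nodes vanish on `K^i`). -/
def weight (κ : STPt d → ℝ) (G : Fin 𝒯.numCells → (Fin d → Bool) → STPt d → Pt d)
    (z : STPt d) : ℝ :=
  ∑ i, {z : STPt d | z.2 ∈ 𝒯.cell i}.indicator (fun z => ∑ v, κ z * ‖G i v z‖ ^ 2) z

/-- `χ i v`, with spatial gradient `G i v`, are the multiscale basis functions for the
coefficient `κc`: at (almost) every time `t`, `-∇·(κc(t,·)∇χ) = 0` in `K^i`, and `χ` has the
boundary values of the nodal function `hat i v` on `∂K^i`. -/
structure IsMultiscaleBasis (T : ℝ) (κc : STPt d → ℝ)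
    (χ : Fin 𝒯.numCells → (Fin d → Bool) → STPt d → ℝ)
    (G : Fin 𝒯.numCells → (Fin d → Bool) → STPt d → Pt d) : Prop where
  boundary : ∀ i v, MemH10Zero T (𝒯.cell i) (fun z => χ i v z - 𝒯.hat i v z.2)
    (fun z => G i v z - 𝒯.hatGrad i v z)
  eq : ∀ i v (w : STPt d → ℝ) (gw : STPt d → Pt d), MemH10Zero T (𝒯.cell i) w gw →
    ∫ z in cyl T (𝒯.cell i), κc z * ⟪G i v z, gw z⟫ = 0

end SpaceMesh

/-- A partition `0 = t₀ < t₁ < ⋯ < t_N = T` of the time interval. -/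
structure TimeMesh (T : ℝ) where
  N : ℕ
  t : Fin (N + 1) → ℝ
  strictMono : StrictMono t
  t_zero : t 0 = 0
  t_last : t (Fin.last N) = T

/-- The coarse time interval `(t_n, t_{n+1}]`. -/
def TimeMesh.interval {T : ℝ} (τ : TimeMesh T) (n : Fin τ.N) : Set ℝ :=
  Ioc (τ.t n.castSucc) (τ.t n.succ)

/-- The maximal time step `Δt`. -/
def TimeMesh.dt {T : ℝ} (τ : TimeMesh T) : ℝ := ⨆ n : Fin τ.N, (τ.t n.succ - τ.t n.castSucc)

/-- Within each coarse time interval the weight `κt` varies in time at most by the factor `M`. -/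
def TimeMesh.Comparable {T : ℝ} (τ : TimeMesh T) (Ω : Set (Pt d)) (κt : STPt d → ℝ)
    (M : ℝ) : Prop :=
  ∀ n, ∀ᵐ x ∂(volume.restrict Ω), ∀ᵐ t ∂(volume.restrict (τ.interval n)),
    ∀ᵐ s ∂(volume.restrict (τ.interval n)), κt (t, x) ≤ M * κt (s, x)

/-! ### Norms, bilinear forms, function spaces (`κt` is the weight `κ̃`) -/

namespace Problem

variable (P : Problem d κ₀ κ₁) (κt : STPt d → ℝ)

/-- `‖ρ^{-1/2} g‖_{L²}` over `(0,T) × Ω`, in `[0,∞]`. -/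
def wnorm (ρ g : STPt d → ℝ) : ℝ≥0∞ :=
  (∫⁻ z in P.Q, (ENNReal.ofReal (ρ z))⁻¹ * ENNReal.ofReal (g z ^ 2)) ^ (1 / 2 : ℝ)

/-- The energy norm `‖v‖_V² = ∫∫ κ|∇v|² + ∫∫ κ̃⁻¹|∂ₜv|²`, in `[0,∞]`. -/
def normV (v : STFun d) : ℝ≥0∞ :=
  ((∫⁻ z in P.Q, ENNReal.ofReal (P.κ z * ‖v.grad z‖ ^ 2)) +
    ∫⁻ z in P.Q, (ENNReal.ofReal (κt z))⁻¹ * ENNReal.ofReal (v.dt z ^ 2)) ^ (1 / 2 : ℝ)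

/-- `s(u,v) = ∫∫ κ̃ u v`. -/
def s (u v : STPt d → ℝ) : ℝ := ∫ z in P.Q, κt z * u z * v z

/-- `b(v,w) = ∫∫ ∂ₜv w`. -/
def b (v w : STFun d) : ℝ := ∫ z in P.Q, v.dt z * w.val z

/-- `a(v,w) = ∫∫ κ∇v·∇w`. -/
def a (v w : STFun d) : ℝ := ∫ z in P.Q, P.κ z * ⟪v.grad z, w.grad z⟫

/-- `e(v,w) = ∑_n ∫_{t_n}^{t_{n+1}} ∫ κ̃⁻¹ ∂ₜv ∂ₜw`, with `∂ₜ` taken on each time interval. -/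
def e (τ : TimeMesh P.T) (v w : STFun d) : ℝ :=
  ∑ n, ∫ z in τ.interval n ×ˢ P.Ω, (κt z)⁻¹ * v.dt z * w.dt z

/-- `d(v,w) = b(v,w) + a(v,w) + e(v,w)`. -/
def dform (τ : TimeMesh P.T) (v w : STFun d) : ℝ := P.b v w + P.a v w + P.e κt τ v w

/-- `V₀`: functions of finite energy with zero lateral and zero initial values. -/
def V₀ : Set (STFun d) := {v | MemH11ZeroZero P.T P.Ω v ∧ P.wnorm κt v.dt < ∞}

/-- `V_d`: functions of finite energy with zero lateral values, weakly differentiable in time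
inside each coarse time interval but possibly discontinuous from one interval to the next. -/
def V_d (τ : TimeMesh P.T) : Set (STFun d) :=
  {v | MemH10Zero P.T P.Ω v.val v.grad ∧ MemLp v.dt 2 (volume.restrict P.Q) ∧
    (∀ n : Fin τ.N, HasWeakDeriv (Ioo (τ.t n.castSucc) (τ.t n.succ) ×ˢ P.Ω)
      (Ioo (τ.t n.castSucc) (τ.t n.succ) ×ˢ P.Ω) (1, 0) v.val v.dt) ∧ P.wnorm κt v.dt < ∞}

variable (𝒯 : SpaceMesh d P.Ω) (τ : TimeMesh P.T)

/-- The part of the space-time element `K^{(n,i)}` that lies in the `j`-th continuum. -/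
def block (n : Fin τ.N) (i : Fin 𝒯.numCells) (j : Option (Fin P.numChannels)) :
    Set (STPt d) :=
  (τ.interval n ×ˢ 𝒯.cell i) ∩ P.continuum j

/-- The index set of the auxiliary functions `ψ_j^{(n,i)}`. -/
abbrev AuxIndex := Fin τ.N × Fin 𝒯.numCells × Option (Fin P.numChannels)

/-- The piecewise constant auxiliary function `ψ_j^{(n,i)}`: constant on the `j`-th continuum of
`K^{(n,i)}` with `∫ κ̃ ψ = 1` there, and zero elsewhere (identically zero, hence irrelevant
for the span, if that continuum does not meet `K^{(n,i)}`). -/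
def ψ (q : AuxIndex P 𝒯 τ) : STPt d → ℝ :=
  (P.block 𝒯 τ q.1 q.2.1 q.2.2).indicator
    fun _ => (∫ z in P.block 𝒯 τ q.1 q.2.1 q.2.2, κt z)⁻¹

/-- The auxiliary space `V_aux`. -/
def Vaux : Submodule ℝ (STPt d → ℝ) := Submodule.span ℝ (range (P.ψ κt 𝒯 τ))

/-- `v = F₁(U)` and `p = F₂(U)` for the global downscale operator `F` with test space `S`. -/
structure IsGlobalDownscale (S : Set (STFun d)) (U : AuxIndex P 𝒯 τ → ℝ) (v : STFun d)
    (p : STPt d → ℝ) : Prop where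
  mem_V₀ : v ∈ P.V₀ κt
  mem_Vaux : p ∈ P.Vaux κt 𝒯 τ
  eq_d : ∀ w ∈ S, P.dform κt τ v w - P.s κt p w.val = 0
  eq_s : ∀ q, P.s κt v.val (P.ψ κt 𝒯 τ q) = U q

/-- `v = F₁(U)` is the global numerical solution `u_glo`: the coefficient vector `U` solves the
coarse problem `s(F₂(U), ψ) = ∫∫ f ψ` for every auxiliary function `ψ`. -/
def IsGlobalSolution (S : Set (STFun d)) (v : STFun d) : Prop :=
  ∃ (U : AuxIndex P 𝒯 τ → ℝ) (p : STPt d → ℝ), P.IsGlobalDownscale κt 𝒯 τ S U v p ∧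
    ∀ q, P.s κt p (P.ψ κt 𝒯 τ q) = ∫ z in P.Q, P.f z * P.ψ κt 𝒯 τ q z

end Problem

end

end SpaceTimeNLMC

namespace SpaceTimeNLMC
open scoped Pointwise

noncomputable section
variable {d : ℕ}

/-! ### Absolutely continuous functions of one variable -/

/-! Let w be the error u - u_glo. Subtracting the two equations gives, for all θ in V₀, b(w,θ) +
a(w,θ) + e(w,θ) = R(θ) + e(u,θ) with R(θ) = ∫fθ - s(F₂(U),θ). The equation for u contains no e-term,
so e(u,θ) is a consistency error; it produces the summand ‖κ̃^{-1/2}∂ₜu‖ with constant one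
(`exists_error`).

The coarse problem makes F₂(U) the κ̃-weighted projection of κ̃⁻¹f onto the piecewise constants.
Hence R(θ) does not change when a constant is subtracted from θ on a space-time element, and R(θ) is
controlled by κ̃^{-1/2}f and κ̃^{1/2}(θ - c) (`enorm_residual_sq_le`). What is needed is a Poincaré
inequality with weight κ̃. It follows from the unweighted one as soon as κ̃ acts as a multiplier of
size h⁻², in the sense that ∫κ̃|θ-c|² is at most a constant times h⁻²∫|θ-c|² + ∫|∇θ|²
(`WeightBound`). For bilinear functions this is a pointwise bound. A multiscale ∇χ need not be
bounded, but a comparison principle gives |χ - g| ≤ 1 (`abs_sub_hat_le`), and testing the equation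
of χ with (χ - g)(θ - c)² gives a Caccioppoli inequality (`H10.caccioppoli`).

The Poincaré inequality in space leaves the oscillation of θ in time, that is, its difference to the
mean over each coarse time interval. There are two ways to treat it.

If Δt ≤ Mh², the oscillation is bounded by ∫|∂ₜθ|, and Cauchy-Schwarz with the weight gives
‖κ̃^{-1/2}∂ₜθ‖, which is part of the energy. Testing with θ = w is then enough
(`error_le_of_dt_le`).

If κ̃ is comparable in time, a second test function is used: the primitive W in time of the
oscillation of w. It vanishes at all mesh times, so b(w,W) = -‖osc w‖² (`integral_dt_mul_oscPrim`),
while ∇W, osc W and, by comparability, κ̃^{-1/2}∂ₜW gain a factor Δt over ∇w, osc w and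
κ̃^{-1/2}∂ₜw. The two tests give two coupled quadratic inequalities for the energy of w and for ‖osc
w‖, which `le_of_energy_inequalities` resolves (`error_le_of_comparable`). Bilinear weights are
always comparable in time, and there h⁻²κ̃⁻¹ is bounded by a multiple of κ⁻¹ on each element, so
that shape regularity suffices.

All Sobolev calculus is done along lines: after extension by zero, a weak derivative in a direction
is the same as an integral identity along almost every line in that direction (`lineAC_of_weak`,
`weak_of_lineAC`). Chain and product rules and the exchange of time integrals with spatial
derivatives become statements about one variable combined with Fubini. -/

theorem absolutelyContinuousOnInterval_lipschitz_comp {F V : ℝ → ℝ} {K : NNReal} {a b : ℝ}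
    (hF : LipschitzWith K F) (hV : AbsolutelyContinuousOnInterval V a b) :
    AbsolutelyContinuousOnInterval (fun x => F (V x)) a b := by
  rw [absolutelyContinuousOnInterval_iff] at hV ⊢
  intro ε hε
  -- The divisor is K + 1 because K may vanish.
  obtain ⟨δ, hδ, h⟩ := hV (ε / (K + 1)) (by positivity)
  refine ⟨δ, hδ, fun E hE hl => ?_⟩
  have h1 := h E hE hl
  calc ∑ i ∈ Finset.range E.1, dist (F (V (E.2 i).1)) (F (V (E.2 i).2))
      ≤ ∑ i ∈ Finset.range E.1, K * dist (V (E.2 i).1) (V (E.2 i).2) :=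
        Finset.sum_le_sum fun i _ => hF.dist_le_mul _ _
    _ = K * ∑ i ∈ Finset.range E.1, dist (V (E.2 i).1) (V (E.2 i).2) := by
        rw [Finset.mul_sum]
    _ ≤ (K + 1) * ∑ i ∈ Finset.range E.1, dist (V (E.2 i).1) (V (E.2 i).2) := by
        gcongr; linarith
    _ < (K + 1) * (ε / (K + 1)) := by gcongr
    _ = ε := by field_simp

theorem absolutelyContinuousOnInterval_sub_integral {h : ℝ → ℝ} {a r : ℝ}
    (hh : IntervalIntegrable h volume 0 r) :
    AbsolutelyContinuousOnInterval (fun s => a - ∫ x in (0:ℝ)..s, h x) 0 r := by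
  have h1 := hh.absolutelyContinuousOnInterval_intervalIntegral (c := 0) (by simp)
  have h2 : AbsolutelyContinuousOnInterval (fun _ : ℝ => a) 0 r :=
    (LipschitzWith.const a).lipschitzOnWith.absolutelyContinuousOnInterval
  exact h2.fun_sub h1

theorem ae_hasDerivAt_sub_integral {h : ℝ → ℝ} {a r : ℝ}
    (hh : IntervalIntegrable h volume 0 r) :
    ∀ᵐ s, s ∈ uIoc 0 r → HasDerivAt (fun s => a - ∫ x in (0:ℝ)..s, h x) (-h s) s := by
  filter_upwards [hh.ae_hasDerivAt_integral] with s hs hs2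
  exact (hs (uIoc_subset_uIcc hs2) 0 (by simp)).const_sub a

/-- The chain rule for an indefinite integral. -/
theorem comp_sub_eq_integral {F F' h : ℝ → ℝ} {K : NNReal} {a r : ℝ}
    (hF : LipschitzWith K F) (hd : ∀ s, HasDerivAt F (F' s) s)
    (hh : IntervalIntegrable h volume 0 r) :
    IntervalIntegrable (fun s => F' (a - ∫ x in (0:ℝ)..s, h x) * h s) volume 0 r ∧
    F a - F (a - ∫ x in (0:ℝ)..r, h x) =
      ∫ s in (0:ℝ)..r, F' (a - ∫ x in (0:ℝ)..s, h x) * h s := by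
  set V : ℝ → ℝ := fun s => a - ∫ x in (0:ℝ)..s, h x with hV
  have hac := absolutelyContinuousOnInterval_lipschitz_comp hF
    (absolutelyContinuousOnInterval_sub_integral (a := a) hh)
  have hae : ∀ᵐ s, s ∈ uIoc 0 r → -deriv (fun x => F (V x)) s = F' (V s) * h s := by
    filter_upwards [ae_hasDerivAt_sub_integral (a := a) hh] with s hs hs2
    have := ((hd (V s)).comp s (hs hs2)).deriv
    simp only [Function.comp_def] at this
    rw [this]; ring
  have hI := hac.intervalIntegrable_deriv
  constructor
  · refine hI.neg.congr_ae ?_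
    rw [Filter.EventuallyEq, ae_restrict_iff' measurableSet_uIoc]
    filter_upwards [hae] with s hs hs2 using hs hs2
  · rw [← intervalIntegral.integral_congr_ae hae, intervalIntegral.integral_neg,
      hac.integral_deriv_eq_sub]
    simp

/-- The product rule for indefinite integrals. -/
theorem mul_sub_eq_integral {h k : ℝ → ℝ} {a b r : ℝ}
    (hh : IntervalIntegrable h volume 0 r) (hk : IntervalIntegrable k volume 0 r) :
    IntervalIntegrable (fun s => h s * (b - ∫ x in (0:ℝ)..s, k x)
        + (a - ∫ x in (0:ℝ)..s, h x) * k s) volume 0 r ∧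
    a * b - (a - ∫ x in (0:ℝ)..r, h x) * (b - ∫ x in (0:ℝ)..r, k x) =
      ∫ s in (0:ℝ)..r, (h s * (b - ∫ x in (0:ℝ)..s, k x)
        + (a - ∫ x in (0:ℝ)..s, h x) * k s) := by
  have hac := absolutelyContinuousOnInterval_sub_integral (a := a) hh
  have hbc := absolutelyContinuousOnInterval_sub_integral (a := b) hk
  constructor
  · exact (hh.mul_continuousOn hbc.continuousOn).add (hk.continuousOn_mul hac.continuousOn)
  · have h1 := hac.integral_deriv_mul_eq_sub hbc
    simp only [intervalIntegral.integral_same, sub_zero] at h1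
    have h2 : a * b - (a - ∫ x in (0:ℝ)..r, h x) * (b - ∫ x in (0:ℝ)..r, k x) =
      -((a - ∫ x in (0:ℝ)..r, h x) * (b - ∫ x in (0:ℝ)..r, k x) - a * b) := by ring
    rw [h2, ← h1, ← intervalIntegral.integral_neg]
    apply intervalIntegral.integral_congr_ae
    filter_upwards [ae_hasDerivAt_sub_integral (a := a) hh,
      ae_hasDerivAt_sub_integral (a := b) hk] with s hs1 hs2 hs3
    rw [(hs1 hs3).deriv, (hs2 hs3).deriv]; ring

/-! ### Absolute continuity along almost every line -/

/-- Along almost every line in direction `e`, `v` is absolutely continuous with derivative `g`. -/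
def LineAC (A : Set (STPt d)) (e : STPt d) (v g : STPt d → ℝ) : Prop :=
  ∀ r : ℝ, 0 < r → ∀ᵐ z ∂volume.restrict A,
    IntervalIntegrable (fun s => g (z - s • e)) volume 0 r ∧
    v z - v (z - r • e) = ∫ s in (0:ℝ)..r, g (z - s • e)

instance : (volume : Measure (STPt d)).IsAddRightInvariant :=
  inferInstanceAs (((volume : Measure ℝ).prod (volume : Measure (Pt d))).IsAddRightInvariant)

theorem measurable_line (e : STPt d) : Measurable fun p : STPt d × ℝ => p.1 - p.2 • e := by
  fun_prop

/-- By translation invariance every slice in s has the same L¹ norm, and s ranges over a bounded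
interval. This justifies each later use of Fubini for line integrals. -/
theorem integrable_line_prod {g : STPt d → ℝ} (hg : Measurable g) (hi : Integrable g)
    (e : STPt d) (a b : ℝ) :
    Integrable (fun p : STPt d × ℝ => g (p.1 - p.2 • e)) (volume.prod (volume.restrict (Ioc a b))) := by
  have hm : Measurable fun p : STPt d × ℝ => g (p.1 - p.2 • e) := hg.comp (measurable_line e)
  rw [integrable_prod_iff' hm.aestronglyMeasurable]
  refine ⟨Filter.Eventually.of_forall fun s => hi.comp_sub_right (s • e), ?_⟩
  have : (fun s : ℝ => ∫ z : STPt d, ‖g (z - s • e)‖) = fun _ => ∫ z, ‖g z‖ := by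
    funext s
    exact integral_sub_right_eq_self (fun z => ‖g z‖) (s • e)
  simp only [this]
  exact integrable_const _

theorem ae_intervalIntegrable_line {g : STPt d → ℝ} (hg : Measurable g) (hi : Integrable g)
    (e : STPt d) {r : ℝ} (hr : 0 ≤ r) :
    ∀ᵐ z : STPt d, IntervalIntegrable (fun s => g (z - s • e)) volume 0 r := by
  have := (integrable_line_prod hg hi e 0 r).prod_right_ae
  filter_upwards [this] with z hz
  rw [intervalIntegrable_iff_integrableOn_Ioc_of_le hr]
  exact hz

theorem measurable_integral_line {g : STPt d → ℝ} (hg : Measurable g) (e : STPt d) :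
    Measurable fun p : STPt d × ℝ => ∫ x in Ioc 0 p.2, g (p.1 - x • e) := by
  -- The variable endpoint moves into an indicator of a jointly measurable set, so that the integral
  -- becomes one with a fixed domain and a parameter.
  have h1 : (fun p : STPt d × ℝ => ∫ x in Ioc 0 p.2, g (p.1 - x • e)) =
      fun p => ∫ x, ({q : (STPt d × ℝ) × ℝ | q.2 ∈ Ioc 0 q.1.2}.indicator
        (fun q => g (q.1.1 - q.2 • e))) (p, x) := by
    funext p
    rw [← integral_indicator measurableSet_Ioc]
    rfl
  rw [h1]
  refine (StronglyMeasurable.integral_prod_right' (ν := volume)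
    (f := {q : (STPt d × ℝ) × ℝ | q.2 ∈ Ioc 0 q.1.2}.indicator
        (fun q => g (q.1.1 - q.2 • e))) ?_).measurable
  apply Measurable.stronglyMeasurable
  refine Measurable.indicator (by fun_prop) ?_
  exact (measurableSet_lt measurable_const measurable_snd).inter
    (measurableSet_le measurable_snd (by fun_prop))

/-- In the hypothesis the exceptional null set of points may depend on s. Fubini exchanges the
quantifiers, at the price of an exceptional null set of s on each line. -/
theorem ae_ae_of_forall_ae {A : Set (STPt d)} {p : STPt d → ℝ → Prop} (hp : MeasurableSet {q : STPt d × ℝ | p q.1 q.2}) {r : ℝ}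
    (h : ∀ s, 0 < s → ∀ᵐ z ∂volume.restrict A, p z s) :
    ∀ᵐ z ∂volume.restrict A, ∀ᵐ s ∂volume.restrict (Ioc 0 r), p z s := by
  rw [Measure.ae_ae_comm hp]
  filter_upwards [ae_restrict_mem measurableSet_Ioc] with s hs using h s hs.1

/-- On almost every line v agrees for almost every parameter with one absolutely continuous
function, so under an integral in s the one may replace the other. -/
theorem LineAC.ae_ae {A : Set (STPt d)} {e : STPt d} {v g : STPt d → ℝ}
    (hv : Measurable v) (hg : Measurable g) (h : LineAC A e v g) (r : ℝ) :
    ∀ᵐ z ∂volume.restrict A, ∀ᵐ s ∂volume.restrict (Ioc 0 r),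
      v (z - s • e) = v z - ∫ x in (0:ℝ)..s, g (z - x • e) := by
  have h1 : ∀ᵐ z ∂volume.restrict A, ∀ᵐ s ∂volume.restrict (Ioc 0 r),
      v (z - s • e) = v z - ∫ x in Ioc 0 s, g (z - x • e) := by
    refine ae_ae_of_forall_ae ?_ ?_
    · apply measurableSet_eq_fun
      · exact hv.comp (measurable_line e)
      · exact (hv.comp measurable_fst).sub (measurable_integral_line hg e)
    · intro s hs
      filter_upwards [h s hs] with z hz
      rw [← intervalIntegral.integral_of_le hs.le, ← hz.2]; ring
  filter_upwards [h1] with z hz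
  filter_upwards [hz, ae_restrict_mem measurableSet_Ioc] with s hs hs2
  rw [hs, intervalIntegral.integral_of_le hs2.1.le]

/-- This is the chain rule in one variable, applied to the absolutely continuous function on each
line. F is differentiable at every point, so no level sets of v have to be discussed; this is why
smooth truncations are used later on. -/
theorem LineAC.comp {A : Set (STPt d)} {e : STPt d} {v g : STPt d → ℝ}
    (hv : Measurable v) (hg : Measurable g) (h : LineAC A e v g) {F F' : ℝ → ℝ} {K : NNReal}
    (hF : LipschitzWith K F) (hd : ∀ s, HasDerivAt F (F' s) s) :
    LineAC A e (fun z => F (v z)) (fun z => F' (v z) * g z) := by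
  intro r hr
  filter_upwards [h r hr, h.ae_ae hv hg r] with z h1 h2
  obtain ⟨h3, h4⟩ := comp_sub_eq_integral (a := v z) hF hd h1.1
  have h5 : ∀ᵐ s ∂volume.restrict (uIoc 0 r),
      F' (v z - ∫ x in (0:ℝ)..s, g (z - x • e)) * g (z - s • e) =
      F' (v (z - s • e)) * g (z - s • e) := by
    rw [uIoc_of_le hr.le]
    filter_upwards [h2] with s hs
    rw [hs]
  refine ⟨h3.congr_ae h5, ?_⟩
  have h6 : v (z - r • e) = v z - ∫ x in (0:ℝ)..r, g (z - x • e) := by rw [← h1.2]; ring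
  rw [h6, h4]
  exact intervalIntegral.integral_congr_ae_restrict h5

theorem LineAC.mul {A : Set (STPt d)} {e : STPt d}
    {v g w k : STPt d → ℝ} (hv : Measurable v) (hg : Measurable g) (hw : Measurable w)
    (hk : Measurable k) (h : LineAC A e v g) (h' : LineAC A e w k) :
    LineAC A e (fun z => v z * w z) (fun z => g z * w z + v z * k z) := by
  intro r hr
  filter_upwards [h r hr, h.ae_ae hv hg r, h' r hr, h'.ae_ae hw hk r] with z h1 h2 h1' h2'
  obtain ⟨h3, h4⟩ := mul_sub_eq_integral (a := v z) (b := w z) h1.1 h1'.1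
  have h5 : ∀ᵐ s ∂volume.restrict (uIoc 0 r),
      g (z - s • e) * (w z - ∫ x in (0:ℝ)..s, k (z - x • e)) +
        (v z - ∫ x in (0:ℝ)..s, g (z - x • e)) * k (z - s • e) =
      g (z - s • e) * w (z - s • e) + v (z - s • e) * k (z - s • e) := by
    rw [uIoc_of_le hr.le]
    filter_upwards [h2, h2'] with s hs hs'
    rw [hs, hs']
  refine ⟨h3.congr_ae h5, ?_⟩
  have h6 : v (z - r • e) = v z - ∫ x in (0:ℝ)..r, g (z - x • e) := by rw [← h1.2]; ring
  have h6' : w (z - r • e) = w z - ∫ x in (0:ℝ)..r, k (z - x • e) := by rw [← h1'.2]; ring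
  rw [h6, h6', h4]
  exact intervalIntegral.integral_congr_ae_restrict h5

theorem LineAC.sub {A : Set (STPt d)} {e : STPt d} {v g w k : STPt d → ℝ}
    (h : LineAC A e v g) (h' : LineAC A e w k) :
    LineAC A e (fun z => v z - w z) (fun z => g z - k z) := by
  intro r hr
  filter_upwards [h r hr, h' r hr] with z h1 h2
  refine ⟨h1.1.sub h2.1, ?_⟩
  rw [intervalIntegral.integral_sub h1.1 h2.1, ← h1.2, ← h2.2]; ring

theorem LineAC.neg {A : Set (STPt d)} {e : STPt d} {v g : STPt d → ℝ}
    (h : LineAC A e v g) : LineAC A e (fun z => -v z) (fun z => -g z) := by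
  intro r hr
  filter_upwards [h r hr] with z h1
  refine ⟨h1.1.neg, ?_⟩
  rw [intervalIntegral.integral_neg, ← h1.2]; ring

/-- Multiplication with a function of time does not affect spatial regularity. -/
theorem LineAC.time_mul {A : Set (STPt d)} {y : Pt d} {v g : STPt d → ℝ}
    (h : LineAC A (0, y) v g) (θ : ℝ → ℝ) :
    LineAC A (0, y) (fun z => θ z.1 * v z) (fun z => θ z.1 * g z) := by
  intro r hr
  filter_upwards [h r hr] with z h1
  have : ∀ s : ℝ, (z - s • ((0, y) : STPt d)).1 = z.1 := by intro s; simp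
  simp only [this]
  refine ⟨h1.1.const_mul _, ?_⟩
  rw [intervalIntegral.integral_const_mul, ← h1.2]; ring

/-! ### Equivalence of weak derivatives and derivatives along lines. -/

theorem contDiff_integral_line {η : STPt d → ℝ} (hη : ContDiff ℝ ((⊤ : ℕ∞) : WithTop ℕ∞) η)
    (hc : HasCompactSupport η) (h : STPt d) :
    ContDiff ℝ ((⊤ : ℕ∞) : WithTop ℕ∞) fun z => ∫ s in (0:ℝ)..1, η (z + s • h) := by
  have hm : Measurable fun s : ℝ => -(s • h) := by fun_prop
  -- The average of η over segments is the convolution of η with the image of Lebesgue measure on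
  -- (0,1] under s ↦ -s h, hence as smooth as η.
  set μ : Measure (STPt d) := (volume.restrict (Ioc (0:ℝ) 1)).map fun s => -(s • h) with hμ
  have : IsFiniteMeasure μ := by rw [hμ]; infer_instance
  have h1 := hc.contDiff_convolution_right (n := ⊤) (μ := μ) (f := fun _ => (1:ℝ))
    (ContinuousLinearMap.mul ℝ ℝ) (integrable_const _).locallyIntegrable hη
  convert h1 using 1
  funext z
  rw [convolution_def, hμ, integral_map hm.aemeasurable, intervalIntegral.integral_of_le zero_le_one]
  · simp
  · apply Continuous.aestronglyMeasurable
    have := hη.continuous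
    fun_prop

/-- A shift by r h turns the integral over [0,1] into the integral over [r,1+r], whose derivative in
r is the difference of the endpoint values. -/
theorem fderiv_integral_line {η : STPt d → ℝ} (hη : ContDiff ℝ ((⊤ : ℕ∞) : WithTop ℕ∞) η)
    (hc : HasCompactSupport η) (h z : STPt d) :
    fderiv ℝ (fun z => ∫ s in (0:ℝ)..1, η (z + s • h)) z h = η (z + h) - η z := by
  have hd : DifferentiableAt ℝ (fun z => ∫ s in (0:ℝ)..1, η (z + s • h)) z :=
    ((contDiff_integral_line hη hc h).differentiable (by simp)).differentiableAt
  have hcont : Continuous fun s : ℝ => η (z + s • h) := by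
    have := hη.continuous
    fun_prop
  have h1 : HasDerivAt (fun r : ℝ => ∫ s in (0:ℝ)..1, η (z + r • h + s • h))
      (fderiv ℝ (fun z => ∫ s in (0:ℝ)..1, η (z + s • h)) z h) 0 := by
    have h2 : HasDerivAt (fun r : ℝ => z + r • h) h 0 := by
      simpa using ((hasDerivAt_id (0:ℝ)).smul_const h).const_add z
    have h3 : HasFDerivAt (fun z => ∫ s in (0:ℝ)..1, η (z + s • h))
      (fderiv ℝ (fun z => ∫ s in (0:ℝ)..1, η (z + s • h)) z) (z + (0:ℝ) • h) := by
      simpa using hd.hasFDerivAt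
    exact h3.comp_hasDerivAt 0 h2
  have h4 : (fun r : ℝ => ∫ s in (0:ℝ)..1, η (z + r • h + s • h)) =
      fun r => (∫ s in (0:ℝ)..(1 + r), η (z + s • h)) - ∫ s in (0:ℝ)..r, η (z + s • h) := by
    funext r
    have : (fun s : ℝ => η (z + r • h + s • h)) = fun s : ℝ => η (z + (s + r) • h) := by
      funext s; congr 1; rw [add_smul]; abel
    rw [this, intervalIntegral.integral_comp_add_right (fun s => η (z + s • h)) r,
      intervalIntegral.integral_interval_sub_left (hcont.intervalIntegrable _ _)
        (hcont.intervalIntegrable _ _)]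
    simp
  rw [h4] at h1
  have h5 : HasDerivAt (fun r => (∫ s in (0:ℝ)..(1 + r), η (z + s • h))
      - ∫ s in (0:ℝ)..r, η (z + s • h)) (η (z + h) - η z) 0 := by
    have e1 : HasDerivAt (fun r => ∫ s in (0:ℝ)..r, η (z + s • h)) (η (z + (0:ℝ) • h)) 0 :=
      intervalIntegral.integral_hasDerivAt_right (hcont.intervalIntegrable _ _)
        (hcont.stronglyMeasurableAtFilter _ _) hcont.continuousAt
    have e2 : HasDerivAt (fun r => ∫ s in (0:ℝ)..r, η (z + s • h))
        (η (z + (1 + 0 : ℝ) • h)) (1 + 0) :=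
      intervalIntegral.integral_hasDerivAt_right (hcont.intervalIntegrable _ _)
        (hcont.stronglyMeasurableAtFilter _ _) hcont.continuousAt
    have e3 := e2.comp_const_add 1 0
    simpa using e3.fun_sub e1
  exact h1.unique h5

theorem exists_bound_of_hasCompactSupport {η : STPt d → ℝ} (hη : Continuous η)
    (hc : HasCompactSupport η) : ∃ C, ∀ z, ‖η z‖ ≤ C := hη.bounded_above_of_compact_support hc

theorem Integrable.mul_of_bound {v : STPt d → ℝ} (hv : Integrable v) {η : STPt d → ℝ}
    (hη : Continuous η) {C : ℝ} (hC : ∀ z, ‖η z‖ ≤ C) : Integrable fun z => v z * η z :=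
  hv.mul_bdd (c := C) hη.aestronglyMeasurable (Filter.Eventually.of_forall hC)

/-- A weak derivative is a derivative along almost every line. -/
theorem lineAC_of_weak {A : Set (STPt d)} (hA : IsOpen A) {e : STPt d}
    (hAe : ∀ z ∈ A, ∀ s : ℝ, 0 ≤ s → z - s • e ∈ A) {v g : STPt d → ℝ}
    (hv : Integrable v) (hgm : Measurable g) (hg : Integrable g)
    (h : HasWeakDeriv univ A e v g) : LineAC A e v g := by
  intro r hr
  have hI := ae_intervalIntegrable_line hgm hg e hr.le
  suffices H : ∀ᵐ z, z ∈ A → v z - v (z - r • e) - ∫ s in (0:ℝ)..r, g (z - s • e) = 0 by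
    rw [ae_restrict_iff' hA.measurableSet]
    filter_upwards [hI, H] with z h1 h2 h3
    exact ⟨h1, by linarith [h2 h3]⟩
  have hLI : Integrable (fun z => ∫ s in (0:ℝ)..r, g (z - s • e)) := by
    simp only [intervalIntegral.integral_of_le hr.le]
    exact (integrable_line_prod hgm hg e 0 r).integral_prod_left
  have hvr : Integrable fun z => v (z - r • e) := hv.comp_sub_right _
  have hsum : Integrable fun z => v z - v (z - r • e) - ∫ s in (0:ℝ)..r, g (z - s • e) :=
    (hv.sub hvr).sub hLI
  refine hA.ae_eq_zero_of_integral_contDiff_smul_eq_zero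
    (hsum.locallyIntegrable.locallyIntegrableOn _) ?_
  intro η hη hηc hηA
  simp only [smul_eq_mul]
  obtain ⟨C, hC⟩ := exists_bound_of_hasCompactSupport hη.continuous hηc
  -- The test function is the average of η over backward-attached segments of length r. Since r
  -- ∂ₑφ(z) = η(z + r e) - η(z), the weak identity for φ becomes the line identity integrated
  -- against η.
  set φ : STPt d → ℝ := fun z => ∫ s in (0:ℝ)..1, η (z + s • (r • e)) with hφ
  have hφs : ContDiff ℝ ((⊤ : ℕ∞) : WithTop ℕ∞) φ := contDiff_integral_line hη hηc _
  -- This compact set contains the support of φ. It lies in A because A is stable under steps in the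
  -- direction -e.
  set k : Set (STPt d) := (fun p : ℝ × STPt d => p.2 - p.1 • (r • e)) '' (Icc 0 1 ×ˢ tsupport η)
    with hk
  have hkc : IsCompact k := (isCompact_Icc.prod hηc).image (by fun_prop)
  have hkA : k ⊆ A := by
    rintro _ ⟨⟨s, z⟩, ⟨hs, hz⟩, rfl⟩
    simp only [smul_smul]
    exact hAe _ (hηA hz) _ (mul_nonneg hs.1 hr.le)
  have hφ0 : ∀ z, z ∉ k → φ z = 0 := by
    intro z hz
    rw [hφ]
    simp only
    rw [intervalIntegral.integral_congr (g := fun _ => (0:ℝ)), intervalIntegral.integral_zero]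
    intro s hs
    rw [uIcc_of_le zero_le_one] at hs
    by_contra hne
    refine hz ⟨(s, z + s • (r • e)), ⟨hs, subset_tsupport _ hne⟩, by simp⟩
  have hφc : HasCompactSupport φ := HasCompactSupport.intro hkc hφ0
  have hφA : tsupport φ ⊆ A :=
    (closure_minimal (fun z hz => by by_contra hzk; exact hz (hφ0 z hzk)) hkc.isClosed).trans hkA
  have hw := h φ hφs hφc hφA
  simp only [Measure.restrict_univ] at hw
  have hfd : ∀ z, r * fderiv ℝ φ z e = η (z + r • e) - η z := by
    intro z
    rw [← fderiv_integral_line hη hηc (r • e) z, map_smul, smul_eq_mul]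
  have e1 : ∫ z, v z * (η (z + r • e) - η z) = -∫ z, r * (g z * φ z) := by
    rw [integral_const_mul, ← mul_neg, ← hw, ← integral_const_mul]
    congr 1; funext z; rw [← hfd]; ring
  have hηr : Continuous fun z => η (z + r • e) := hη.continuous.comp (by fun_prop)
  have e2 : ∫ z, v z * (η (z + r • e) - η z) = (∫ z, η z * v (z - r • e)) - ∫ z, η z * v z := by
    have : (fun z => v z * (η (z + r • e) - η z)) =
        fun z => v z * η (z + r • e) - v z * η z := by funext z; ring
    rw [this, integral_sub (Integrable.mul_of_bound hv hηr (fun z => hC _))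
      (Integrable.mul_of_bound hv hη.continuous hC)]
    congr 1
    · rw [← integral_sub_right_eq_self _ (r • e)]
      congr 1; funext z; simp [mul_comm]
    · congr 1; funext z; ring
  have e3 : ∫ z, r * (g z * φ z) = ∫ z, η z * ∫ s in (0:ℝ)..r, g (z - s • e) := by
    have hφr : ∀ z, r * φ z = ∫ s in Ioc (0:ℝ) r, η (z + s • e) := by
      intro z
      rw [← intervalIntegral.integral_of_le hr.le, hφ]
      simp only [smul_smul]
      rw [← smul_eq_mul, intervalIntegral.smul_integral_comp_mul_right (fun s => η (z + s • e))]
      simp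
    have hlp := integrable_line_prod hgm hg e 0 r
    have hlp' : Integrable (fun p : STPt d × ℝ => g p.1 * η (p.1 + p.2 • e))
        (volume.prod (volume.restrict (Ioc 0 r))) := by
      refine Integrable.mul_bdd (c := C) (hg.comp_fst _) ?_ (Filter.Eventually.of_forall fun p => hC _)
      apply Continuous.aestronglyMeasurable
      have := hη.continuous
      fun_prop
    have hlp2 : Integrable (fun p : STPt d × ℝ => η p.1 * g (p.1 - p.2 • e))
        (volume.prod (volume.restrict (Ioc 0 r))) := by
      refine Integrable.bdd_mul (c := C) hlp ?_ (Filter.Eventually.of_forall fun p => hC _)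
      apply Continuous.aestronglyMeasurable
      have := hη.continuous
      fun_prop
    calc ∫ z, r * (g z * φ z) = ∫ z, ∫ s in Ioc (0:ℝ) r, g z * η (z + s • e) := by
          congr 1; funext z
          rw [integral_const_mul, ← hφr]; ring
      _ = ∫ s in Ioc (0:ℝ) r, ∫ z, g z * η (z + s • e) := integral_integral_swap hlp'
      _ = ∫ s in Ioc (0:ℝ) r, ∫ z, η z * g (z - s • e) := by
          congr 1; funext s
          rw [← integral_sub_right_eq_self _ (s • e)]
          congr 1; funext z; simp [mul_comm]
      _ = ∫ z, ∫ s in Ioc (0:ℝ) r, η z * g (z - s • e) := (integral_integral_swap hlp2).symm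
      _ = _ := by
          congr 1; funext z
          rw [integral_const_mul, intervalIntegral.integral_of_le hr.le]
  have hi1 := Integrable.mul_of_bound hv hη.continuous hC
  have hi2 := Integrable.mul_of_bound hvr hη.continuous hC
  have hi3 := Integrable.mul_of_bound hLI hη.continuous hC
  have : (fun z => η z * (v z - v (z - r • e) - ∫ s in (0:ℝ)..r, g (z - s • e))) = fun z =>
      v z * η z - v (z - r • e) * η z - (∫ s in (0:ℝ)..r, g (z - s • e)) * η z := by
    funext z; ring
  have goal1 : ∫ z, η z * (v z - v (z - r • e) - ∫ s in (0:ℝ)..r, g (z - s • e)) =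
      (∫ z, v z * η z) - (∫ z, v (z - r • e) * η z)
        - ∫ z, (∫ s in (0:ℝ)..r, g (z - s • e)) * η z := by
    rw [this]
    rw [← integral_sub hi1 hi2]; exact integral_sub (hi1.sub hi2) hi3
  rw [goal1]
  rw [e2, e3] at e1
  simp only [mul_comm (η _)] at e1
  linarith

/-- A derivative along almost every line is a weak derivative. -/
theorem weak_of_lineAC {A : Set (STPt d)} (hA : IsOpen A) {e : STPt d} {v g : STPt d → ℝ}
    (hv : Integrable v) (hgm : Measurable g) (hg : Integrable g)
    (h : LineAC A e v g) : HasWeakDeriv univ A e v g := by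
  intro φ hφ hφc hφA
  simp only [Measure.restrict_univ]
  obtain ⟨C, hC⟩ := exists_bound_of_hasCompactSupport hφ.continuous hφc
  have hφ1 : Continuous (fderiv ℝ φ) := hφ.continuous_fderiv (by simp)
  have hfdc : Continuous fun z => fderiv ℝ φ z e := hφ1.clm_apply continuous_const
  obtain ⟨D, hD⟩ := exists_bound_of_hasCompactSupport hfdc (hφc.fderiv_apply ℝ e)
  have hsc : ∀ s : ℝ, Continuous fun z => φ (z + s • e) := fun s =>
    hφ.continuous.comp (by fun_prop)
  -- Both sides of the weak identity are recognized as the derivative at r = 0 of ∫ v φ(· + r e).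
  have hJ : HasDerivAt (fun r : ℝ => ∫ z, v z * φ (z + r • e)) (∫ z, v z * fderiv ℝ φ z e) 0 := by
    have := hasDerivAt_integral_of_dominated_loc_of_deriv_le (μ := volume) (𝕜 := ℝ)
      (F := fun (r : ℝ) z => v z * φ (z + r • e))
      (F' := fun (r : ℝ) z => v z * fderiv ℝ φ (z + r • e) e) (x₀ := 0) (s := univ)
      (bound := fun z => ‖v z‖ * D) Filter.univ_mem ?_ ?_ ?_ ?_ ?_ ?_
    · simpa using this.2
    · exact Filter.Eventually.of_forall fun r =>
        (Integrable.mul_of_bound hv (hsc r) (fun z => hC _)).aestronglyMeasurable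
    · exact Integrable.mul_of_bound hv (hsc 0) (fun z => hC _)
    · exact (Integrable.mul_of_bound hv (η := fun z => fderiv ℝ φ (z + (0:ℝ) • e) e)
        (hfdc.comp (f := fun z => z + (0:ℝ) • e) (by fun_prop)) (fun z => hD _)).aestronglyMeasurable
    · refine Filter.Eventually.of_forall fun z r _ => ?_
      rw [norm_mul]
      exact mul_le_mul_of_nonneg_left (hD _) (norm_nonneg _)
    · exact hv.norm.mul_const _
    · refine Filter.Eventually.of_forall fun z r _ => ?_
      have h2 : HasDerivAt (fun r : ℝ => z + r • e) e r := by
        simpa using ((hasDerivAt_id r).smul_const e).const_add z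
      have h3 : HasFDerivAt φ (fderiv ℝ φ (z + r • e)) (z + r • e) :=
        ((hφ.differentiable (by simp)) _).hasFDerivAt
      exact (h3.comp_hasDerivAt r h2).const_mul (v z)
  have hH : Continuous fun s : ℝ => ∫ z, g z * φ (z + s • e) := by
    refine continuous_of_dominated (bound := fun z => ‖g z‖ * C) ?_ ?_ (hg.norm.mul_const _) ?_
    · exact fun s => (Integrable.mul_of_bound hg (hsc s) (fun z => hC _)).aestronglyMeasurable
    · intro s
      refine Filter.Eventually.of_forall fun z => ?_
      rw [norm_mul]
      exact mul_le_mul_of_nonneg_left (hC _) (norm_nonneg _)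
    · refine Filter.Eventually.of_forall fun z => ?_
      have := hφ.continuous
      fun_prop
  have hK : HasDerivAt (fun r : ℝ => (∫ z, v z * φ z) - ∫ s in (0:ℝ)..r, ∫ z, g z * φ (z + s • e))
      (-∫ z, g z * φ z) 0 := by
    have e1 : HasDerivAt (fun r => ∫ s in (0:ℝ)..r, ∫ z, g z * φ (z + s • e))
        (∫ z, g z * φ (z + (0:ℝ) • e)) 0 :=
      intervalIntegral.integral_hasDerivAt_right (hH.intervalIntegrable _ _)
        (hH.stronglyMeasurableAtFilter _ _) hH.continuousAt
    simpa using e1.const_sub (∫ z, v z * φ z)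
  -- The line identity only looks backwards, so the formula holds for r ≥ 0; one-sided derivatives
  -- at 0 are compared at the end.
  have hEq : ∀ r ∈ Ici (0:ℝ), (∫ z, v z * φ (z + r • e)) =
      (∫ z, v z * φ z) - ∫ s in (0:ℝ)..r, ∫ z, g z * φ (z + s • e) := by
    intro r hr
    rcases (mem_Ici.1 hr).eq_or_lt with rfl | hr
    · simp
    have hlp2 : Integrable (fun p : STPt d × ℝ => φ p.1 * g (p.1 - p.2 • e))
        (volume.prod (volume.restrict (Ioc 0 r))) := by
      refine Integrable.bdd_mul (c := C) (integrable_line_prod hgm hg e 0 r) ?_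
        (Filter.Eventually.of_forall fun p => hC _)
      apply Continuous.aestronglyMeasurable
      have := hφ.continuous
      fun_prop
    have hvr : Integrable fun z => v (z - r • e) := hv.comp_sub_right _
    have a1 : ∫ z, v z * φ (z + r • e) = ∫ z, v (z - r • e) * φ z := by
      rw [← integral_sub_right_eq_self _ (r • e)]
      congr 1; funext z; simp
    have a2 : ∫ z, φ z * (v z - v (z - r • e)) =
        ∫ z, φ z * ∫ s in (0:ℝ)..r, g (z - s • e) := by
      apply integral_congr_ae
      have := h r hr
      rw [ae_restrict_iff' hA.measurableSet] at this
      filter_upwards [this] with z hz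
      by_cases hzA : z ∈ A
      · rw [(hz hzA).2]
      · have : φ z = 0 := by
          by_contra hne
          exact hzA (hφA (subset_tsupport _ hne))
        rw [this]; simp
    have a3 : ∫ z, φ z * ∫ s in (0:ℝ)..r, g (z - s • e) =
        ∫ s in (0:ℝ)..r, ∫ z, g z * φ (z + s • e) := by
      rw [intervalIntegral.integral_of_le hr.le]
      calc ∫ z, φ z * ∫ s in (0:ℝ)..r, g (z - s • e)
          = ∫ z, ∫ s in Ioc (0:ℝ) r, φ z * g (z - s • e) := by
            congr 1; funext z
            rw [integral_const_mul, intervalIntegral.integral_of_le hr.le]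
        _ = ∫ s in Ioc (0:ℝ) r, ∫ z, φ z * g (z - s • e) := integral_integral_swap hlp2
        _ = _ := by
            congr 1; funext s
            rw [← integral_sub_right_eq_self (fun z => g z * φ (z + s • e)) (s • e)]
            congr 1; funext z; simp [mul_comm]
    have a4 : ∫ z, φ z * (v z - v (z - r • e)) =
        (∫ z, v z * φ z) - ∫ z, v (z - r • e) * φ z := by
      rw [← integral_sub (Integrable.mul_of_bound hv hφ.continuous hC)
        (Integrable.mul_of_bound hvr hφ.continuous hC)]
      congr 1; funext z; ring
    rw [a1, ← a3, ← a2, a4]; ring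
  have h0 := hEq 0 self_mem_Ici
  exact (uniqueDiffOn_Ici (0:ℝ) 0 self_mem_Ici).eq_deriv _ hJ.hasDerivWithinAt
    (hK.hasDerivWithinAt.congr (fun r hr => hEq r hr) h0)

/-! ### Representatives of Sobolev functions -/

theorem measurableSet_cyl {T : ℝ} {ω : Set (Pt d)} (hω : MeasurableSet ω) :
    MeasurableSet (cyl T ω) := measurableSet_Ioo.prod hω

theorem volume_cyl_lt_top {T : ℝ} {ω : Set (Pt d)} (hb : Bornology.IsBounded ω) :
    volume (cyl T ω) < ∞ := by
  rw [cyl, Measure.volume_eq_prod, Measure.prod_prod]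
  exact ENNReal.mul_lt_top measure_Ioo_lt_top hb.measure_lt_top

theorem isFiniteMeasure_restrict_cyl {T : ℝ} {ω : Set (Pt d)} (hb : Bornology.IsBounded ω) :
    IsFiniteMeasure (volume.restrict (cyl T ω)) :=
  ⟨by rw [Measure.restrict_apply_univ]; exact volume_cyl_lt_top hb⟩

/-- A measurable function vanishing outside the cylinder that is absolutely continuous along almost
every line in space. -/
structure H10 (T : ℝ) (ω : Set (Pt d)) (v : STPt d → ℝ) (g : STPt d → Pt d) : Prop where
  meas_val : Measurable v
  meas_grad : Measurable g
  val_zero : ∀ z ∉ cyl T ω, v z = 0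
  grad_zero : ∀ z ∉ cyl T ω, g z = 0
  memLp_val : MemLp v 2 volume
  memLp_grad : MemLp g 2 volume
  lineAC : ∀ y : Pt d, LineAC (Ioo 0 T ×ˢ univ) (0, y) v (fun z => ⟪g z, y⟫)

theorem integrable_of_memLp_two {E : Type*} [NormedAddCommGroup E] {Q : Set (STPt d)}
    (hQ : MeasurableSet Q) (hf : volume Q < ∞) {v : STPt d → E}
    (h0 : ∀ z ∉ Q, v z = 0) (hv : MemLp v 2 volume) : Integrable v := by
  have h1 : IsFiniteMeasure (volume.restrict Q) := ⟨by rwa [Measure.restrict_apply_univ]⟩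
  have h2 : Integrable v (volume.restrict Q) := (hv.restrict Q).integrable (by norm_num)
  have h3 : Q.indicator v = v := indicator_eq_self.2 fun z hz => by
    by_contra h; exact hz (h0 z h)
  rw [← h3]
  exact IntegrableOn.integrable_indicator h2 hQ

/-- Vanishing on the part of the boundary inside A means that the extension by zero has no singular
derivative there. After the extension boundary values need no separate treatment. -/
theorem hasWeakDeriv_iff_univ {Q A : Set (STPt d)} {e : STPt d}
    {v g v' g' : STPt d → ℝ} (hv0 : ∀ z ∉ Q, v' z = 0) (hg0 : ∀ z ∉ Q, g' z = 0)
    (hv : v =ᵐ[volume.restrict Q] v') (hg : g =ᵐ[volume.restrict Q] g') :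
    HasWeakDeriv Q A e v g ↔ HasWeakDeriv univ A e v' g' := by
  have key : ∀ (a b φ : STPt d → ℝ), (∀ z ∉ Q, b z = 0) → a =ᵐ[volume.restrict Q] b →
      ∫ z in Q, a z * φ z = ∫ z in univ, b z * φ z := by
    intro a b φ hb hab
    rw [Measure.restrict_univ, ← setIntegral_eq_integral_of_forall_compl_eq_zero (s := Q)
      (f := fun z => b z * φ z) (fun z hz => by rw [hb z hz, zero_mul])]
    apply integral_congr_ae
    filter_upwards [hab] with z hz
    rw [hz]
  unfold HasWeakDeriv
  refine forall_congr' fun φ => forall_congr' fun _ => forall_congr' fun _ => forall_congr' fun _ => ?_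
  rw [key v v' _ hv0 hv, key g g' _ hg0 hg]

theorem exists_zero_extension {E : Type*} [NormedAddCommGroup E] [MeasurableSpace E] [BorelSpace E]
    {Q : Set (STPt d)} (hQ : MeasurableSet Q) {v : STPt d → E}
    (hv : MemLp v 2 (volume.restrict Q)) :
    ∃ v' : STPt d → E, Measurable v' ∧ (∀ z ∉ Q, v' z = 0) ∧ MemLp v' 2 volume ∧
      v =ᵐ[volume.restrict Q] v' := by
  refine ⟨Q.indicator (hv.1.mk v), hv.1.stronglyMeasurable_mk.measurable.indicator hQ,
    fun z hz => indicator_of_notMem hz _, ?_, ?_⟩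
  · rw [memLp_indicator_iff_restrict hQ]
    exact hv.ae_eq hv.1.ae_eq_mk
  · filter_upwards [hv.1.ae_eq_mk, ae_restrict_mem hQ] with z hz hz2
    rw [indicator_of_mem hz2, hz]

theorem isOpen_slab (T : ℝ) : IsOpen (Ioo 0 T ×ˢ univ : Set (STPt d)) := isOpen_Ioo.prod isOpen_univ

theorem MemH10Zero.exists_H10 {T : ℝ} {ω : Set (Pt d)} (hω : MeasurableSet ω)
    (hb : Bornology.IsBounded ω) {v : STPt d → ℝ} {g : STPt d → Pt d} (h : MemH10Zero T ω v g) :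
    ∃ v' g', H10 T ω v' g' ∧ v =ᵐ[volume.restrict (cyl T ω)] v' ∧
      g =ᵐ[volume.restrict (cyl T ω)] g' := by
  have hQ := measurableSet_cyl (T := T) hω
  obtain ⟨v', hv1, hv2, hv3, hv4⟩ := exists_zero_extension hQ h.memLp_val
  obtain ⟨g', hg1, hg2, hg3, hg4⟩ := exists_zero_extension hQ h.memLp_grad
  refine ⟨v', g', ⟨hv1, hg1, hv2, hg2, hv3, hg3, fun y => ?_⟩, hv4, hg4⟩
  refine lineAC_of_weak (isOpen_slab T) ?_ (integrable_of_memLp_two hQ (volume_cyl_lt_top hb) hv2 hv3)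
    (by fun_prop)
    ((integrable_of_memLp_two hQ (volume_cyl_lt_top hb) hg2 hg3).inner_const y) ?_
  · rintro ⟨t, x⟩ hz s -
    simpa using hz
  · refine (hasWeakDeriv_iff_univ hv2 (fun z hz => by simp [hg2 z hz]) hv4 ?_).1 (h.weak_grad y)
    filter_upwards [hg4] with z hz
    rw [hz]

theorem H10.integrable_val {T : ℝ} {ω : Set (Pt d)} (hω : MeasurableSet ω)
    (hb : Bornology.IsBounded ω) {v : STPt d → ℝ} {g : STPt d → Pt d} (h : H10 T ω v g) :
    Integrable v :=
  integrable_of_memLp_two (measurableSet_cyl hω) (volume_cyl_lt_top hb) h.val_zero h.memLp_val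

theorem H10.integrable_grad {T : ℝ} {ω : Set (Pt d)} (hω : MeasurableSet ω)
    (hb : Bornology.IsBounded ω) {v : STPt d → ℝ} {g : STPt d → Pt d} (h : H10 T ω v g) :
    Integrable g :=
  integrable_of_memLp_two (measurableSet_cyl hω) (volume_cyl_lt_top hb) h.grad_zero h.memLp_grad

theorem H10.memH10Zero {T : ℝ} {ω : Set (Pt d)} (hω : MeasurableSet ω)
    (hb : Bornology.IsBounded ω) {v : STPt d → ℝ} {g : STPt d → Pt d} (h : H10 T ω v g) :
    MemH10Zero T ω v g where
  memLp_val := h.memLp_val.restrict _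
  memLp_grad := h.memLp_grad.restrict _
  weak_grad y := by
    refine (hasWeakDeriv_iff_univ h.val_zero
      (fun z hz => by simp [h.grad_zero z hz]) .rfl .rfl).2 ?_
    have := h.meas_grad
    exact weak_of_lineAC (isOpen_slab T) (h.integrable_val hω hb) (by fun_prop)
      ((h.integrable_grad hω hb).inner_const y) (h.lineAC y)

theorem HasWeakDeriv.sub {Q A : Set (STPt d)} {e : STPt d} {v g w k : STPt d → ℝ}
    (hv : Integrable v (volume.restrict Q)) (hg : Integrable g (volume.restrict Q))
    (hw : Integrable w (volume.restrict Q)) (hk : Integrable k (volume.restrict Q))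
    (h : HasWeakDeriv Q A e v g) (h' : HasWeakDeriv Q A e w k) :
    HasWeakDeriv Q A e (v - w) (g - k) := by
  intro φ h1 h2 h3
  obtain ⟨C, hC⟩ := exists_bound_of_hasCompactSupport h1.continuous h2
  have hfdc : Continuous fun z => fderiv ℝ φ z e :=
    (h1.continuous_fderiv (by simp)).clm_apply continuous_const
  obtain ⟨D, hD⟩ := exists_bound_of_hasCompactSupport hfdc (h2.fderiv_apply ℝ e)
  have i1 : ∀ {f : STPt d → ℝ}, Integrable f (volume.restrict Q) →
      Integrable (fun z => f z * φ z) (volume.restrict Q) := fun hf =>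
    hf.mul_bdd (c := C) h1.continuous.aestronglyMeasurable (Filter.Eventually.of_forall hC)
  have i2 : ∀ {f : STPt d → ℝ}, Integrable f (volume.restrict Q) →
      Integrable (fun z => f z * fderiv ℝ φ z e) (volume.restrict Q) := fun hf =>
    hf.mul_bdd (c := D) hfdc.aestronglyMeasurable (Filter.Eventually.of_forall hD)
  simp only [Pi.sub_apply, sub_mul]
  rw [integral_sub (i2 hv) (i2 hw), integral_sub (i1 hg) (i1 hk), h φ h1 h2 h3, h' φ h1 h2 h3]
  ring

theorem MemH10Zero.sub {T : ℝ} {ω : Set (Pt d)} (hb : Bornology.IsBounded ω)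
    {v w : STPt d → ℝ} {g k : STPt d → Pt d}
    (h : MemH10Zero T ω v g) (h' : MemH10Zero T ω w k) : MemH10Zero T ω (v - w) (g - k) where
  memLp_val := h.memLp_val.sub h'.memLp_val
  memLp_grad := h.memLp_grad.sub h'.memLp_grad
  weak_grad y := by
    have := isFiniteMeasure_restrict_cyl (T := T) hb
    have := HasWeakDeriv.sub (h.memLp_val.integrable (by norm_num))
      ((h.memLp_grad.integrable (by norm_num)).inner_const y)
      (h'.memLp_val.integrable (by norm_num))
      ((h'.memLp_grad.integrable (by norm_num)).inner_const y) (h.weak_grad y) (h'.weak_grad y)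
    convert this using 1
    funext z
    simp [inner_sub_left]

theorem MemH11ZeroZero.sub {T : ℝ} {Ω : Set (Pt d)} (hb : Bornology.IsBounded Ω) {v w : STFun d}
    (h : MemH11ZeroZero T Ω v) (h' : MemH11ZeroZero T Ω w) : MemH11ZeroZero T Ω (v - w) where
  memH10 := h.memH10.sub hb h'.memH10
  memLp_dt := h.memLp_dt.sub h'.memLp_dt
  weak_dt := by
    have := isFiniteMeasure_restrict_cyl (T := T) hb
    exact HasWeakDeriv.sub (h.memH10.memLp_val.integrable (by norm_num))
      (h.memLp_dt.integrable (by norm_num)) (h'.memH10.memLp_val.integrable (by norm_num))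
      (h'.memLp_dt.integrable (by norm_num)) h.weak_dt h'.weak_dt

/-- Representatives of functions with zero initial values. -/
structure H11 (T : ℝ) (Ω : Set (Pt d)) (v : STFun d) : Prop extends H10 T Ω v.val v.grad where
  meas_dt : Measurable v.dt
  dt_zero : ∀ z ∉ cyl T Ω, v.dt z = 0
  memLp_dt : MemLp v.dt 2 volume
  ftc : ∀ᵐ z ∂volume.restrict (cyl T Ω), v.val z = ∫ s in (0:ℝ)..z.1, v.dt (s, z.2)

theorem H11.integrable_dt {T : ℝ} {Ω : Set (Pt d)} (hω : MeasurableSet Ω)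
    (hb : Bornology.IsBounded Ω) {v : STFun d} (h : H11 T Ω v) : Integrable v.dt :=
  integrable_of_memLp_two (measurableSet_cyl hω) (volume_cyl_lt_top hb) h.dt_zero h.memLp_dt

theorem isOpen_past {T : ℝ} {Ω : Set (Pt d)} (hΩ : IsOpen Ω) : IsOpen (Iio T ×ˢ Ω : Set (STPt d)) :=
  isOpen_Iio.prod hΩ

theorem MemH11ZeroZero.exists_H11 {T : ℝ} (hT : 0 < T) {Ω : Set (Pt d)} (hΩ : IsOpen Ω)
    (hb : Bornology.IsBounded Ω) {v : STFun d} (h : MemH11ZeroZero T Ω v) :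
    ∃ v', H11 T Ω v' ∧ v.val =ᵐ[volume.restrict (cyl T Ω)] v'.val ∧
      v.grad =ᵐ[volume.restrict (cyl T Ω)] v'.grad ∧
      v.dt =ᵐ[volume.restrict (cyl T Ω)] v'.dt := by
  have hQ := measurableSet_cyl (T := T) hΩ.measurableSet
  obtain ⟨v', g', hv', h1, h2⟩ := h.memH10.exists_H10 hΩ.measurableSet hb
  obtain ⟨k', hk1, hk2, hk3, hk4⟩ := exists_zero_extension hQ h.memLp_dt
  refine ⟨⟨v', g', k'⟩, ⟨hv', hk1, hk2, hk3, ?_⟩, h1, h2, hk4⟩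
  have hL : LineAC (Iio T ×ˢ Ω) (1, 0) v' k' := by
    refine lineAC_of_weak (isOpen_past hΩ) ?_ (hv'.integrable_val hΩ.measurableSet hb) hk1
      (integrable_of_memLp_two hQ (volume_cyl_lt_top hb) hk2 hk3) ?_
    · rintro ⟨t, x⟩ ⟨ht, hx⟩ s hs
      simp only [mem_Iio] at ht
      simpa using ⟨by linarith, hx⟩
    · exact (hasWeakDeriv_iff_univ hv'.val_zero hk2 h1 hk4).1 h.weak_dt
  have hsub : cyl T Ω ⊆ Iio T ×ˢ Ω := prod_mono (fun t ht => ht.2) subset_rfl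
  filter_upwards [ae_restrict_of_ae_restrict_of_subset hsub (hL T hT), ae_restrict_mem hQ]
    with z hz hzQ
  obtain ⟨t, x⟩ := z
  have ht : t ∈ Ioo 0 T := hzQ.1
  -- A step of length T back in time from a point of the cylinder ends at a negative time, where the
  -- extension vanishes. Here the zero initial value enters.
  have h3 : v' ((t, x) - T • ((1, 0) : STPt d)) = 0 := by
    apply hv'.val_zero
    rintro ⟨h4, -⟩
    simp at h4
    linarith [ht.2, h4.1]
  have h5 := hz.2
  have h6 : ∀ s : ℝ, (t, x) - s • ((1, 0) : STPt d) = (t - s, x) := by intro s; simp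
  simp only [h6] at h5 h3
  rw [h3, sub_zero] at h5
  simp only
  rw [h5, intervalIntegral.integral_comp_sub_left (fun s => k' (s, x)) t, sub_zero]
  have hz1 := hz.1
  simp only [h6] at hz1
  have h7 : IntervalIntegrable (fun s => k' (s, x)) volume (t - 0) (t - T) := by
    have := hz1.comp_sub_left t
    simpa using this
  rw [← intervalIntegral.integral_add_adjacent_intervals (b := 0)]
  · rw [intervalIntegral.integral_congr (g := fun _ => (0:ℝ)), intervalIntegral.integral_zero, zero_add]
    intro s hs
    rw [uIcc_of_le (by linarith [ht.2])] at hs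
    exact hk2 _ fun hmem => absurd hmem.1.1 (not_lt.2 hs.2)
  · refine h7.symm.mono_set ?_
    rw [sub_zero, uIcc_of_le (by linarith [ht.2]), uIcc_of_le (by linarith [ht.2, ht.1])]
    exact Icc_subset_Icc_right ht.1.le
  · refine h7.symm.mono_set ?_
    rw [sub_zero, uIcc_of_le ht.1.le, uIcc_of_le (by linarith [ht.2, ht.1])]
    exact Icc_subset_Icc_left (by linarith [ht.2])

theorem ae_of_ae_space {p : Pt d → Prop} (h : ∀ᵐ x, p x) : ∀ᵐ z : STPt d, p z.2 :=
  (Measure.quasiMeasurePreserving_snd (μ := (volume : Measure ℝ))).ae h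

theorem ae_of_ae_time {p : ℝ → Prop} (h : ∀ᵐ x, p x) : ∀ᵐ z : STPt d, p z.1 :=
  (Measure.quasiMeasurePreserving_fst (ν := (volume : Measure (Pt d)))).ae h

theorem ae_integrable_time {g : STPt d → ℝ} (hg : Integrable g) :
    ∀ᵐ x : Pt d, Integrable (fun t => g (t, x)) :=
  hg.prod_left_ae

theorem H11.memH11ZeroZero {T : ℝ} {Ω : Set (Pt d)} (hΩ : IsOpen Ω)
    (hb : Bornology.IsBounded Ω) {v : STFun d} (h : H11 T Ω v) : MemH11ZeroZero T Ω v where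
  memH10 := h.memH10Zero hΩ.measurableSet hb
  memLp_dt := h.memLp_dt.restrict _
  weak_dt := by
    have hQ := measurableSet_cyl (T := T) hΩ.measurableSet
    refine (hasWeakDeriv_iff_univ h.val_zero h.dt_zero .rfl .rfl).2 ?_
    refine weak_of_lineAC (isOpen_past hΩ) (h.integrable_val hΩ.measurableSet hb) h.meas_dt
      (h.integrable_dt hΩ.measurableSet hb) ?_
    intro r hr
    have h6 : ∀ (z : STPt d) (s : ℝ), z - s • ((1, 0) : STPt d) = (z.1 - s, z.2) := by
      intro z s; ext <;> simp
    have h0 : ∀ x (a b : ℝ), a ≤ 0 → b ≤ 0 → ∫ s in a..b, v.dt (s, x) = 0 := by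
      intro x a b ha hb
      rw [intervalIntegral.integral_congr (g := fun _ => (0:ℝ)), intervalIntegral.integral_zero]
      intro s hs
      refine h.dt_zero _ fun hmem => absurd hmem.1.1 (not_lt.2 ?_)
      rcases mem_uIcc.1 hs with h | h <;> linarith
    -- For nonpositive times both sides vanish, so the formula extends to the whole past and two
    -- instances of it can be subtracted.
    have h1 : ∀ᵐ z : STPt d, z ∈ Iio T ×ˢ Ω → v.val z = ∫ s in (0:ℝ)..z.1, v.dt (s, z.2) := by
      have := h.ftc
      rw [ae_restrict_iff' hQ] at this
      filter_upwards [this] with z hz hzA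
      by_cases hz0 : 0 < z.1
      · exact hz ⟨⟨hz0, hzA.1⟩, hzA.2⟩
      · rw [h0 z.2 0 z.1 le_rfl (not_lt.1 hz0)]
        exact h.val_zero _ fun hmem => hz0 hmem.1.1
    have h2 : ∀ᵐ z : STPt d, z - r • ((1, 0) : STPt d) ∈ Iio T ×ˢ Ω →
        v.val (z - r • ((1, 0) : STPt d)) =
          ∫ s in (0:ℝ)..(z - r • ((1, 0) : STPt d)).1, v.dt (s, (z - r • ((1, 0) : STPt d)).2) :=
      (measurePreserving_sub_right volume (r • ((1, 0) : STPt d))).quasiMeasurePreserving.ae h1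
    have h3 := ae_of_ae_space (ae_integrable_time (h.integrable_dt hΩ.measurableSet hb))
    rw [ae_restrict_iff' (isOpen_past hΩ).measurableSet]
    filter_upwards [h1, h2, h3] with z hz1 hz2 hz3 hzA
    simp only [h6] at hz2 ⊢
    have hi : ∀ a b, IntervalIntegrable (fun s => v.dt (s, z.2)) volume a b := fun a b =>
      hz3.intervalIntegrable
    refine ⟨by simpa using (hi z.1 (z.1 - r)).comp_sub_left z.1, ?_⟩
    have hlt : z.1 < T := hzA.1
    rw [hz1 hzA, hz2 ⟨by simp only [mem_Iio]; linarith, hzA.2⟩,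
      intervalIntegral.integral_interval_sub_left (hi _ _) (hi _ _),
      intervalIntegral.integral_comp_sub_left (fun s => v.dt (s, z.2)) z.1, sub_zero]

/-! ### Poincaré inequalities -/

theorem sq_lintegral_mul_le {α : Type*} [MeasurableSpace α] {μ : Measure α} {f g : α → ℝ≥0∞}
    (hf : AEMeasurable f μ) (hg : AEMeasurable g μ) :
    (∫⁻ x, f x * g x ∂μ) ^ 2 ≤ (∫⁻ x, f x ^ 2 ∂μ) * ∫⁻ x, g x ^ 2 ∂μ := by
  have h := ENNReal.lintegral_mul_le_Lp_mul_Lq μ Real.HolderConjugate.two_two hf hg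
  simp only [Pi.mul_apply] at h
  have h2 := pow_le_pow_left₀ (zero_le (a := ∫⁻ x, f x * g x ∂μ)) h 2
  rw [mul_pow, ← ENNReal.rpow_natCast, ← ENNReal.rpow_natCast, ← ENNReal.rpow_natCast,
    ← ENNReal.rpow_mul, ← ENNReal.rpow_mul] at h2
  simpa using h2

theorem sq_lintegral_le {α : Type*} [MeasurableSpace α] {μ : Measure α} {f : α → ℝ≥0∞}
    (hf : AEMeasurable f μ) : (∫⁻ x, f x ∂μ) ^ 2 ≤ μ univ * ∫⁻ x, f x ^ 2 ∂μ := by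
  have h := sq_lintegral_mul_le (g := fun _ => 1) hf aemeasurable_const
  simpa [mul_comm] using h

theorem add_sq_le_two_mul (a b : ℝ≥0∞) : (a + b) ^ 2 ≤ 2 * a ^ 2 + 2 * b ^ 2 := by
  rcases eq_or_ne a ∞ with rfl | ha
  · simp
  rcases eq_or_ne b ∞ with rfl | hb
  · simp
  lift a to NNReal using ha
  lift b to NNReal using hb
  norm_cast
  have : ((a : ℝ) + b) ^ 2 ≤ 2 * a ^ 2 + 2 * b ^ 2 := by nlinarith [sq_nonneg ((a : ℝ) - b)]
  exact_mod_cast this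

/-- The difference is the integral of the gradient along the segment from x - y to x. By convexity
the segment stays in K when both endpoints do, which the indicator ensures, and translation
invariance removes the shift. -/
theorem H10.lintegral_translate_le {T : ℝ} {Ω : Set (Pt d)} {v : STPt d → ℝ} {g : STPt d → Pt d}
    (h : H10 T Ω v g) {I : Set ℝ} (hI : I ⊆ Ioo 0 T) (hIm : MeasurableSet I) {K : Set (Pt d)}
    (hK : Convex ℝ K) (hKm : MeasurableSet K) (y : Pt d) :
    ∫⁻ z in I ×ˢ K, K.indicator 1 (z.2 - y) * ‖v z - v (z.1, z.2 - y)‖ₑ ^ 2 ≤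
      ‖y‖ₑ ^ 2 * ∫⁻ z in I ×ˢ K, ‖g z‖ₑ ^ 2 := by
  have hg := h.meas_grad
  have hR : MeasurableSet (I ×ˢ K) := hIm.prod hKm
  have hsub : I ×ˢ K ⊆ Ioo 0 T ×ˢ univ := prod_mono hI (subset_univ _)
  have e0 : ∀ (z : STPt d) (s : ℝ), z - s • ((0, y) : STPt d) = (z.1, z.2 - s • y) := by
    intro z s; ext <;> simp
  have h1 : ∀ᵐ z ∂volume.restrict (I ×ˢ K), ‖v z - v (z.1, z.2 - y)‖ₑ ^ 2 ≤
      ∫⁻ s in Ioc (0:ℝ) 1, ‖y‖ₑ ^ 2 * ‖g (z.1, z.2 - s • y)‖ₑ ^ 2 := by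
    filter_upwards [ae_restrict_of_ae_restrict_of_subset hsub (h.lineAC y 1 one_pos)] with z hz
    have h2 := hz.2
    rw [e0, one_smul] at h2
    simp only [e0] at h2
    rw [h2, intervalIntegral.integral_of_le zero_le_one]
    calc _ ≤ (∫⁻ s in Ioc (0:ℝ) 1, ‖⟪g (z.1, z.2 - s • y), y⟫‖ₑ) ^ 2 := by
          gcongr; exact enorm_integral_le_lintegral_enorm _
      _ ≤ volume.restrict (Ioc (0:ℝ) 1) univ *
          ∫⁻ s in Ioc (0:ℝ) 1, ‖⟪g (z.1, z.2 - s • y), y⟫‖ₑ ^ 2 := by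
          apply sq_lintegral_le
          fun_prop
      _ = ∫⁻ s in Ioc (0:ℝ) 1, ‖⟪g (z.1, z.2 - s • y), y⟫‖ₑ ^ 2 := by simp
      _ ≤ _ := by
          gcongr with s
          rw [mul_comm, ← mul_pow]
          gcongr
          rw [← enorm_norm (g _), ← enorm_norm y, ← enorm_mul]
          rw [enorm_le_iff_norm_le]
          simpa using norm_inner_le_norm (𝕜 := ℝ) (g (z.1, z.2 - s • y)) y
  calc ∫⁻ z in I ×ˢ K, K.indicator 1 (z.2 - y) * ‖v z - v (z.1, z.2 - y)‖ₑ ^ 2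
      ≤ ∫⁻ z in I ×ˢ K, K.indicator 1 (z.2 - y) *
          ∫⁻ s in Ioc (0:ℝ) 1, ‖y‖ₑ ^ 2 * ‖g (z.1, z.2 - s • y)‖ₑ ^ 2 := by
        apply lintegral_mono_ae
        filter_upwards [h1] with z hz
        gcongr
    _ = ∫⁻ z in I ×ˢ K, ∫⁻ s in Ioc (0:ℝ) 1,
          K.indicator 1 (z.2 - y) * (‖y‖ₑ ^ 2 * ‖g (z.1, z.2 - s • y)‖ₑ ^ 2) := by
        congr 1; funext z
        rw [← lintegral_const_mul _ (by fun_prop)]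
    _ = ∫⁻ s in Ioc (0:ℝ) 1, ∫⁻ z in I ×ˢ K,
          K.indicator 1 (z.2 - y) * (‖y‖ₑ ^ 2 * ‖g (z.1, z.2 - s • y)‖ₑ ^ 2) := by
        apply lintegral_lintegral_swap
        apply Measurable.aemeasurable
        have : Measurable (K.indicator (1 : Pt d → ℝ≥0∞)) := measurable_one.indicator hKm
        simp only [Function.uncurry_def]
        fun_prop
    _ ≤ ∫⁻ s in Ioc (0:ℝ) 1, ‖y‖ₑ ^ 2 * ∫⁻ z in I ×ˢ K, ‖g z‖ₑ ^ 2 := by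
        apply setLIntegral_mono measurable_const
        intro s hs
        rw [← lintegral_const_mul _ (by fun_prop), ← lintegral_indicator hR, ← lintegral_indicator hR]
        rw [← lintegral_sub_right_eq_self (μ := volume)
          ((I ×ˢ K).indicator fun z => ‖y‖ₑ ^ 2 * ‖g z‖ₑ ^ 2) (s • ((0, y) : STPt d))]
        apply lintegral_mono
        intro z
        simp only [e0]
        by_cases hz : z ∈ I ×ˢ K
        · by_cases hz2 : z.2 - y ∈ K
          · have : (z.1, z.2 - s • y) ∈ I ×ˢ K := by
              refine ⟨hz.1, ?_⟩
              have := hK hz.2 hz2 (a := 1 - s) (b := s) (by linarith [hs.2]) hs.1.le (by ring)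
              convert this using 1
              module
            rw [indicator_of_mem hz, indicator_of_mem this, indicator_of_mem hz2]
            simp
          · rw [indicator_of_mem hz, indicator_of_notMem hz2]
            simp
        · rw [indicator_of_notMem hz]; simp
    _ = _ := by simp

/-- The Poincaré inequality in space in terms of differences. -/
theorem H10.lintegral_sub_sub_le {T : ℝ} {Ω : Set (Pt d)} {v : STPt d → ℝ} {g : STPt d → Pt d}
    (h : H10 T Ω v g) {I : Set ℝ} (hI : I ⊆ Ioo 0 T) (hIm : MeasurableSet I) {K : Set (Pt d)}
    (hK : Convex ℝ K) (hKm : MeasurableSet K) {D : ℝ≥0∞} (hD : ∀ y ∈ K - K, ‖y‖ₑ ≤ D) :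
    ∫⁻ z in I ×ˢ K, ∫⁻ y in K, ‖v z - v (z.1, y)‖ₑ ^ 2 ≤
      volume (K - K) * D ^ 2 * ∫⁻ z in I ×ˢ K, ‖g z‖ₑ ^ 2 := by
  have hv := h.meas_val
  have hind : Measurable (K.indicator (1 : Pt d → ℝ≥0∞)) := measurable_one.indicator hKm
  calc ∫⁻ z in I ×ˢ K, ∫⁻ y in K, ‖v z - v (z.1, y)‖ₑ ^ 2
      = ∫⁻ z in I ×ˢ K, ∫⁻ y, K.indicator 1 (z.2 - y) * ‖v z - v (z.1, z.2 - y)‖ₑ ^ 2 := by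
        congr 1; funext z
        rw [← lintegral_indicator hKm,
          ← lintegral_sub_left_eq_self (K.indicator fun y => ‖v z - v (z.1, y)‖ₑ ^ 2) z.2]
        congr 1; funext y
        by_cases hy : z.2 - y ∈ K <;> simp [hy]
    _ = ∫⁻ y, ∫⁻ z in I ×ˢ K, K.indicator 1 (z.2 - y) * ‖v z - v (z.1, z.2 - y)‖ₑ ^ 2 := by
        apply lintegral_lintegral_swap
        apply Measurable.aemeasurable
        simp only [Function.uncurry_def]
        fun_prop
    _ ≤ ∫⁻ y in K - K, D ^ 2 * ∫⁻ z in I ×ˢ K, ‖g z‖ₑ ^ 2 := by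
        rw [← lintegral_indicator₀]
        · apply lintegral_mono
          intro y
          by_cases hy : y ∈ K - K
          · rw [indicator_of_mem hy]
            refine (h.lintegral_translate_le hI hIm hK hKm y).trans ?_
            gcongr
            exact hD y hy
          · rw [indicator_of_notMem hy, nonpos_iff_eq_zero]
            beta_reduce
            rw [setLIntegral_congr_fun (g := fun _ => 0) (hIm.prod hKm), lintegral_zero]
            intro z hz
            have : z.2 - y ∉ K := fun hz2 => hy ⟨z.2, hz.2, z.2 - y, hz2, by simp⟩
            simp [this]
        · exact (hK.sub hK).nullMeasurableSet volume
    _ = _ := by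
        rw [setLIntegral_const]; ring

/-- The mean value over the time interval `(a,b)`. -/
def timeMean {E : Type*} [NormedAddCommGroup E] [NormedSpace ℝ E] (a b : ℝ) (v : STPt d → E)
    (x : Pt d) : E := (b - a)⁻¹ • ∫ s in Ioc a b, v (s, x)

section
variable {E : Type*} [NormedAddCommGroup E] [NormedSpace ℝ E]

theorem integrable_timeMean (a b : ℝ) {v : STPt d → E} (hv : Integrable v) :
    Integrable (timeMean a b v) := by
  have h1 : Integrable v (((volume : Measure ℝ).restrict (Ioc a b)).prod (volume : Measure (Pt d))) := by
    have := hv.restrict (s := Ioc a b ×ˢ univ)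
    rwa [Measure.volume_eq_prod, ← Measure.prod_restrict, Measure.restrict_univ] at this
  exact h1.integral_prod_right.smul _

theorem measurable_timeMean [MeasurableSpace E] [BorelSpace E] [SecondCountableTopology E]
    (a b : ℝ) {v : STPt d → E} (hv : Measurable v) : Measurable (timeMean a b v) := by
  unfold timeMean
  have : Measurable fun x : Pt d => ∫ s in Ioc a b, v (s, x) :=
    (StronglyMeasurable.integral_prod_right' (ν := volume.restrict (Ioc a b))
      (f := fun p : Pt d × ℝ => v (p.2, p.1))
      (by apply Measurable.stronglyMeasurable; fun_prop)).measurable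
  fun_prop

end

/-- On a space-time element, a function is approximated by a constant up to its gradient and its
oscillation in time. -/
theorem H10.exists_lintegral_sub_const_le {T : ℝ} {Ω : Set (Pt d)} (hΩ : MeasurableSet Ω)
    (hb : Bornology.IsBounded Ω) {v : STPt d → ℝ} {g : STPt d → Pt d}
    (h : H10 T Ω v g) {a b : ℝ} (hI : Ioo a b ⊆ Ioo 0 T) {K : Set (Pt d)}
    (hK : Convex ℝ K) (hKm : MeasurableSet K) (hK0 : volume K ≠ 0) (hKt : volume K ≠ ∞)
    {D : ℝ≥0∞} (hD : ∀ y ∈ K - K, ‖y‖ₑ ≤ D) :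
    ∃ c : ℝ, ∫⁻ z in Ioo a b ×ˢ K, ‖v z - c‖ₑ ^ 2 ≤
      2 * ((volume K)⁻¹ * volume (K - K)) * D ^ 2 * (∫⁻ z in Ioo a b ×ˢ K, ‖g z‖ₑ ^ 2) +
      2 * (volume K)⁻¹ * ∫⁻ t in Ioo a b, (∫⁻ y in K, ‖v (t, y) - timeMean a b v y‖ₑ) ^ 2 := by
  have hv := h.meas_val
  set m := timeMean a b v with hm
  have hmm : Measurable m := measurable_timeMean a b hv
  have hmi : Integrable m := integrable_timeMean a b (h.integrable_val hΩ hb)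
  -- The constant is the mean over K of the time mean.
  set c : ℝ := (volume K).toReal⁻¹ * ∫ y in K, m y with hc
  have hKp : 0 < (volume K).toReal := ENNReal.toReal_pos hK0 hKt
  have hfin : IsFiniteMeasure (volume.restrict K) :=
    ⟨by rw [Measure.restrict_apply_univ]; exact hKt.lt_top⟩
  have h1 : ∀ z : STPt d, ‖v z - c‖ₑ ^ 2 ≤ 2 * (volume K)⁻¹ * (∫⁻ y in K, ‖v z - v (z.1, y)‖ₑ ^ 2)
      + 2 * (volume K)⁻¹ ^ 2 * (∫⁻ y in K, ‖v (z.1, y) - m y‖ₑ) ^ 2 := by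
    intro z
    have e1 : v z - c = (volume K).toReal⁻¹ * ∫ y in K, (v z - m y) := by
      rw [integral_sub (integrable_const _) hmi.restrict, setIntegral_const, hc,
        measureReal_def, smul_eq_mul]
      field_simp
    have e2 : ‖(volume K).toReal⁻¹‖ₑ = (volume K)⁻¹ := by
      rw [Real.enorm_eq_ofReal (by positivity), ENNReal.ofReal_inv_of_pos hKp,
        ENNReal.ofReal_toReal hKt]
    rw [e1, enorm_mul, e2]
    calc ((volume K)⁻¹ * ‖∫ y in K, (v z - m y)‖ₑ) ^ 2
        ≤ ((volume K)⁻¹ * ((∫⁻ y in K, ‖v z - v (z.1, y)‖ₑ) + ∫⁻ y in K, ‖v (z.1, y) - m y‖ₑ)) ^ 2 := by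
          gcongr
          refine (enorm_integral_le_lintegral_enorm _).trans ?_
          rw [← lintegral_add_left (by fun_prop)]
          apply lintegral_mono
          intro y
          simp only
          -- The first summand is a difference in space at a fixed time, the second an oscillation
          -- in time. The latter is kept as the square of an L¹ norm over K, the form in which
          -- Cauchy-Schwarz with the weight κ̃ can be applied for short time steps.
          have : v z - m y = (v z - v (z.1, y)) + (v (z.1, y) - m y) := by ring
          rw [this]
          exact enorm_add_le _ _
      _ ≤ (volume K)⁻¹ ^ 2 * (2 * (∫⁻ y in K, ‖v z - v (z.1, y)‖ₑ) ^ 2 +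
            2 * (∫⁻ y in K, ‖v (z.1, y) - m y‖ₑ) ^ 2) := by
          rw [mul_pow]
          gcongr
          exact add_sq_le_two_mul _ _
      _ ≤ (volume K)⁻¹ ^ 2 * (2 * (volume K * ∫⁻ y in K, ‖v z - v (z.1, y)‖ₑ ^ 2) +
            2 * (∫⁻ y in K, ‖v (z.1, y) - m y‖ₑ) ^ 2) := by
          gcongr
          refine (sq_lintegral_le (by fun_prop)).trans ?_
          rw [Measure.restrict_apply_univ]
      _ = _ := by
          have : (volume K)⁻¹ * volume K = 1 := ENNReal.inv_mul_cancel hK0 hKt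
          rw [mul_add, show ∀ k V A : ℝ≥0∞, k ^ 2 * (2 * (V * A)) = 2 * k * (k * V) * A from
            fun _ _ _ => by ring, this]
          ring
  refine ⟨c, ?_⟩
  have hm1 : Measurable fun z : STPt d => ∫⁻ y in K, ‖v z - v (z.1, y)‖ₑ ^ 2 := by
    apply Measurable.lintegral_prod_right'
      (f := fun p : STPt d × Pt d => ‖v p.1 - v (p.1.1, p.2)‖ₑ ^ 2)
    fun_prop
  have hm2 : Measurable fun t : ℝ => ∫⁻ y in K, ‖v (t, y) - m y‖ₑ := by
    apply Measurable.lintegral_prod_right' (f := fun p : ℝ × Pt d => ‖v p - m p.2‖ₑ)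
    fun_prop
  calc ∫⁻ z in Ioo a b ×ˢ K, ‖v z - c‖ₑ ^ 2
      ≤ ∫⁻ z in Ioo a b ×ˢ K, (2 * (volume K)⁻¹ * (∫⁻ y in K, ‖v z - v (z.1, y)‖ₑ ^ 2)
      + 2 * (volume K)⁻¹ ^ 2 * (∫⁻ y in K, ‖v (z.1, y) - m y‖ₑ) ^ 2) := lintegral_mono h1
    _ = 2 * (volume K)⁻¹ * (∫⁻ z in Ioo a b ×ˢ K, ∫⁻ y in K, ‖v z - v (z.1, y)‖ₑ ^ 2) +
        2 * (volume K)⁻¹ ^ 2 * (volume K *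
          ∫⁻ t in Ioo a b, (∫⁻ y in K, ‖v (t, y) - m y‖ₑ) ^ 2) := by
        rw [lintegral_add_left (by fun_prop), lintegral_const_mul _ hm1,
          lintegral_const_mul _ (by fun_prop)]
        congr 2
        rw [Measure.volume_eq_prod, ← Measure.prod_restrict, lintegral_prod _ (by fun_prop)]
        simp only [lintegral_const, Measure.restrict_apply_univ]
        rw [lintegral_mul_const _ (by fun_prop), mul_comm]
    _ ≤ 2 * (volume K)⁻¹ * (volume (K - K) * D ^ 2 * ∫⁻ z in Ioo a b ×ˢ K, ‖g z‖ₑ ^ 2) +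
        2 * (volume K)⁻¹ ^ 2 * (volume K *
          ∫⁻ t in Ioo a b, (∫⁻ y in K, ‖v (t, y) - m y‖ₑ) ^ 2) := by
        gcongr
        exact h.lintegral_sub_sub_le hI measurableSet_Ioo hK hKm hD
    _ = _ := by
        have : (volume K)⁻¹ * volume K = 1 := ENNReal.inv_mul_cancel hK0 hKt
        rw [show ∀ k V A : ℝ≥0∞, 2 * k ^ 2 * (V * A) = 2 * k * (k * V) * A from
            fun _ _ _ => by ring, this]
        ring

/-! ### Elements and nodal functions -/

namespace SpaceMesh
variable {Ω : Set (Pt d)} (𝒯 : SpaceMesh d Ω)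

theorem side_pos (i : Fin 𝒯.numCells) (k : Fin d) : 0 < 𝒯.side i k := sub_pos.2 (𝒯.lo_lt_hi i k)

theorem cell_eq (i : Fin 𝒯.numCells) :
    𝒯.cell i = ⋂ k, (fun x : Pt d => x k) ⁻¹' Ioo (𝒯.lo i k) (𝒯.hi i k) := by
  ext x; simp [cell]

theorem isOpen_cell (i : Fin 𝒯.numCells) : IsOpen (𝒯.cell i) := by
  rw [cell_eq]
  exact isOpen_iInter_of_finite fun k => isOpen_Ioo.preimage (by fun_prop)

theorem measurableSet_cell (i : Fin 𝒯.numCells) : MeasurableSet (𝒯.cell i) :=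
  (𝒯.isOpen_cell i).measurableSet

theorem convex_cell (i : Fin 𝒯.numCells) : Convex ℝ (𝒯.cell i) := by
  rw [cell_eq]
  exact convex_iInter fun k => (convex_Ioo _ _).linear_preimage
    (EuclideanSpace.proj k : Pt d →L[ℝ] ℝ).toLinearMap

theorem norm_sub_le_of_side_le {i : Fin 𝒯.numCells} {h : ℝ} (hh : ∀ k, 𝒯.side i k ≤ h) (hh0 : 0 ≤ h)
    {x y : Pt d} (hx : x ∈ 𝒯.cell i) (hy : y ∈ 𝒯.cell i) : ‖x - y‖ ≤ √d * h := by
  rw [EuclideanSpace.norm_eq]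
  calc √(∑ k, ‖(x - y) k‖ ^ 2) ≤ √(∑ _k : Fin d, h ^ 2) := by
        gcongr with k
        rw [PiLp.sub_apply, Real.norm_eq_abs, abs_le]
        have h1 := hx k
        have h2 := hy k
        have h3 := hh k
        simp only [side] at h3
        constructor <;> linarith [h1.1, h1.2, h2.1, h2.2]
    _ = √d * h := by
        rw [Finset.sum_const, Finset.card_univ, Fintype.card_fin, nsmul_eq_mul,
          Real.sqrt_mul (by positivity), Real.sqrt_sq hh0]

theorem nonempty_cell (i : Fin 𝒯.numCells) : (𝒯.cell i).Nonempty :=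
  ⟨WithLp.toLp 2 fun k => (𝒯.lo i k + 𝒯.hi i k) / 2, fun k => by
    have := 𝒯.lo_lt_hi i k
    constructor <;> simp only <;> linarith⟩

theorem side_le_H (i : Fin 𝒯.numCells) (k : Fin d) : 𝒯.side i k ≤ 𝒯.H :=
  (le_ciSup (f := fun k => 𝒯.side i k) (finite_range _).bddAbove k).trans
    (le_ciSup (f := fun i => ⨆ k, 𝒯.side i k) (finite_range _).bddAbove i)

theorem isBounded_cell (i : Fin 𝒯.numCells) : Bornology.IsBounded (𝒯.cell i) := by
  rw [Metric.isBounded_iff]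
  refine ⟨√d * |𝒯.H|, fun x hx y hy => ?_⟩
  rw [dist_eq_norm]
  exact 𝒯.norm_sub_le_of_side_le (fun k => (𝒯.side_le_H i k).trans (le_abs_self _)) (abs_nonneg _) hx hy

theorem volume_cell_ne_zero (i : Fin 𝒯.numCells) : volume (𝒯.cell i) ≠ 0 :=
  ((𝒯.isOpen_cell i).measure_pos volume (𝒯.nonempty_cell i)).ne'

theorem volume_cell_ne_top (i : Fin 𝒯.numCells) : volume (𝒯.cell i) ≠ ∞ :=
  (𝒯.isBounded_cell i).measure_lt_top.ne

/-- A box is symmetric about its centre, so K - K lies in a translate of 2K. -/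
theorem volume_cell_sub_cell (i : Fin 𝒯.numCells) :
    (volume (𝒯.cell i))⁻¹ * volume (𝒯.cell i - 𝒯.cell i) ≤ 2 ^ d := by
  have h1 : 𝒯.cell i - 𝒯.cell i ⊆
      (fun x => x + -(𝒯.lo i + 𝒯.hi i)) '' ((2:ℝ) • 𝒯.cell i) := by
    rintro _ ⟨x, hx, y, hy, rfl⟩
    refine ⟨x - y + (𝒯.lo i + 𝒯.hi i), ⟨(2:ℝ)⁻¹ • (x - y + (𝒯.lo i + 𝒯.hi i)), fun k => ?_, ?_⟩, ?_⟩
    · have h1 := hx k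
      have h2 := hy k
      simp only [PiLp.smul_apply, PiLp.add_apply, PiLp.sub_apply, smul_eq_mul]
      constructor <;> linarith [h1.1, h1.2, h2.1, h2.2]
    · simp
    · simp only [neg_add_rev]; abel
  have h2 : volume (𝒯.cell i - 𝒯.cell i) ≤ 2 ^ d * volume (𝒯.cell i) := by
    refine (measure_mono h1).trans ?_
    rw [image_add_right, measure_preimage_add_right, Measure.addHaar_smul]
    simp [abs_of_pos, ENNReal.ofReal_pow]
  calc _ ≤ (volume (𝒯.cell i))⁻¹ * (2 ^ d * volume (𝒯.cell i)) := by gcongr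
    _ = 2 ^ d * ((volume (𝒯.cell i))⁻¹ * volume (𝒯.cell i)) := by ring
    _ = 2 ^ d := by
        rw [ENNReal.inv_mul_cancel (𝒯.volume_cell_ne_zero i) (𝒯.volume_cell_ne_top i), mul_one]

/-- The factors of the multilinear nodal function. -/
def hatFactor (i : Fin 𝒯.numCells) (v : Fin d → Bool) (k : Fin d) (x : Pt d) : ℝ :=
  if v k then (x k - 𝒯.lo i k) / 𝒯.side i k else (𝒯.hi i k - x k) / 𝒯.side i k

theorem hat_eq (i : Fin 𝒯.numCells) (v : Fin d → Bool) (x : Pt d) :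
    𝒯.hat i v x = ∏ k, 𝒯.hatFactor i v k x := rfl

theorem hatFactor_mem {i : Fin 𝒯.numCells} (v : Fin d → Bool) {x : Pt d} {k : Fin d}
    (hx : x k ∈ Icc (𝒯.lo i k) (𝒯.hi i k)) : 𝒯.hatFactor i v k x ∈ Icc 0 1 := by
  have hs := 𝒯.side_pos i k
  have hs2 : 𝒯.side i k = 𝒯.hi i k - 𝒯.lo i k := rfl
  unfold hatFactor
  split_ifs
  · exact ⟨div_nonneg (by linarith [hx.1]) hs.le, (div_le_one hs).2 (by linarith [hx.2])⟩
  · exact ⟨div_nonneg (by linarith [hx.2]) hs.le, (div_le_one hs).2 (by linarith [hx.1])⟩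

theorem hat_mem {i : Fin 𝒯.numCells} (v : Fin d → Bool) {x : Pt d}
    (hx : ∀ k, x k ∈ Icc (𝒯.lo i k) (𝒯.hi i k)) : 𝒯.hat i v x ∈ Icc 0 1 := by
  rw [hat_eq]
  exact ⟨Finset.prod_nonneg fun k _ => (𝒯.hatFactor_mem v (hx k)).1,
    Finset.prod_le_one (fun k _ => (𝒯.hatFactor_mem v (hx k)).1)
      fun k _ => (𝒯.hatFactor_mem v (hx k)).2⟩

/-- The slope of the factor of the nodal function in the `k`-th direction. -/
def slope (i : Fin 𝒯.numCells) (v : Fin d → Bool) (k : Fin d) : ℝ :=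
  if v k then (𝒯.side i k)⁻¹ else -(𝒯.side i k)⁻¹

theorem hasFDerivAt_hatFactor (i : Fin 𝒯.numCells) (v : Fin d → Bool) (k : Fin d) (x : Pt d) :
    HasFDerivAt (𝒯.hatFactor i v k) (𝒯.slope i v k • (EuclideanSpace.proj k : Pt d →L[ℝ] ℝ)) x := by
  have h1 : HasFDerivAt (fun x : Pt d => x k) (EuclideanSpace.proj k : Pt d →L[ℝ] ℝ) x :=
    (EuclideanSpace.proj k : Pt d →L[ℝ] ℝ).hasFDerivAt
  unfold hatFactor slope
  split_ifs
  · simpa [div_eq_inv_mul] using (h1.sub_const (𝒯.lo i k)).const_mul (𝒯.side i k)⁻¹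
  · simpa [div_eq_inv_mul] using (h1.const_sub (𝒯.hi i k)).const_mul (𝒯.side i k)⁻¹

theorem hasFDerivAt_hat (i : Fin 𝒯.numCells) (v : Fin d → Bool) (x : Pt d) :
    HasFDerivAt (𝒯.hat i v) (∑ k, (∏ l ∈ Finset.univ.erase k, 𝒯.hatFactor i v l x) •
      (𝒯.slope i v k • (EuclideanSpace.proj k : Pt d →L[ℝ] ℝ))) x :=
  HasFDerivAt.finsetProd fun k _ => 𝒯.hasFDerivAt_hatFactor i v k x

theorem inner_hatGrad (i : Fin 𝒯.numCells) (v : Fin d → Bool) (z : STPt d) (y : Pt d) :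
    ⟪𝒯.hatGrad i v z, y⟫ = fderiv ℝ (𝒯.hat i v) z.2 y := by
  simp [hatGrad, gradient]

theorem hatGrad_apply (i : Fin 𝒯.numCells) (v : Fin d → Bool) (z : STPt d) (k : Fin d) :
    𝒯.hatGrad i v z k =
      (∏ l ∈ Finset.univ.erase k, 𝒯.hatFactor i v l z.2) * 𝒯.slope i v k := by
  have h1 := 𝒯.inner_hatGrad i v z (EuclideanSpace.single k 1)
  rw [EuclideanSpace.inner_single_right, (𝒯.hasFDerivAt_hat i v z.2).fderiv] at h1
  simp only [one_mul, conj_trivial] at h1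
  rw [h1]
  simp

theorem abs_slope (i : Fin 𝒯.numCells) (v : Fin d → Bool) (k : Fin d) :
    |𝒯.slope i v k| = (𝒯.side i k)⁻¹ := by
  have := 𝒯.side_pos i k
  unfold slope
  split_ifs <;> simp [abs_of_pos this]

theorem norm_hatGrad_sq_le {i : Fin 𝒯.numCells} (v : Fin d → Bool) {z : STPt d}
    (hz : z.2 ∈ 𝒯.cell i) {h : ℝ} (hh0 : 0 < h) (hh : ∀ k, h ≤ 𝒯.side i k) :
    ‖𝒯.hatGrad i v z‖ ^ 2 ≤ d * (h ^ 2)⁻¹ := by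
  rw [EuclideanSpace.norm_sq_eq]
  calc ∑ k, ‖𝒯.hatGrad i v z k‖ ^ 2 ≤ ∑ _k : Fin d, (h ^ 2)⁻¹ := by
        gcongr with k
        rw [hatGrad_apply, norm_mul, Real.norm_eq_abs (𝒯.slope i v k), abs_slope, ← inv_pow]
        have h1 : ‖∏ l ∈ Finset.univ.erase k, 𝒯.hatFactor i v l z.2‖ ≤ 1 := by
          rw [Real.norm_eq_abs, abs_of_nonneg]
          · exact Finset.prod_le_one
              (fun k _ => (𝒯.hatFactor_mem v (Ioo_subset_Icc_self (hz k))).1)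
              fun k _ => (𝒯.hatFactor_mem v (Ioo_subset_Icc_self (hz k))).2
          · exact Finset.prod_nonneg
              fun k _ => (𝒯.hatFactor_mem v (Ioo_subset_Icc_self (hz k))).1
        have h2 : (𝒯.side i k)⁻¹ ≤ h⁻¹ := inv_anti₀ hh0 (hh k)
        have h3 : 0 < (𝒯.side i k)⁻¹ := inv_pos.2 (𝒯.side_pos i k)
        gcongr
        calc _ ≤ 1 * h⁻¹ := by gcongr
          _ = h⁻¹ := one_mul _
    _ = _ := by simp

/-- At the vertex nearest to the point every factor of the nodal function is at least 1/2, and one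
factor is replaced by its slope. This bounds the bilinear weight from below. -/
theorem exists_le_norm_hatGrad_sq (i : Fin 𝒯.numCells) (z : STPt d)
    (k : Fin d) : ∃ v, (4 ^ d * 𝒯.side i k ^ 2)⁻¹ ≤ ‖𝒯.hatGrad i v z‖ ^ 2 := by
  classical
  refine ⟨fun l => decide ((𝒯.lo i l + 𝒯.hi i l) / 2 ≤ z.2 l), ?_⟩
  set v : Fin d → Bool := fun l => decide ((𝒯.lo i l + 𝒯.hi i l) / 2 ≤ z.2 l) with hv
  have hs := 𝒯.side_pos i k
  have h1 : ∀ l, (1/2 : ℝ) ≤ 𝒯.hatFactor i v l z.2 := by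
    intro l
    have hs := 𝒯.side_pos i l
    have hs2 : 𝒯.side i l = 𝒯.hi i l - 𝒯.lo i l := rfl
    unfold hatFactor
    by_cases h : (𝒯.lo i l + 𝒯.hi i l) / 2 ≤ z.2 l
    · simp only [hv, h, decide_true, if_true]
      rw [le_div_iff₀ hs]; linarith
    · simp only [hv, h, decide_false, Bool.false_eq_true, if_false]
      rw [le_div_iff₀ hs]; linarith [not_le.1 h]
  have h2 : ((1/2 : ℝ)) ^ d ≤ ∏ l ∈ Finset.univ.erase k, 𝒯.hatFactor i v l z.2 := by
    calc ((1/2 : ℝ)) ^ d ≤ (1/2 : ℝ) ^ (Finset.univ.erase k).card :=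
          pow_le_pow_of_le_one (by norm_num) (by norm_num) (by
            calc _ ≤ (Finset.univ : Finset (Fin d)).card := Finset.card_le_card (Finset.erase_subset _ _)
              _ = d := by simp)
      _ ≤ _ := by
          rw [← Finset.prod_const]
          exact Finset.prod_le_prod (fun _ _ => by norm_num) fun l _ => h1 l
  calc (4 ^ d * 𝒯.side i k ^ 2)⁻¹ = (((1/2 : ℝ)) ^ d * (𝒯.side i k)⁻¹) ^ 2 := by
        rw [mul_pow, ← pow_mul, mul_comm d 2, pow_mul, mul_inv, ← inv_pow, inv_pow (𝒯.side i k)]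
        norm_num
    _ ≤ ‖𝒯.hatGrad i v z k‖ ^ 2 := by
        rw [hatGrad_apply, norm_mul, Real.norm_eq_abs (𝒯.slope i v k), abs_slope]
        gcongr
        exact h2.trans (le_abs_self _)
    _ ≤ ‖𝒯.hatGrad i v z‖ ^ 2 := by
        gcongr
        exact PiLp.norm_apply_le _ _

theorem contDiff_hat (i : Fin 𝒯.numCells) (v : Fin d → Bool) : ContDiff ℝ 1 (𝒯.hat i v) := by
  have : 𝒯.hat i v = fun x => ∏ k, 𝒯.hatFactor i v k x := rfl
  rw [this]
  refine contDiff_prod fun k _ => ?_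
  unfold hatFactor
  split_ifs <;> fun_prop

/-- The projection onto the closed element. -/
def clampPt (i : Fin 𝒯.numCells) (x : Pt d) : Pt d :=
  WithLp.toLp 2 fun k => max (𝒯.lo i k) (min (𝒯.hi i k) (x k))

theorem clampPt_mem (i : Fin 𝒯.numCells) (x : Pt d) (k : Fin d) :
    𝒯.clampPt i x k ∈ Icc (𝒯.lo i k) (𝒯.hi i k) :=
  ⟨le_max_left _ _, max_le (𝒯.lo_lt_hi i k).le (min_le_left _ _)⟩

theorem clampPt_eq {i : Fin 𝒯.numCells} {x : Pt d} (hx : x ∈ 𝒯.cell i) : 𝒯.clampPt i x = x := by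
  ext k
  have := hx k
  simp [clampPt, this.1.le, this.2.le]

theorem lipschitzWith_clampPt (i : Fin 𝒯.numCells) : LipschitzWith 1 (𝒯.clampPt i) := by
  refine LipschitzWith.of_dist_le_mul fun x y => ?_
  rw [NNReal.coe_one, one_mul, EuclideanSpace.dist_eq, EuclideanSpace.dist_eq]
  gcongr with k
  simp only [clampPt, Real.dist_eq]
  refine (abs_max_sub_max_le_max _ _ _ _).trans ?_
  simp only [sub_self, abs_zero]
  refine max_le (abs_nonneg _) ((abs_min_sub_min_le_max _ _ _ _).trans ?_)
  simp

/-- A multilinear function need be neither bounded nor Lipschitz on the whole space. Composed with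
the projection onto the element it is both, takes values in [0,1], and can serve as a global
barrier. -/
theorem exists_lipschitzWith_hat_clampPt (i : Fin 𝒯.numCells) (v : Fin d → Bool) :
    ∃ C, LipschitzWith C fun x => 𝒯.hat i v (𝒯.clampPt i x) := by
  have hc : IsCompact (closure (𝒯.cell i)) := (𝒯.isBounded_cell i).isCompact_closure
  have hK : Convex ℝ {x : Pt d | ∀ k, x k ∈ Icc (𝒯.lo i k) (𝒯.hi i k)} := by
    have : {x : Pt d | ∀ k, x k ∈ Icc (𝒯.lo i k) (𝒯.hi i k)} =
        ⋂ k, (fun x : Pt d => x k) ⁻¹' Icc (𝒯.lo i k) (𝒯.hi i k) := by ext x; simp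
    rw [this]
    exact convex_iInter fun k => (convex_Icc _ _).linear_preimage
      (EuclideanSpace.proj k : Pt d →L[ℝ] ℝ).toLinearMap
  have hKc : IsCompact {x : Pt d | ∀ k, x k ∈ Icc (𝒯.lo i k) (𝒯.hi i k)} := by
    have : {x : Pt d | ∀ k, x k ∈ Icc (𝒯.lo i k) (𝒯.hi i k)} =
        (EuclideanSpace.equiv (Fin d) ℝ) ⁻¹' (univ.pi fun k => Icc (𝒯.lo i k) (𝒯.hi i k)) := by
      ext x
      simp only [mem_ofPred_eq, mem_preimage, mem_univ_pi]
      rfl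
    rw [this]
    exact (EuclideanSpace.equiv (Fin d) ℝ).toHomeomorph.isCompact_preimage.2
      (isCompact_univ_pi fun k => isCompact_Icc)
  obtain ⟨C, hC⟩ := (𝒯.contDiff_hat i v).contDiffOn.exists_lipschitzOnWith one_ne_zero hK hKc
  refine ⟨C * 1, ?_⟩
  rw [← lipschitzOnWith_univ]
  exact hC.comp (𝒯.lipschitzWith_clampPt i).lipschitzOnWith fun x _ => 𝒯.clampPt_mem i x

theorem lineDeriv_hat_clampPt {i : Fin 𝒯.numCells} (v : Fin d → Bool) {z : STPt d}
    (hx : z.2 ∈ 𝒯.cell i) (y : Pt d) :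
    lineDeriv ℝ (fun x => 𝒯.hat i v (𝒯.clampPt i x)) z.2 y = ⟪𝒯.hatGrad i v z, y⟫ := by
  have h1 : (fun x => 𝒯.hat i v (𝒯.clampPt i x)) =ᶠ[nhds z.2] 𝒯.hat i v := by
    filter_upwards [(𝒯.isOpen_cell i).mem_nhds hx] with x hx
    rw [𝒯.clampPt_eq hx]
  rw [h1.lineDeriv_eq, inner_hatGrad]
  exact ((𝒯.contDiff_hat i v).differentiable one_ne_zero _).lineDeriv_eq_fderiv

theorem measurable_hatGrad (i : Fin 𝒯.numCells) (v : Fin d → Bool) : Measurable (𝒯.hatGrad i v) := by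
  have h1 : Continuous fun x => gradient (𝒯.hat i v) x := by
    unfold gradient
    exact (LinearIsometryEquiv.continuous _).comp ((𝒯.contDiff_hat i v).continuous_fderiv one_ne_zero)
  exact h1.measurable.comp measurable_snd

theorem cell_subset (i : Fin 𝒯.numCells) : 𝒯.cell i ⊆ Ω := by
  refine (interior_maximal ?_ (𝒯.isOpen_cell i)).trans 𝒯.interior_union.subset
  exact subset_iUnion_of_subset i fun x hx k => Ioo_subset_Icc_self (hx k)

/-- Points of Ω in no open element lie on one of finitely many hyperplanes carrying faces. -/
theorem volume_diff_cells : volume (Ω \ ⋃ i, 𝒯.cell i) = 0 := by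
  have h1 : Ω \ ⋃ i, 𝒯.cell i ⊆ ⋃ i, ⋃ k, ({x : Pt d | x k = 𝒯.lo i k} ∪ {x : Pt d | x k = 𝒯.hi i k}) := by
    rintro x ⟨hx, hx2⟩
    obtain ⟨i, hi⟩ := mem_iUnion.1 (interior_subset (𝒯.interior_union.superset hx))
    simp only [mem_iUnion, not_exists] at hx2
    have := hx2 i
    simp only [cell, mem_ofPred_eq, not_forall] at this
    obtain ⟨k, hk⟩ := this
    have hik := hi k
    refine mem_iUnion.2 ⟨i, mem_iUnion.2 ⟨k, ?_⟩⟩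
    simp only [mem_union, mem_ofPred_eq]
    by_contra hcon
    push Not at hcon
    exact hk ⟨lt_of_le_of_ne hik.1 (Ne.symm hcon.1), lt_of_le_of_ne hik.2 hcon.2⟩
  have h2 : ∀ (k : Fin d) (c : ℝ), volume {x : Pt d | x k = c} = 0 := by
    intro k c
    exact (PiLp.volume_preserving_ofLp (Fin d)).quasiMeasurePreserving.preimage_null
      (Measure.pi_hyperplane (fun _ => volume) k c)
  refine measure_mono_null h1 ?_
  simp [measure_iUnion_null_iff, h2]

end SpaceMesh

/-! ### The maximum principle -/

theorem LineAC.congr_grad {A : Set (STPt d)} {e : STPt d} {v g g' : STPt d → ℝ}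
    (hg : Measurable g) (hg' : Measurable g') (hgg : g =ᵐ[volume] g') (h : LineAC A e v g) :
    LineAC A e v g' := by
  intro r hr
  have h1 : ∀ᵐ z ∂volume.restrict A, ∀ᵐ s ∂volume.restrict (Ioc 0 r),
      g (z - s • e) = g' (z - s • e) := by
    refine ae_ae_of_forall_ae ?_ fun s _ => ?_
    · exact measurableSet_eq_fun (hg.comp (measurable_line e)) (hg'.comp (measurable_line e))
    · exact ae_restrict_of_ae
        ((measurePreserving_sub_right volume (s • e)).quasiMeasurePreserving.ae hgg)
  filter_upwards [h r hr, h1] with z hz hz1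
  rw [← uIoc_of_le hr.le] at hz1
  exact ⟨hz.1.congr_ae hz1, hz.2.trans (intervalIntegral.integral_congr_ae_restrict hz1)⟩

/-- A function with zero gradient that vanishes outside a bounded cylinder is zero. -/
theorem eq_zero_of_lineAC_zero {T : ℝ} {K : Set (Pt d)} (hd : 0 < d) (hK : MeasurableSet K)
    (hb : Bornology.IsBounded K) {v : STPt d → ℝ} (h0 : ∀ z ∉ cyl T K, v z = 0)
    (h : ∀ y : Pt d, LineAC (Ioo 0 T ×ˢ univ) (0, y) v 0) :
    ∀ᵐ z ∂volume.restrict (cyl T K), v z = 0 := by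
  set y : Pt d := EuclideanSpace.single ⟨0, hd⟩ 1 with hy
  have hy1 : ‖y‖ = 1 := by simp [hy]
  obtain ⟨C, hC⟩ := Metric.isBounded_iff.1 hb
  -- A step longer than the diameter bound C leads out of the cylinder, where v vanishes, and v is
  -- unchanged along the line.
  have hr : 0 < |C| + 1 := by positivity
  have hsub : cyl T K ⊆ Ioo 0 T ×ˢ univ := prod_mono subset_rfl (subset_univ _)
  filter_upwards [ae_restrict_of_ae_restrict_of_subset hsub (h y _ hr),
    ae_restrict_mem (measurableSet_cyl hK)] with z hz hzK
  have h1 : z - (|C| + 1) • ((0, y) : STPt d) ∉ cyl T K := by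
    intro hmem
    have := hC hzK.2 hmem.2
    rw [dist_eq_norm] at this
    simp only [Prod.snd_sub, Prod.smul_snd, sub_sub_cancel, norm_smul, hy1, mul_one,
      Real.norm_eq_abs, abs_of_pos hr] at this
    linarith [le_abs_self C]
  have := hz.2
  rw [h0 _ h1] at this
  simpa using this

/-- The derivative of `smoothPos`. -/
def smoothPosDeriv (r : ℝ) : ℝ := min (max r 0) 1

/-- A continuously differentiable replacement for the positive part. -/
def smoothPos (s : ℝ) : ℝ := ∫ r in (0:ℝ)..s, smoothPosDeriv r

theorem continuous_smoothPosDeriv : Continuous smoothPosDeriv := by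
  unfold smoothPosDeriv; fun_prop

theorem smoothPosDeriv_mem (r : ℝ) : smoothPosDeriv r ∈ Icc 0 1 :=
  ⟨le_min (le_max_right _ _) zero_le_one, min_le_right _ _⟩

theorem smoothPosDeriv_of_nonpos {r : ℝ} (hr : r ≤ 0) : smoothPosDeriv r = 0 := by
  simp [smoothPosDeriv, hr]

theorem smoothPosDeriv_pos {r : ℝ} (hr : 0 < r) : 0 < smoothPosDeriv r := by
  simp [smoothPosDeriv, hr]

theorem hasDerivAt_smoothPos (s : ℝ) : HasDerivAt smoothPos (smoothPosDeriv s) s :=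
  intervalIntegral.integral_hasDerivAt_right (continuous_smoothPosDeriv.intervalIntegrable _ _)
    (continuous_smoothPosDeriv.stronglyMeasurableAtFilter _ _) continuous_smoothPosDeriv.continuousAt

theorem lipschitzWith_of_hasDerivAt {F F' : ℝ → ℝ} (hd : ∀ s, HasDerivAt F (F' s) s) {C : NNReal}
    (hC : ∀ s, |F' s| ≤ C) : LipschitzWith C F := by
  refine lipschitzWith_of_nnnorm_deriv_le (fun s => (hd s).differentiableAt) fun s => ?_
  rw [(hd s).deriv]
  exact_mod_cast hC s

theorem lipschitzWith_smoothPos : LipschitzWith 1 smoothPos :=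
  lipschitzWith_of_hasDerivAt hasDerivAt_smoothPos fun s => by
    have := smoothPosDeriv_mem s
    rw [abs_of_nonneg this.1]; exact_mod_cast this.2

theorem smoothPos_of_nonpos {s : ℝ} (hs : s ≤ 0) : smoothPos s = 0 := by
  unfold smoothPos
  rw [intervalIntegral.integral_congr (g := fun _ => (0:ℝ)), intervalIntegral.integral_zero]
  intro r hr
  rw [uIcc_of_ge hs] at hr
  exact smoothPosDeriv_of_nonpos hr.2

theorem abs_smoothPos_le (s : ℝ) : |smoothPos s| ≤ |s| := by
  have h0 : smoothPos 0 = 0 := smoothPos_of_nonpos le_rfl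
  simpa [h0, Real.dist_eq] using lipschitzWith_smoothPos.dist_le_mul s 0

theorem smoothPos_pos {s : ℝ} (hs : 0 < s) : 0 < smoothPos s :=
  intervalIntegral.intervalIntegral_pos_of_pos_on (continuous_smoothPosDeriv.intervalIntegrable _ _)
    (fun _ hx => smoothPosDeriv_pos hx.1) hs

/-- A Lipschitz function is absolutely continuous on every line, and its line derivative is the
derivative there up to the sign caused by moving backwards. -/
theorem lineAC_of_lipschitzWith (A : Set (STPt d)) {B : Pt d → ℝ} {C : NNReal}
    (hB : LipschitzWith C B) (y : Pt d) :
    LineAC A (0, y) (fun z => B z.2) (fun z => lineDeriv ℝ B z.2 y) := by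
  intro r hr
  refine Filter.Eventually.of_forall fun z => ?_
  have h1 : LipschitzWith (C * ‖y‖₊) fun s : ℝ => B (z.2 - s • y) := by
    refine hB.comp (LipschitzWith.of_dist_le_mul fun s t => ?_)
    rw [dist_sub_left, dist_eq_norm, ← sub_smul, norm_smul, mul_comm, Real.dist_eq,
      Real.norm_eq_abs]
    simp
  have h2 : AbsolutelyContinuousOnInterval (fun s : ℝ => B (z.2 - s • y)) 0 r :=
    h1.lipschitzOnWith.absolutelyContinuousOnInterval
  have h3 : ∀ s : ℝ, lineDeriv ℝ B (z - s • ((0, y) : STPt d)).2 y =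
      -deriv (fun s : ℝ => B (z.2 - s • y)) s := by
    intro s
    have h4 : (fun t : ℝ => B (z.2 - s • y + t • y)) = fun t => B (z.2 - (s - t) • y) := by
      funext t; congr 1; module
    simp only [lineDeriv, Prod.snd_sub, Prod.smul_snd]
    rw [h4]
    have := deriv_comp_const_sub (f := fun s : ℝ => B (z.2 - s • y)) s 0
    simpa using this
  simp only [h3]
  refine ⟨h2.intervalIntegrable_deriv.neg, ?_⟩
  rw [intervalIntegral.integral_neg, h2.integral_deriv_eq_sub]
  simp

/-- A comparison principle: subsolutions lie below a barrier that is nonnegative on the boundary. -/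
theorem H10.le_barrier {T : ℝ} {K : Set (Pt d)} (hd : 0 < d) (hK : MeasurableSet K)
    (hb : Bornology.IsBounded K) {κ₀ κ₁ : ℝ} (hκ₀ : 0 < κ₀) {κc : STPt d → ℝ}
    (hκm : AEMeasurable κc (volume.restrict (cyl T K))) (hκ : ∀ z ∈ cyl T K, κc z ∈ Icc κ₀ κ₁)
    {φ : STPt d → ℝ} {gφ G : STPt d → Pt d} (h : H10 T K φ gφ) {B : Pt d → ℝ} {C : NNReal}
    (hB : LipschitzWith C B) (hB0 : ∀ x, 0 ≤ B x) {b : STPt d → Pt d} (hbm : Measurable b)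
    (hBb : ∀ z ∈ cyl T K, ∀ y, lineDeriv ℝ B z.2 y = ⟪b z, y⟫)
    (hG : ∀ᵐ z ∂volume.restrict (cyl T K), G z = gφ z - b z)
    (hGm : MemLp G 2 (volume.restrict (cyl T K)))
    (heq : ∀ w gw, MemH10Zero T K w gw → ∫ z in cyl T K, κc z * ⟪G z, gw z⟫ = 0) :
    ∀ᵐ z ∂volume.restrict (cyl T K), φ z ≤ B z.2 := by
  have hQ := measurableSet_cyl (T := T) hK
  have hφm := h.meas_val
  have hgm := h.meas_grad
  have hBm : Measurable B := hB.continuous.measurable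
  have hβ := continuous_smoothPosDeriv
  have hβm : Measurable smoothPosDeriv := hβ.measurable
  have hsm : Measurable smoothPos := lipschitzWith_smoothPos.continuous.measurable
  -- The test function is a smoothed positive part of φ - B. Outside the cylinder φ = 0 ≤ B, so it
  -- has zero boundary values. Its gradient is a nonnegative multiple of G, the gradient of φ - B.
  set ζ : STPt d → ℝ := fun z => smoothPos (φ z - B z.2) with hζ
  set gζ : STPt d → Pt d := (cyl T K).indicator fun z =>
    smoothPosDeriv (φ z - B z.2) • (gφ z - b z) with hgζ
  have hle : ∀ z ∉ cyl T K, φ z - B z.2 ≤ 0 := fun z hz => by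
    rw [h.val_zero z hz]; linarith [hB0 z.2]
  have hgζm : Measurable gζ := by
    apply Measurable.indicator _ hQ
    fun_prop
  have hgG : gζ =ᵐ[volume.restrict (cyl T K)] fun z => smoothPosDeriv (φ z - B z.2) • G z := by
    filter_upwards [hG, ae_restrict_mem hQ] with z hz hz2
    rw [hgζ, indicator_of_mem hz2, hz]
  have hζH : H10 T K ζ gζ := by
    refine ⟨by fun_prop, hgζm, fun z hz => smoothPos_of_nonpos (hle z hz),
      fun z hz => indicator_of_notMem hz _, ?_, ?_, fun y => ?_⟩
    · refine h.memLp_val.mono (by apply Measurable.aestronglyMeasurable; fun_prop)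
        (Filter.Eventually.of_forall fun z => ?_)
      rw [Real.norm_eq_abs, Real.norm_eq_abs]
      rcases le_or_gt (φ z - B z.2) 0 with h1 | h1
      · rw [hζ]; simp only; rw [smoothPos_of_nonpos h1, abs_zero]; exact abs_nonneg _
      · refine (abs_smoothPos_le _).trans ?_
        have := hB0 z.2
        rw [abs_of_pos h1]
        exact le_trans (by linarith) (le_abs_self _)
    · rw [hgζ, memLp_indicator_iff_restrict hQ]
      refine hGm.mono (by apply Measurable.aestronglyMeasurable; fun_prop) ?_
      filter_upwards [hG] with z hz
      rw [norm_smul, ← hz, Real.norm_eq_abs, abs_of_nonneg (smoothPosDeriv_mem _).1]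
      exact mul_le_of_le_one_left (norm_nonneg _) (smoothPosDeriv_mem _).2
    · have h1 := ((h.lineAC y).sub (lineAC_of_lipschitzWith (Ioo 0 T ×ˢ univ) hB y)).comp
        (by fun_prop) (by
          have : Measurable fun z : STPt d => lineDeriv ℝ B z.2 y :=
            (measurable_lineDeriv (𝕜 := ℝ) (v := y) hB.continuous).comp measurable_snd
          fun_prop) lipschitzWith_smoothPos hasDerivAt_smoothPos
      convert h1 using 2 with z
      by_cases hz : z ∈ cyl T K
      · rw [hgζ, indicator_of_mem hz, inner_smul_left, inner_sub_left, hBb z hz y]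
        simp
      · rw [hgζ, indicator_of_notMem hz, smoothPosDeriv_of_nonpos (hle z hz)]
        simp
  have h1 := heq ζ gζ (hζH.memH10Zero hK hb)
  have h2 : ∫ z in cyl T K, κc z * (smoothPosDeriv (φ z - B z.2) * ‖G z‖ ^ 2) = 0 := by
    rw [← h1]
    apply integral_congr_ae
    filter_upwards [hgG] with z hz
    rw [hz, inner_smul_right, real_inner_self_eq_norm_sq]
  have h3 : Integrable (fun z => κc z * (smoothPosDeriv (φ z - B z.2) * ‖G z‖ ^ 2))
      (volume.restrict (cyl T K)) := by
    refine Integrable.bdd_mul (c := max |κ₀| |κ₁|) ?_ hκm.aestronglyMeasurable ?_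
    · refine Integrable.bdd_mul (c := 1) ((memLp_two_iff_integrable_sq_norm hGm.1).1 hGm)
        (by apply Measurable.aestronglyMeasurable; fun_prop)
        (Filter.Eventually.of_forall fun z => ?_)
      rw [Real.norm_eq_abs, abs_of_nonneg (smoothPosDeriv_mem _).1]
      exact (smoothPosDeriv_mem _).2
    · filter_upwards [ae_restrict_mem hQ] with z hz
      exact abs_le_max_abs_abs (hκ z hz).1 (hκ z hz).2
  -- The integrand is nonnegative with integral zero, and κc ≥ κ₀ > 0. So the gradient of ζ
  -- vanishes, and ζ itself because it vanishes outside a bounded set.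
  have h4 : ∀ᵐ z ∂volume.restrict (cyl T K), smoothPosDeriv (φ z - B z.2) • G z = 0 := by
    rw [integral_eq_zero_iff_of_nonneg_ae ?_ h3] at h2
    · filter_upwards [h2, ae_restrict_mem hQ] with z hz hz2
      have hκz := (hκ z hz2).1
      have : κc z ≠ 0 := by linarith
      simpa [this] using hz
    · filter_upwards [ae_restrict_mem hQ] with z hz
      have hκz := (hκ z hz).1
      exact mul_nonneg (by linarith) (mul_nonneg (smoothPosDeriv_mem _).1 (by positivity))
  have h5 : gζ =ᵐ[volume] 0 := by
    have : ∀ᵐ z ∂volume.restrict (cyl T K), gζ z = 0 := by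
      filter_upwards [hgG, h4] with z hz hz2
      rw [hz, hz2]
    rw [ae_restrict_iff' hQ] at this
    filter_upwards [this] with z hz
    by_cases hzQ : z ∈ cyl T K
    · exact hz hzQ
    · exact hζH.grad_zero z hzQ
  have h6 : ∀ y : Pt d, LineAC (Ioo 0 T ×ˢ univ) (0, y) ζ 0 := fun y =>
    (hζH.lineAC y).congr_grad (by fun_prop) measurable_zero (by
      filter_upwards [h5] with z hz
      rw [hz]; simp)
  filter_upwards [eq_zero_of_lineAC_zero hd hK hb hζH.val_zero h6] with z hz
  by_contra hcon
  have := smoothPos_pos (s := φ z - B z.2) (by linarith)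
  rw [hζ] at hz
  simp only at hz
  linarith

/-- Multiscale basis functions differ from the nodal functions by at most one. -/
theorem SpaceMesh.IsMultiscaleBasis.abs_sub_hat_le {Ω : Set (Pt d)} {𝒯 : SpaceMesh d Ω} {T : ℝ}
    (hd : 0 < d) {κ₀ κ₁ : ℝ} (hκ₀ : 0 < κ₀) {κc : STPt d → ℝ}
    (hκm : AEMeasurable κc (volume.restrict (cyl T Ω))) (hκ : ∀ z ∈ cyl T Ω, κc z ∈ Icc κ₀ κ₁)
    {χ : Fin 𝒯.numCells → (Fin d → Bool) → STPt d → ℝ}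
    {G : Fin 𝒯.numCells → (Fin d → Bool) → STPt d → Pt d} (h : 𝒯.IsMultiscaleBasis T κc χ G)
    (i : Fin 𝒯.numCells) (v : Fin d → Bool) {φ : STPt d → ℝ} {gφ : STPt d → Pt d}
    (hφ : H10 T (𝒯.cell i) φ gφ)
    (hG : ∀ᵐ z ∂volume.restrict (cyl T (𝒯.cell i)), G i v z - 𝒯.hatGrad i v z = gφ z)
    (hGm : MemLp (G i v) 2 (volume.restrict (cyl T (𝒯.cell i)))) :
    ∀ᵐ z ∂volume.restrict (cyl T (𝒯.cell i)), |φ z| ≤ 1 := by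
  have hsub : cyl T (𝒯.cell i) ⊆ cyl T Ω := prod_mono subset_rfl (𝒯.cell_subset i)
  obtain ⟨C, hC⟩ := 𝒯.exists_lipschitzWith_hat_clampPt i v
  have hmem : ∀ x, 𝒯.hat i v (𝒯.clampPt i x) ∈ Icc 0 1 := fun x =>
    𝒯.hat_mem v (𝒯.clampPt_mem i x)
  have hgm := 𝒯.measurable_hatGrad i v
  have hB1 : LipschitzWith C fun x => 1 - 𝒯.hat i v (𝒯.clampPt i x) := by
    refine LipschitzWith.of_dist_le_mul fun x y => ?_
    rw [dist_sub_left]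
    exact hC.dist_le_mul x y
  -- With φ = χ - g the barrier 1 - g expresses χ ≤ 1.
  have h1 := H10.le_barrier (κ₁ := κ₁) hd (𝒯.measurableSet_cell i) (𝒯.isBounded_cell i) hκ₀
    (hκm.mono_measure (Measure.restrict_mono hsub le_rfl)) (fun z hz => hκ z (hsub hz)) hφ
    hB1 (fun x => by linarith [(hmem x).2]) (b := fun z => -𝒯.hatGrad i v z) hgm.neg
    (fun z hz y => by
      rw [inner_neg_left, ← 𝒯.lineDeriv_hat_clampPt v hz.2 y]
      simp only [lineDeriv, deriv_const_sub])
    (by filter_upwards [hG] with z hz; rw [← hz]; abel) hGm (h.eq i v)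
  have hφn : H10 T (𝒯.cell i) (fun z => -φ z) (fun z => -gφ z) :=
    ⟨hφ.meas_val.neg, hφ.meas_grad.neg, fun z hz => by simp [hφ.val_zero z hz],
      fun z hz => by simp [hφ.grad_zero z hz], hφ.memLp_val.neg, hφ.memLp_grad.neg, fun y => by
        simpa only [inner_neg_left] using (hφ.lineAC y).neg⟩
  -- With the barrier g for -φ one gets χ ≥ 0. Since 0 ≤ g ≤ 1, the two bounds give |χ - g| ≤ 1.
  have h2 := H10.le_barrier (κ₁ := κ₁) hd (𝒯.measurableSet_cell i) (𝒯.isBounded_cell i) hκ₀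
    (hκm.mono_measure (Measure.restrict_mono hsub le_rfl)) (fun z hz => hκ z (hsub hz)) hφn
    hC (fun x => (hmem x).1) hgm (fun z hz y => 𝒯.lineDeriv_hat_clampPt v hz.2 y)
    (G := fun z => -G i v z)
    (by filter_upwards [hG] with z hz; rw [← hz]; abel) hGm.neg (fun w gw hw => by
      have := h.eq i v w gw hw
      simp only [inner_neg_left, mul_neg, integral_neg, this, neg_zero])
  filter_upwards [h1, h2] with z hz1 hz2
  rw [abs_le]
  have := hmem z.2
  constructor <;> linarith [this.1, this.2]

/-! ### Caccioppoli inequalities -/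

theorem ofReal_norm_sq {E : Type*} [NormedAddCommGroup E] (x : E) :
    ENNReal.ofReal (‖x‖ ^ 2) = ‖x‖ₑ ^ 2 := by
  rw [ENNReal.ofReal_pow (norm_nonneg _), ofReal_norm]

theorem integrable_inner_of_memLp {μ : Measure (STPt d)} {f g : STPt d → Pt d} (hf : MemLp f 2 μ)
    (hg : MemLp g 2 μ) : Integrable (fun z => ⟪f z, g z⟫) μ :=
  (hf.norm.integrable_mul hg.norm).mono (hf.1.inner hg.1) (Filter.Eventually.of_forall fun z => by
    simpa using abs_real_inner_le_norm (f z) (g z))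

/-- This is the integrand obtained by testing with φζ², where ∇φ = G - b and ∇ζ = ζ'g. Each of the
two cross terms is split by Young's inequality and absorbs a quarter of ζ²|G|²; half of it remains.
-/
theorem caccioppoli_pointwise {κ β ζ ζ' φ : ℝ} {G b g : Pt d} (hκ : 0 ≤ κ) (hb : ‖b‖ ^ 2 ≤ β)
    (hζ' : |ζ'| ≤ 1) (hφ : |φ| ≤ 1) :
    κ * (2⁻¹ * (ζ ^ 2 * ‖G‖ ^ 2)) ≤
      κ * ⟪G, ζ ^ 2 • (G - b) + (φ * (2 * ζ * ζ')) • g⟫ + κ * (β * ζ ^ 2 + 4 * ‖g‖ ^ 2) := by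
  rw [← mul_add]
  refine mul_le_mul_of_nonneg_left ?_ hκ
  rw [inner_add_right, inner_smul_right, inner_smul_right, inner_sub_right,
    real_inner_self_eq_norm_sq]
  have h1 : |⟪G, b⟫| ≤ ‖G‖ * ‖b‖ := abs_real_inner_le_norm G b
  have h2 : |⟪G, g⟫| ≤ ‖G‖ * ‖g‖ := abs_real_inner_le_norm G g
  have h3 : ζ ^ 2 * ⟪G, b⟫ ≤ 4⁻¹ * (ζ ^ 2 * ‖G‖ ^ 2) + ζ ^ 2 * β := by
    have : ⟪G, b⟫ ≤ 4⁻¹ * ‖G‖ ^ 2 + β := by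
      nlinarith [sq_nonneg (2⁻¹ * ‖G‖ - ‖b‖), le_abs_self ⟪G, b⟫]
    nlinarith [sq_nonneg ζ]
  have h4 : -(φ * (2 * ζ * ζ') * ⟪G, g⟫) ≤ 4⁻¹ * (ζ ^ 2 * ‖G‖ ^ 2) + 4 * ‖g‖ ^ 2 := by
    calc -(φ * (2 * ζ * ζ') * ⟪G, g⟫) ≤ |φ * (2 * ζ * ζ') * ⟪G, g⟫| := neg_le_abs _
      _ = 2 * |ζ| * (|φ| * |ζ'|) * |⟪G, g⟫| := by
          rw [abs_mul, abs_mul, abs_mul, abs_mul, abs_two]; ring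
      _ ≤ 2 * |ζ| * (1 * 1) * (‖G‖ * ‖g‖) := by gcongr
      _ ≤ 4⁻¹ * (|ζ| ^ 2 * ‖G‖ ^ 2) + 4 * ‖g‖ ^ 2 := by
          nlinarith [sq_nonneg (2⁻¹ * (|ζ| * ‖G‖) - 2 * ‖g‖)]
      _ = _ := by rw [sq_abs]
  linarith

/-- The basis equation is tested with the product of the indicator of I in time, φ = χ - g and
F(v)². Only spatial derivatives occur, so the indicator does no harm; φ vanishes on ∂K, so v needs
no boundary values on K. Boundedness of φ and F makes the product admissible. -/
theorem H10.caccioppoli_of_bounded {T : ℝ} {K Ω : Set (Pt d)} (hK : MeasurableSet K)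
    (hb : Bornology.IsBounded K) {κ₀ κ₁ : ℝ} (hκ₀ : 0 < κ₀) (hκ₁ : κ₀ ≤ κ₁) {κc : STPt d → ℝ}
    (hκm : AEMeasurable κc (volume.restrict (cyl T K))) (hκ : ∀ z ∈ cyl T K, κc z ∈ Icc κ₀ κ₁)
    {φ : STPt d → ℝ} {gφ G b : STPt d → Pt d} (hφ : H10 T K φ gφ)
    (hφ1 : ∀ᵐ z ∂volume.restrict (cyl T K), |φ z| ≤ 1)
    (hG : ∀ᵐ z ∂volume.restrict (cyl T K), G z - b z = gφ z)
    (hGm : MemLp G 2 (volume.restrict (cyl T K))) {β : ℝ}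
    (hbβ : ∀ z ∈ cyl T K, ‖b z‖ ^ 2 ≤ β)
    (heq : ∀ w gw, MemH10Zero T K w gw → ∫ z in cyl T K, κc z * ⟪G z, gw z⟫ = 0)
    {v : STPt d → ℝ} {g : STPt d → Pt d} (h : H10 T Ω v g) {I : Set ℝ} (hI : I ⊆ Ioo 0 T)
    (hIm : MeasurableSet I) {F F' : ℝ → ℝ} {N : ℝ} (hF : ∀ s, HasDerivAt F (F' s) s)
    (hF'c : Continuous F')
    (hF1 : ∀ s, |F' s| ≤ 1) (hFN : ∀ s, |F s| ≤ N) :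
    ∫⁻ z in I ×ˢ K, ‖G z‖ₑ ^ 2 * ‖F (v z)‖ₑ ^ 2 ≤
      ENNReal.ofReal (κ₁ / κ₀) * (2 * ENNReal.ofReal β * (∫⁻ z in I ×ˢ K, ‖F (v z)‖ₑ ^ 2) +
        8 * ∫⁻ z in I ×ˢ K, ‖g z‖ₑ ^ 2) := by
  classical
  have hQ := measurableSet_cyl (T := T) hK
  have hR : MeasurableSet (I ×ˢ K) := hIm.prod hK
  have hRQ : I ×ˢ K ⊆ cyl T K := prod_mono hI subset_rfl
  have hφm := hφ.meas_val
  have hgφm := hφ.meas_grad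
  have hvm := h.meas_val
  have hgm := h.meas_grad
  have hFc : Continuous F := continuous_iff_continuousAt.2 fun s => (hF s).continuousAt
  have hFm := hFc.measurable
  have hF'm := hF'c.measurable
  have hN : 0 ≤ N := (abs_nonneg _).trans (hFN 0)
  have hκ₁0 : 0 < κ₁ := by linarith
  have hd2 : ∀ s, HasDerivAt (fun s => F s ^ 2) (2 * F s * F' s) s := fun s => by
    simpa using (hF s).fun_pow 2
  have hF2 : LipschitzWith (2 * N).toNNReal fun s => F s ^ 2 := by
    refine lipschitzWith_of_hasDerivAt hd2 fun s => ?_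
    rw [abs_mul, abs_mul, abs_two, Real.coe_toNNReal _ (by positivity)]
    calc 2 * |F s| * |F' s| ≤ 2 * N * 1 := by gcongr; exacts [hFN s, hF1 s]
      _ = _ := mul_one _
  have hmono : volume.restrict (I ×ˢ K) ≤ volume.restrict (cyl T K) :=
    Measure.restrict_mono hRQ le_rfl
  set θ : ℝ → ℝ := I.indicator 1 with hθ
  have hθm : Measurable θ := measurable_one.indicator hIm
  have hθ1 : ∀ t, |θ t| ≤ 1 := fun t => by
    by_cases ht : t ∈ I <;> simp [hθ, ht]
  set q : STPt d → ℝ := fun z => θ z.1 * (φ z * F (v z) ^ 2) with hq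
  set gq : STPt d → Pt d := fun z =>
    θ z.1 • (F (v z) ^ 2 • gφ z + (φ z * (2 * F (v z) * F' (v z))) • g z) with hgq
  have hφ1' : ∀ᵐ z, |φ z| ≤ 1 := by
    rw [ae_restrict_iff' hQ] at hφ1
    filter_upwards [hφ1] with z hz
    by_cases hzQ : z ∈ cyl T K
    · exact hz hzQ
    · rw [hφ.val_zero z hzQ]; simp
  have hF2N : ∀ s, F s ^ 2 ≤ N ^ 2 := fun s => by
    rw [← sq_abs]; gcongr; exact hFN s
  have hqH : H10 T K q gq := by
    refine ⟨by fun_prop, by fun_prop, fun z hz => by simp [hq, hφ.val_zero z hz],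
      fun z hz => by simp [hgq, hφ.val_zero z hz, hφ.grad_zero z hz], ?_, ?_, fun y => ?_⟩
    · refine (hφ.memLp_val.const_mul (N ^ 2)).mono
        (by apply Measurable.aestronglyMeasurable; fun_prop) (Filter.Eventually.of_forall fun z => ?_)
      simp only [hq, norm_mul, Real.norm_eq_abs]
      rw [abs_of_nonneg (sq_nonneg (F (v z))), abs_of_nonneg (sq_nonneg N)]
      calc |θ z.1| * (|φ z| * F (v z) ^ 2) ≤ 1 * (|φ z| * N ^ 2) :=
            mul_le_mul (hθ1 _) (mul_le_mul_of_nonneg_left (hF2N _) (abs_nonneg _)) (by positivity)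
              zero_le_one
        _ = _ := by ring
    · have h1 : MemLp (fun z => (N ^ 2) * ‖gφ z‖ + (2 * N) * ‖g z‖) 2 volume :=
        (hφ.memLp_grad.norm.const_mul _).add (h.memLp_grad.norm.const_mul _)
      refine h1.mono (by apply Measurable.aestronglyMeasurable; fun_prop) ?_
      filter_upwards [hφ1'] with z hz
      rw [Real.norm_eq_abs, abs_of_nonneg (a := N ^ 2 * ‖gφ z‖ + 2 * N * ‖g z‖) (by positivity), hgq]
      simp only
      rw [norm_smul, Real.norm_eq_abs]
      calc |θ z.1| * ‖F (v z) ^ 2 • gφ z + (φ z * (2 * F (v z) * F' (v z))) • g z‖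
          ≤ 1 * (‖F (v z) ^ 2 • gφ z‖ + ‖(φ z * (2 * F (v z) * F' (v z))) • g z‖) := by
            gcongr
            exacts [hθ1 _, norm_add_le _ _]
        _ = F (v z) ^ 2 * ‖gφ z‖ + |φ z| * (2 * |F (v z)| * |F' (v z)|) * ‖g z‖ := by
            rw [norm_smul, norm_smul, Real.norm_eq_abs, Real.norm_eq_abs, abs_mul, abs_mul, abs_mul,
              abs_two, abs_of_nonneg (sq_nonneg (F (v z))), one_mul]
        _ ≤ N ^ 2 * ‖gφ z‖ + 1 * (2 * N * 1) * ‖g z‖ := by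
            refine add_le_add (mul_le_mul_of_nonneg_right (hF2N _) (norm_nonneg _)) ?_
            gcongr
            exacts [hFN _, hF1 _]
        _ = _ := by ring
    · have h1 := (h.lineAC y).comp hvm (by fun_prop) hF2 hd2
      have h2 := ((hφ.lineAC y).mul hφm (by fun_prop) (by fun_prop) (by fun_prop) h1).time_mul θ
      convert h2 using 2 with z
      rw [hgq]
      simp only [inner_smul_left, inner_add_left, conj_trivial]
      ring
  have h1 := heq q gq (hqH.memH10Zero hK hb)
  -- The indicator of I localizes the equation to the times in I.
  rw [setIntegral_eq_of_subset_of_forall_sdiff_eq_zero hQ hRQ] at h1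
  swap
  · rintro z ⟨hz1, hz2⟩
    have : z.1 ∉ I := fun h => hz2 ⟨h, hz1.2⟩
    simp [hgq, hθ, this]
  have hGm' := hGm.mono_measure hmono
  have hfin : IsFiniteMeasure (volume.restrict (I ×ˢ K)) :=
    ⟨by rw [Measure.restrict_apply_univ]; exact (measure_mono hRQ).trans_lt (volume_cyl_lt_top hb)⟩
  have hκm' := hκm.mono_measure hmono
  have hFv : AEStronglyMeasurable (fun z => F (v z) ^ 2) (volume.restrict (I ×ˢ K)) := by
    apply Measurable.aestronglyMeasurable; fun_prop
  have hFvb : ∀ᵐ z ∂volume.restrict (I ×ˢ K), ‖F (v z) ^ 2‖ ≤ N ^ 2 :=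
    Filter.Eventually.of_forall fun z => by
      rw [Real.norm_eq_abs, abs_of_nonneg (sq_nonneg _)]; exact hF2N _
  have i1 : Integrable (fun z => κ₀ * (2⁻¹ * (F (v z) ^ 2 * ‖G z‖ ^ 2)))
      (volume.restrict (I ×ˢ K)) :=
    ((((memLp_two_iff_integrable_sq_norm hGm'.1).1 hGm').bdd_mul (c := N ^ 2)
      hFv hFvb).const_mul _).const_mul _
  have i2 : Integrable (fun z => κc z * ⟪G z, gq z⟫) (volume.restrict (I ×ˢ K)) := by
    refine Integrable.bdd_mul (c := κ₁) ?_ hκm'.aestronglyMeasurable ?_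
    · exact integrable_inner_of_memLp hGm' (hqH.memLp_grad.restrict _)
    · filter_upwards [ae_restrict_mem hR] with z hz
      have := hκ z (hRQ hz)
      rw [Real.norm_eq_abs, abs_of_nonneg (by linarith [this.1])]
      exact this.2
  have i3 : Integrable (fun z => κ₁ * (β * F (v z) ^ 2 + 4 * ‖g z‖ ^ 2))
      (volume.restrict (I ×ˢ K)) := by
    refine Integrable.const_mul (Integrable.add ?_ ?_) _
    · exact ((integrable_const (1:ℝ)).bdd_mul (c := N ^ 2) hFv hFvb |>.congr
        (by simp)).const_mul β
    · exact ((memLp_two_iff_integrable_sq_norm (h.memLp_grad.restrict _).1).1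
        (h.memLp_grad.restrict _)).const_mul 4
  have hle : ∫ z in I ×ˢ K, κ₀ * (2⁻¹ * (F (v z) ^ 2 * ‖G z‖ ^ 2)) ≤
      ∫ z in I ×ˢ K, κ₁ * (β * F (v z) ^ 2 + 4 * ‖g z‖ ^ 2) := by
    rw [← zero_add (∫ z in I ×ˢ K, κ₁ * (β * F (v z) ^ 2 + 4 * ‖g z‖ ^ 2)), ← h1,
      ← integral_add i2 i3]
    apply integral_mono_ae i1 (i2.add i3)
    filter_upwards [ae_restrict_mem hR, ae_mono hmono hG, ae_mono hmono hφ1] with z hz hz1 hz2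
    have hk := hκ z (hRQ hz)
    have hbz := hbβ z (hRQ hz)
    have := caccioppoli_pointwise (G := G z) (b := b z) (g := g z) (ζ := F (v z))
      (by linarith [hk.1] : 0 ≤ κc z) hbz (hF1 (v z)) hz2
    have hβ : 0 ≤ β := (sq_nonneg _).trans hbz
    have hgqz : gq z = F (v z) ^ 2 • (G z - b z) + (φ z * (2 * F (v z) * F' (v z))) • g z := by
      simp [hgq, hθ, hz.1, hz1]
    simp only [Pi.add_apply]
    rw [hgqz]
    have e1 : κ₀ * (2⁻¹ * (F (v z) ^ 2 * ‖G z‖ ^ 2)) ≤ κc z * (2⁻¹ * (F (v z) ^ 2 * ‖G z‖ ^ 2)) := by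
      gcongr; exact hk.1
    have e2 : κc z * (β * F (v z) ^ 2 + 4 * ‖g z‖ ^ 2) ≤ κ₁ * (β * F (v z) ^ 2 + 4 * ‖g z‖ ^ 2) := by
      gcongr; exact hk.2
    linarith
  by_cases hβ : 0 ≤ β
  swap
  · have : I ×ˢ K = ∅ := by
      rw [eq_empty_iff_forall_notMem]
      exact fun z hz => hβ ((sq_nonneg _).trans (hbβ z (hRQ hz)))
    simp [this]
  have hle2 := ENNReal.ofReal_le_ofReal hle
  rw [ofReal_integral_eq_lintegral_ofReal i1 (Filter.Eventually.of_forall fun z => by positivity),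
    ofReal_integral_eq_lintegral_ofReal i3 (Filter.Eventually.of_forall fun z => by positivity)] at hle2
  have e1 : ∀ z, ENNReal.ofReal (κ₀ * (2⁻¹ * (F (v z) ^ 2 * ‖G z‖ ^ 2))) =
      ENNReal.ofReal (κ₀ / 2) * (‖G z‖ₑ ^ 2 * ‖F (v z)‖ₑ ^ 2) := by
    intro z
    rw [← ofReal_norm_sq, ← ofReal_norm_sq, ← ENNReal.ofReal_mul (by positivity),
      ← ENNReal.ofReal_mul (by positivity), Real.norm_eq_abs, sq_abs]
    congr 1; ring
  have e2 : ∀ z, ENNReal.ofReal (κ₁ * (β * F (v z) ^ 2 + 4 * ‖g z‖ ^ 2)) =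
      ENNReal.ofReal κ₁ * (ENNReal.ofReal β * ‖F (v z)‖ₑ ^ 2 + 4 * ‖g z‖ₑ ^ 2) := by
    intro z
    rw [ENNReal.ofReal_mul hκ₁0.le, ENNReal.ofReal_add (by positivity) (by positivity),
      ENNReal.ofReal_mul hβ, ENNReal.ofReal_mul (by norm_num), ← ofReal_norm_sq, ← ofReal_norm_sq,
      Real.norm_eq_abs, sq_abs]
    norm_num
  simp only [e1, e2] at hle2
  rw [lintegral_const_mul' _ _ ENNReal.ofReal_ne_top, lintegral_const_mul' _ _ ENNReal.ofReal_ne_top,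
    lintegral_add_left (by fun_prop), lintegral_const_mul' _ _ ENNReal.ofReal_ne_top,
    lintegral_const_mul' _ _ (by norm_num)] at hle2
  have h3 : ENNReal.ofReal (2 / κ₀) * ENNReal.ofReal (κ₀ / 2) = 1 := by
    rw [← ENNReal.ofReal_mul (by positivity)]
    rw [show 2 / κ₀ * (κ₀ / 2) = 1 by field_simp, ENNReal.ofReal_one]
  have h4 : ENNReal.ofReal (2 / κ₀) * ENNReal.ofReal κ₁ = ENNReal.ofReal (κ₁ / κ₀) * 2 := by
    rw [← ENNReal.ofReal_mul (by positivity), show (2:ℝ≥0∞) = ENNReal.ofReal 2 by norm_num,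
      ← ENNReal.ofReal_mul (by positivity)]
    congr 1; ring
  calc ∫⁻ z in I ×ˢ K, ‖G z‖ₑ ^ 2 * ‖F (v z)‖ₑ ^ 2
      = ENNReal.ofReal (2 / κ₀) * (ENNReal.ofReal (κ₀ / 2) *
          ∫⁻ z in I ×ˢ K, ‖G z‖ₑ ^ 2 * ‖F (v z)‖ₑ ^ 2) := by rw [← mul_assoc, h3, one_mul]
    _ ≤ ENNReal.ofReal (2 / κ₀) * (ENNReal.ofReal κ₁ *
          (ENNReal.ofReal β * (∫⁻ z in I ×ˢ K, ‖F (v z)‖ₑ ^ 2) +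
            4 * ∫⁻ z in I ×ˢ K, ‖g z‖ₑ ^ 2)) := by gcongr
    _ = _ := by rw [← mul_assoc, h4]; ring

theorem hasDerivAt_arctan_scaled {N : ℝ} (hN : N ≠ 0) (c s : ℝ) :
    HasDerivAt (fun s => N * Real.arctan ((s - c) / N)) (1 / (1 + ((s - c) / N) ^ 2)) s := by
  have h1 : HasDerivAt (fun s => (s - c) / N) (1 / N) s :=
    ((hasDerivAt_id s).sub_const c).div_const N
  have := (h1.arctan).const_mul N
  have e : 1 / (1 + ((s - c) / N) ^ 2) = N * (1 / (1 + ((s - c) / N) ^ 2) * (1 / N)) := by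
    rw [mul_comm, mul_assoc, one_div_mul_cancel hN, mul_one]
  rw [e]
  exact this

theorem abs_arctan_le (x : ℝ) : |Real.arctan x| ≤ |x| := by
  have h : LipschitzWith 1 Real.arctan :=
    lipschitzWith_of_hasDerivAt (fun s => Real.hasDerivAt_arctan s) fun s => by
      rw [abs_of_nonneg (by positivity), NNReal.coe_one, div_le_one (by positivity)]
      nlinarith [sq_nonneg s]
  simpa [Real.dist_eq] using h.dist_le_mul x 0

/-- The bound for bounded F does not depend on the supremum of F. Truncations of s - c that are
bounded and 1-Lipschitz are inserted, and Fatou's lemma gives the limit. -/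
theorem H10.caccioppoli {T : ℝ} {K Ω : Set (Pt d)} (hK : MeasurableSet K)
    (hb : Bornology.IsBounded K) {κ₀ κ₁ : ℝ} (hκ₀ : 0 < κ₀) (hκ₁ : κ₀ ≤ κ₁) {κc : STPt d → ℝ}
    (hκm : AEMeasurable κc (volume.restrict (cyl T K))) (hκ : ∀ z ∈ cyl T K, κc z ∈ Icc κ₀ κ₁)
    {φ : STPt d → ℝ} {gφ G b : STPt d → Pt d} (hφ : H10 T K φ gφ)
    (hφ1 : ∀ᵐ z ∂volume.restrict (cyl T K), |φ z| ≤ 1)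
    (hG : ∀ᵐ z ∂volume.restrict (cyl T K), G z - b z = gφ z)
    (hGm : MemLp G 2 (volume.restrict (cyl T K))) {β : ℝ}
    (hbβ : ∀ z ∈ cyl T K, ‖b z‖ ^ 2 ≤ β)
    (heq : ∀ w gw, MemH10Zero T K w gw → ∫ z in cyl T K, κc z * ⟪G z, gw z⟫ = 0)
    {v : STPt d → ℝ} {g : STPt d → Pt d} (h : H10 T Ω v g) (c : ℝ) {I : Set ℝ} (hI : I ⊆ Ioo 0 T)
    (hIm : MeasurableSet I) :
    ∫⁻ z in I ×ˢ K, ‖G z‖ₑ ^ 2 * ‖v z - c‖ₑ ^ 2 ≤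
      ENNReal.ofReal (κ₁ / κ₀) * (2 * ENNReal.ofReal β * (∫⁻ z in I ×ˢ K, ‖v z - c‖ₑ ^ 2) +
        8 * ∫⁻ z in I ×ˢ K, ‖g z‖ₑ ^ 2) := by
  have hmono : volume.restrict (I ×ˢ K) ≤ volume.restrict (cyl T K) :=
    Measure.restrict_mono (prod_mono hI subset_rfl) le_rfl
  have hGm' := (hGm.mono_measure hmono).1
  have hvm := h.meas_val
  -- Scaled arctangents are everywhere differentiable truncations: |F n s| ≤ |s - c| and F n s → s -
  -- c.
  set F : ℕ → ℝ → ℝ := fun n s => ((n : ℝ) + 1) * Real.arctan ((s - c) / ((n : ℝ) + 1)) with hF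
  have hFle : ∀ n s, |F n s| ≤ |s - c| := by
    intro n s
    have hn : (0:ℝ) < (n : ℝ) + 1 := by positivity
    rw [hF]; simp only
    rw [abs_mul, abs_of_pos hn]
    calc ((n : ℝ) + 1) * |Real.arctan ((s - c) / ((n : ℝ) + 1))|
        ≤ ((n : ℝ) + 1) * |(s - c) / ((n : ℝ) + 1)| :=
          mul_le_mul_of_nonneg_left (abs_arctan_le _) hn.le
      _ = |s - c| := by rw [abs_div, abs_of_pos hn]; field_simp
  have hlim : ∀ s, Filter.Tendsto (fun n => F n s) Filter.atTop (nhds (s - c)) := by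
    intro s
    rcases eq_or_ne (s - c) 0 with h0 | h0
    · simp [hF, h0]
    have h1 := (hasDerivAt_iff_tendsto_slope.1 (Real.hasDerivAt_arctan 0))
    have h2 : Filter.Tendsto (fun n : ℕ => (s - c) / ((n : ℝ) + 1)) Filter.atTop
        (nhdsWithin 0 {0}ᶜ) := by
      rw [tendsto_nhdsWithin_iff]
      refine ⟨tendsto_const_nhds.div_atTop
        (Filter.tendsto_atTop_add_const_right _ _ tendsto_natCast_atTop_atTop),
        Filter.Eventually.of_forall fun n => ?_⟩
      have hn : (0:ℝ) < (n : ℝ) + 1 := by positivity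
      exact div_ne_zero h0 hn.ne'
    have h3 := (h1.comp h2).const_mul (s - c)
    simp only [ne_eq, OfNat.ofNat_ne_zero, not_false_eq_true, zero_pow, add_zero, div_one,
      mul_one] at h3
    refine h3.congr fun n => ?_
    have hn : (0:ℝ) < (n : ℝ) + 1 := by positivity
    simp only [hF, Function.comp, slope_def_field, Real.arctan_zero, sub_zero]
    field_simp
  have hbound : ∀ n, ∫⁻ z in I ×ˢ K, ‖G z‖ₑ ^ 2 * ‖F n (v z)‖ₑ ^ 2 ≤
      ENNReal.ofReal (κ₁ / κ₀) * (2 * ENNReal.ofReal β * (∫⁻ z in I ×ˢ K, ‖v z - c‖ₑ ^ 2) +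
        8 * ∫⁻ z in I ×ˢ K, ‖g z‖ₑ ^ 2) := by
    intro n
    have hn : (0:ℝ) < (n : ℝ) + 1 := by positivity
    refine (H10.caccioppoli_of_bounded hK hb hκ₀ hκ₁ hκm hκ hφ hφ1 hG hGm hbβ heq h hI hIm
      (N := ((n : ℝ) + 1) * (Real.pi / 2))
      (fun s => hasDerivAt_arctan_scaled hn.ne' c s) ?_ ?_ ?_).trans ?_
    · refine Continuous.div (by fun_prop) (by fun_prop) fun s => by positivity
    · intro s
      rw [abs_of_nonneg (by positivity), div_le_one (by positivity)]
      nlinarith [sq_nonneg ((s - c) / ((n : ℝ) + 1))]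
    · intro s
      rw [abs_mul, abs_of_pos hn]
      refine mul_le_mul_of_nonneg_left ?_ hn.le
      exact abs_le.2 ⟨(Real.neg_pi_div_two_lt_arctan _).le, (Real.arctan_lt_pi_div_two _).le⟩
    · gcongr with z
      rw [enorm_le_iff_norm_le]
      exact hFle n (v z)
  have hFm : ∀ n, Measurable (F n) := fun n => by
    have := Real.continuous_arctan.measurable
    fun_prop
  calc ∫⁻ z in I ×ˢ K, ‖G z‖ₑ ^ 2 * ‖v z - c‖ₑ ^ 2
      = ∫⁻ z in I ×ˢ K, Filter.liminf (fun n => ‖G z‖ₑ ^ 2 * ‖F n (v z)‖ₑ ^ 2) Filter.atTop := by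
        congr 1; funext z
        symm
        apply Filter.Tendsto.liminf_eq
        refine ENNReal.Tendsto.const_mul ?_ (Or.inr (by simp))
        exact (ENNReal.continuous_pow 2).continuousAt.tendsto.comp
          ((continuous_enorm.tendsto _).comp (hlim (v z)))
    _ ≤ Filter.liminf (fun n => ∫⁻ z in I ×ˢ K, ‖G z‖ₑ ^ 2 * ‖F n (v z)‖ₑ ^ 2) Filter.atTop := by
        apply lintegral_liminf_le'
        intro n
        have := hFm n
        exact (hGm'.enorm.pow_const 2).mul (by fun_prop)
    _ ≤ _ := by
        refine Filter.liminf_le_of_frequently_le' (Filter.Frequently.of_forall hbound)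

/-! ### Time meshes -/

namespace TimeMesh
variable {T : ℝ} (τ : TimeMesh T)

theorem t_nonneg (k : Fin (τ.N + 1)) : 0 ≤ τ.t k := by
  rw [← τ.t_zero]; exact τ.strictMono.monotone (Fin.zero_le k)

theorem t_le (k : Fin (τ.N + 1)) : τ.t k ≤ T := by
  conv_rhs => rw [← τ.t_last]
  exact τ.strictMono.monotone (Fin.le_last k)

theorem step_pos (n : Fin τ.N) : 0 < τ.t n.succ - τ.t n.castSucc :=
  sub_pos.2 (τ.strictMono Fin.castSucc_lt_succ)

theorem step_le_dt (n : Fin τ.N) : τ.t n.succ - τ.t n.castSucc ≤ τ.dt :=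
  le_ciSup (f := fun n : Fin τ.N => τ.t n.succ - τ.t n.castSucc) (finite_range _).bddAbove n

/-- The open coarse time interval. -/
def openInterval (n : Fin τ.N) : Set ℝ := Ioo (τ.t n.castSucc) (τ.t n.succ)

theorem openInterval_subset_interval (n : Fin τ.N) : τ.openInterval n ⊆ τ.interval n :=
  Ioo_subset_Ioc_self

theorem openInterval_subset (n : Fin τ.N) : τ.openInterval n ⊆ Ioo 0 T :=
  Ioo_subset_Ioo (τ.t_nonneg _) (τ.t_le _)

theorem interval_inj {n m : Fin τ.N} {t : ℝ} (hn : t ∈ τ.interval n) (hm : t ∈ τ.interval m) :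
    n = m := by
  by_contra hne
  wlog h : n < m generalizing n m
  · exact this hm hn (Ne.symm hne) (lt_of_le_of_ne (not_lt.1 h) (Ne.symm hne))
  have h1 : τ.t n.succ ≤ τ.t m.castSucc :=
    τ.strictMono.monotone (Fin.succ_le_castSucc_iff.2 h)
  exact absurd hm.1 (not_lt.2 (hn.2.trans h1))

theorem exists_mem_interval {t : ℝ} (ht : t ∈ Ioc 0 T) : ∃ n, t ∈ τ.interval n := by
  by_contra hcon
  push Not at hcon
  have h : ∀ k : Fin (τ.N + 1), τ.t k < t := by
    intro k
    induction k using Fin.induction with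
    | zero => rw [τ.t_zero]; exact ht.1
    | succ n ih =>
      by_contra hle
      exact hcon n ⟨ih, not_lt.1 hle⟩
  have := h (Fin.last _)
  rw [τ.t_last] at this
  exact absurd ht.2 (not_le.2 this)

theorem ae_exists_mem_openInterval :
    ∀ᵐ t : ℝ, t ∈ Ioo 0 T → ∃ n, t ∈ τ.openInterval n := by
  have h1 : ∀ᵐ t : ℝ, t ∉ range τ.t := (countable_range τ.t).ae_notMem _
  filter_upwards [h1] with t ht ht2
  obtain ⟨n, hn⟩ := τ.exists_mem_interval ⟨ht2.1, ht2.2.le⟩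
  exact ⟨n, hn.1, lt_of_le_of_ne hn.2 fun h => ht ⟨_, h.symm⟩⟩

variable {Ω : Set (Pt d)}

theorem cyl_ae_eq_iUnion (Ω : Set (Pt d)) :
    (cyl T Ω : Set (STPt d)) =ᵐ[volume] ⋃ n, τ.openInterval n ×ˢ Ω := by
  have h1 := ae_of_ae_time (d := d) τ.ae_exists_mem_openInterval
  filter_upwards [h1] with z hz
  apply propext
  constructor
  · rintro ⟨hz1, hz2⟩
    obtain ⟨n, hn⟩ := hz hz1
    exact mem_iUnion.2 ⟨n, hn, hz2⟩
  · intro hmem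
    obtain ⟨n, hn⟩ := mem_iUnion.1 hmem
    exact ⟨τ.openInterval_subset n hn.1, hn.2⟩

theorem pairwise_disjoint_openInterval (Ω : Set (Pt d)) :
    Pairwise (Function.onFun Disjoint fun n => τ.openInterval n ×ˢ Ω) := by
  intro n m hnm
  refine disjoint_left.2 fun z hz hz2 => hnm ?_
  exact τ.interval_inj (τ.openInterval_subset_interval n hz.1) (τ.openInterval_subset_interval m hz2.1)

theorem lintegral_cyl (hΩ : MeasurableSet Ω) (f : STPt d → ℝ≥0∞) :
    ∫⁻ z in cyl T Ω, f z = ∑ n, ∫⁻ z in τ.openInterval n ×ˢ Ω, f z := by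
  have hm : ∀ n, MeasurableSet (τ.openInterval n ×ˢ Ω) := fun n => measurableSet_Ioo.prod hΩ
  rw [Measure.restrict_congr_set (τ.cyl_ae_eq_iUnion Ω), lintegral_iUnion hm (τ.pairwise_disjoint_openInterval Ω),
    tsum_fintype]

theorem interval_prod_ae_eq (n : Fin τ.N) (Ω : Set (Pt d)) :
    (τ.interval n ×ˢ Ω : Set (STPt d)) =ᵐ[volume] τ.openInterval n ×ˢ Ω := by
  have h1 : ∀ᵐ t : ℝ, t ∉ range τ.t := (countable_range τ.t).ae_notMem _
  filter_upwards [ae_of_ae_time (d := d) h1] with z hz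
  apply propext
  refine ⟨fun h => ⟨⟨h.1.1, lt_of_le_of_ne h.1.2 fun h => hz ⟨_, h.symm⟩⟩, h.2⟩,
    fun h => ⟨τ.openInterval_subset_interval n h.1, h.2⟩⟩

theorem integral_cyl (hΩ : MeasurableSet Ω) {f : STPt d → ℝ}
    (hf : IntegrableOn f (cyl T Ω)) :
    ∫ z in cyl T Ω, f z = ∑ n, ∫ z in τ.interval n ×ˢ Ω, f z := by
  have hm : ∀ n, MeasurableSet (τ.openInterval n ×ˢ Ω) := fun n => measurableSet_Ioo.prod hΩ
  have h1 := hf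
  rw [integrableOn_congr_set_ae (τ.cyl_ae_eq_iUnion Ω)] at h1
  rw [setIntegral_congr_set (τ.cyl_ae_eq_iUnion Ω),
    integral_iUnion hm (τ.pairwise_disjoint_openInterval Ω) h1,
    tsum_fintype]
  exact Finset.sum_congr rfl fun n _ => (setIntegral_congr_set (τ.interval_prod_ae_eq n Ω)).symm

/-! ### Oscillation and primitive in time. -/

variable {E : Type*} [NormedAddCommGroup E] [NormedSpace ℝ E]

/-- The oscillation in time: the difference to the mean value over each coarse time interval. -/
def osc (v : STPt d → E) (z : STPt d) : E :=
  ∑ n, (τ.interval n).indicator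
    (fun _ => v z - timeMean (τ.t n.castSucc) (τ.t n.succ) v z.2) z.1

theorem osc_of_mem (v : STPt d → E) {z : STPt d} {n : Fin τ.N} (hz : z.1 ∈ τ.interval n) :
    τ.osc v z = v z - timeMean (τ.t n.castSucc) (τ.t n.succ) v z.2 := by
  rw [osc, Finset.sum_eq_single n, indicator_of_mem hz]
  · intro m _ hm
    exact indicator_of_notMem (fun h => hm (τ.interval_inj h hz)) _
  · simp

theorem timeMean_of_notMem {v : STPt d → E} (hv : ∀ z ∉ cyl T Ω, v z = 0) (a b : ℝ) {x : Pt d}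
    (hx : x ∉ Ω) : timeMean a b v x = 0 := by
  simp [timeMean, hv (_, x) fun h => hx h.2]

theorem measurable_osc [MeasurableSpace E] [BorelSpace E] [SecondCountableTopology E]
    {v : STPt d → E} (hv : Measurable v) : Measurable (τ.osc v) := by
  unfold osc
  refine Finset.measurable_sum _ fun n _ => ?_
  have h1 : (fun z : STPt d => (τ.interval n).indicator
      (fun _ => v z - timeMean (τ.t n.castSucc) (τ.t n.succ) v z.2) z.1) =
      ((fun z : STPt d => z.1) ⁻¹' τ.interval n).indicator
        fun z => v z - timeMean (τ.t n.castSucc) (τ.t n.succ) v z.2 := by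
    funext z
    by_cases hz : z.1 ∈ τ.interval n <;> simp [hz]
  rw [h1]
  have := measurable_timeMean (τ.t n.castSucc) (τ.t n.succ) hv
  exact (by fun_prop : Measurable fun z : STPt d =>
    v z - timeMean (τ.t n.castSucc) (τ.t n.succ) v z.2).indicator (measurableSet_Ioc.preimage measurable_fst)

end TimeMesh

/-- Lower bounds of integrals over products. -/
theorem lintegral_prod_set {I : Set ℝ} {K : Set (Pt d)} {f : STPt d → ℝ≥0∞} (hf : Measurable f) :
    ∫⁻ z in I ×ˢ K, f z = ∫⁻ x in K, ∫⁻ t in I, f (t, x) := by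
  rw [Measure.volume_eq_prod, ← Measure.prod_restrict, lintegral_prod_symm _ hf.aemeasurable]

section
variable {E : Type*} [NormedAddCommGroup E] [NormedSpace ℝ E]

theorem enorm_timeMean_sq_le {a b : ℝ} (hab : a < b) (v : STPt d → E) (x : Pt d)
    (hv : AEMeasurable (fun s => ‖v (s, x)‖ₑ) (volume.restrict (Ioc a b))) :
    ENNReal.ofReal (b - a) * ‖timeMean a b v x‖ₑ ^ 2 ≤ ∫⁻ s in Ioc a b, ‖v (s, x)‖ₑ ^ 2 := by
  have hba : 0 < b - a := sub_pos.2 hab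
  have h0 : ENNReal.ofReal (b - a) ≠ 0 := by simpa using hab
  have h1 : ‖timeMean a b v x‖ₑ ≤ (ENNReal.ofReal (b - a))⁻¹ * ∫⁻ s in Ioc a b, ‖v (s, x)‖ₑ := by
    rw [timeMean, enorm_smul, Real.enorm_eq_ofReal (by positivity), ENNReal.ofReal_inv_of_pos hba]
    gcongr
    exact enorm_integral_le_lintegral_enorm _
  have h2 := sq_lintegral_le hv
  rw [Measure.restrict_apply_univ, Real.volume_Ioc] at h2
  have h3 := ENNReal.inv_mul_cancel h0 ENNReal.ofReal_ne_top
  calc ENNReal.ofReal (b - a) * ‖timeMean a b v x‖ₑ ^ 2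
      ≤ ENNReal.ofReal (b - a) * ((ENNReal.ofReal (b - a))⁻¹ * ∫⁻ s in Ioc a b, ‖v (s, x)‖ₑ) ^ 2 := by
        gcongr
    _ = ((ENNReal.ofReal (b - a))⁻¹ * ENNReal.ofReal (b - a)) * (ENNReal.ofReal (b - a))⁻¹ *
          (∫⁻ s in Ioc a b, ‖v (s, x)‖ₑ) ^ 2 := by ring
    _ ≤ 1 * (ENNReal.ofReal (b - a))⁻¹ * (ENNReal.ofReal (b - a) * ∫⁻ s in Ioc a b, ‖v (s, x)‖ₑ ^ 2) := by
        rw [h3]; gcongr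
    _ = ((ENNReal.ofReal (b - a))⁻¹ * ENNReal.ofReal (b - a)) * ∫⁻ s in Ioc a b, ‖v (s, x)‖ₑ ^ 2 := by
        ring
    _ = _ := by rw [h3, one_mul]

theorem enorm_sub_sq_le {E : Type*} [NormedAddCommGroup E] (a b : E) : ‖a - b‖ₑ ^ 2 ≤ 2 * ‖a‖ₑ ^ 2 + 2 * ‖b‖ₑ ^ 2 :=
  (pow_le_pow_left₀ (zero_le (a := ‖a - b‖ₑ)) (enorm_sub_le) 2).trans (add_sq_le_two_mul _ _)

/-- The time mean is bounded by Jensen's inequality; the factor 4 comes from splitting the square of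
a difference. -/
theorem TimeMesh.lintegral_osc_le [MeasurableSpace E] [BorelSpace E] [SecondCountableTopology E]
    {T : ℝ} (τ : TimeMesh T) {Ω : Set (Pt d)} (hΩ : MeasurableSet Ω) {v : STPt d → E}
    (hv : Measurable v) :
    ∫⁻ z in cyl T Ω, ‖τ.osc v z‖ₑ ^ 2 ≤ 4 * ∫⁻ z in cyl T Ω, ‖v z‖ₑ ^ 2 := by
  rw [τ.lintegral_cyl hΩ, τ.lintegral_cyl hΩ, Finset.mul_sum]
  refine Finset.sum_le_sum fun n _ => ?_
  have ho := τ.measurable_osc hv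
  rw [lintegral_prod_set (by fun_prop), lintegral_prod_set (by fun_prop),
    ← lintegral_const_mul' _ _ (by norm_num)]
  refine lintegral_mono fun x => ?_
  have hn := sub_pos.1 (τ.step_pos n)
  have h1 := enorm_timeMean_sq_le hn v x (by fun_prop)
  have h2 : ∀ t ∈ τ.openInterval n, ‖τ.osc v (t, x)‖ₑ ^ 2 ≤
      2 * ‖v (t, x)‖ₑ ^ 2 + 2 * ‖timeMean (τ.t n.castSucc) (τ.t n.succ) v x‖ₑ ^ 2 := by
    intro t ht
    rw [τ.osc_of_mem v (n := n) (τ.openInterval_subset_interval n ht)]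
    exact enorm_sub_sq_le _ _
  calc ∫⁻ t in τ.openInterval n, ‖τ.osc v (t, x)‖ₑ ^ 2
      ≤ ∫⁻ t in τ.openInterval n, (2 * ‖v (t, x)‖ₑ ^ 2 +
          2 * ‖timeMean (τ.t n.castSucc) (τ.t n.succ) v x‖ₑ ^ 2) :=
        setLIntegral_mono (by fun_prop) h2
    _ = 2 * (∫⁻ t in τ.openInterval n, ‖v (t, x)‖ₑ ^ 2) +
          2 * (ENNReal.ofReal (τ.t n.succ - τ.t n.castSucc) *
            ‖timeMean (τ.t n.castSucc) (τ.t n.succ) v x‖ₑ ^ 2) := by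
        rw [lintegral_add_left (by fun_prop), lintegral_const_mul' _ _ (by norm_num),
          setLIntegral_const, TimeMesh.openInterval, Real.volume_Ioo]
        ring
    _ ≤ 2 * (∫⁻ t in τ.openInterval n, ‖v (t, x)‖ₑ ^ 2) +
          2 * ∫⁻ t in τ.openInterval n, ‖v (t, x)‖ₑ ^ 2 := by
        gcongr
        refine h1.trans_eq ?_
        exact setLIntegral_congr Ioo_ae_eq_Ioc.symm
    _ = _ := by ring

/-- The primitive in time. -/
def prim (v : STPt d → E) (z : STPt d) : E := ∫ s in Ioc 0 z.1, v (s, z.2)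

theorem measurable_prim [MeasurableSpace E] [BorelSpace E] [SecondCountableTopology E]
    {v : STPt d → E} (hv : Measurable v) : Measurable (prim v) := by
  have h1 : prim v = fun z => ∫ x, ({q : STPt d × ℝ | q.2 ∈ Ioc 0 q.1.1}.indicator
        (fun q => v (q.2, q.1.2))) (z, x) := by
    funext z
    rw [prim, ← integral_indicator measurableSet_Ioc]
    rfl
  rw [h1]
  refine (StronglyMeasurable.integral_prod_right' (ν := volume)
    (f := {q : STPt d × ℝ | q.2 ∈ Ioc 0 q.1.1}.indicator (fun q => v (q.2, q.1.2))) ?_).measurable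
  apply Measurable.stronglyMeasurable
  refine Measurable.indicator (by fun_prop) ?_
  exact (measurableSet_lt measurable_const measurable_snd).inter
    (measurableSet_le measurable_snd (by fun_prop))

theorem TimeMesh.integral_osc_eq_zero [CompleteSpace E] {T : ℝ} (τ : TimeMesh T) {v : STPt d → E} {x : Pt d}
    (hv : Integrable fun s => v (s, x)) (n : Fin τ.N) :
    ∫ s in τ.interval n, τ.osc v (s, x) = 0 := by
  have hs := τ.step_pos n
  have hm : MeasurableSet (τ.interval n) := measurableSet_Ioc
  have hf : volume (τ.interval n) ≠ ∞ := by simp [interval]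
  have : IsFiniteMeasure (volume.restrict (τ.interval n)) := ⟨by simpa using hf.lt_top⟩
  rw [setIntegral_congr_fun (g := fun s => v (s, x) - timeMean (τ.t n.castSucc) (τ.t n.succ) v x)
    hm fun s hs => τ.osc_of_mem v hs, integral_sub hv.restrict (integrable_const _),
    setIntegral_const, timeMean, measureReal_def, interval, Real.volume_Ioc,
    ENNReal.toReal_ofReal hs.le, smul_smul, mul_inv_cancel₀ hs.ne', one_smul, sub_self]

/-- The integrals over the coarse intervals up to a mesh time all vanish, and so does their sum. -/
theorem TimeMesh.prim_eq_zero {T : ℝ} (τ : TimeMesh T) {ω : STPt d → E} {x : Pt d}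
    (hω : Integrable fun s => ω (s, x)) (h0 : ∀ n, ∫ s in τ.interval n, ω (s, x) = 0)
    (k : Fin (τ.N + 1)) : prim ω (τ.t k, x) = 0 := by
  induction k using Fin.induction with
  | zero => simp [prim, τ.t_zero]
  | succ n ih =>
    have h1 := h0 n
    simp only [prim] at ih ⊢
    rw [← Ioc_union_Ioc_eq_Ioc (τ.t_nonneg n.castSucc) (sub_pos.1 (τ.step_pos n)).le,
      setIntegral_union (Ioc_disjoint_Ioc_of_le le_rfl) measurableSet_Ioc hω.integrableOn
        hω.integrableOn, ih, zero_add]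
    exact h1

theorem TimeMesh.prim_eq {T : ℝ} (τ : TimeMesh T) {ω : STPt d → E} {x : Pt d}
    (hω : Integrable fun s => ω (s, x)) (h0 : ∀ n, ∫ s in τ.interval n, ω (s, x) = 0)
    {n : Fin τ.N} {t : ℝ} (ht : t ∈ τ.interval n) :
    prim ω (t, x) = ∫ s in Ioc (τ.t n.castSucc) t, ω (s, x) := by
  have h1 := τ.prim_eq_zero hω h0 n.castSucc
  simp only [prim] at h1 ⊢
  rw [← Ioc_union_Ioc_eq_Ioc (τ.t_nonneg n.castSucc) ht.1.le,
    setIntegral_union (Ioc_disjoint_Ioc_of_le le_rfl) measurableSet_Ioc hω.integrableOn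
      hω.integrableOn, h1, zero_add]

/-- Since the primitive vanishes at the mesh times, it only sees the part of its own coarse interval
before t. Cauchy-Schwarz there gains powers of Δt instead of T. -/
theorem TimeMesh.lintegral_prim_le [MeasurableSpace E] [BorelSpace E] [SecondCountableTopology E]
    {T : ℝ} (τ : TimeMesh T) {Ω : Set (Pt d)} (hΩ : MeasurableSet Ω) {ω : STPt d → E}
    (hm : Measurable ω) (hω : ∀ᵐ x : Pt d, Integrable fun s => ω (s, x))
    (h0 : ∀ᵐ x : Pt d, ∀ n, ∫ s in τ.interval n, ω (s, x) = 0) :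
    ∫⁻ z in cyl T Ω, ‖prim ω z‖ₑ ^ 2 ≤ ENNReal.ofReal τ.dt ^ 2 * ∫⁻ z in cyl T Ω, ‖ω z‖ₑ ^ 2 := by
  rw [τ.lintegral_cyl hΩ, τ.lintegral_cyl hΩ, Finset.mul_sum]
  refine Finset.sum_le_sum fun n _ => ?_
  have hp := measurable_prim hm
  rw [lintegral_prod_set (by fun_prop), lintegral_prod_set (by fun_prop),
    ← lintegral_const_mul' _ _ (by simp)]
  refine lintegral_mono_ae ?_
  filter_upwards [ae_restrict_of_ae hω, ae_restrict_of_ae h0] with x hx1 hx2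
  have hvol : volume (τ.openInterval n) ≤ ENNReal.ofReal τ.dt := by
    rw [openInterval, Real.volume_Ioo]
    exact ENNReal.ofReal_le_ofReal (τ.step_le_dt n)
  have h1 : ∀ t ∈ τ.openInterval n, ‖prim ω (t, x)‖ₑ ^ 2 ≤
      ENNReal.ofReal τ.dt * ∫⁻ s in τ.openInterval n, ‖ω (s, x)‖ₑ ^ 2 := by
    intro t ht
    rw [τ.prim_eq hx1 hx2 (τ.openInterval_subset_interval n ht)]
    calc _ ≤ (∫⁻ s in Ioc (τ.t n.castSucc) t, ‖ω (s, x)‖ₑ) ^ 2 := by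
          gcongr; exact enorm_integral_le_lintegral_enorm _
      _ ≤ (∫⁻ s in τ.openInterval n, ‖ω (s, x)‖ₑ) ^ 2 := by
          gcongr
          exact fun s hs => ⟨hs.1, hs.2.trans_lt ht.2⟩
      _ ≤ volume.restrict (τ.openInterval n) univ * ∫⁻ s in τ.openInterval n, ‖ω (s, x)‖ₑ ^ 2 :=
          sq_lintegral_le (by fun_prop)
      _ ≤ _ := by
          rw [Measure.restrict_apply_univ]
          gcongr
  calc ∫⁻ t in τ.openInterval n, ‖prim ω (t, x)‖ₑ ^ 2
      ≤ ∫⁻ t in τ.openInterval n, (ENNReal.ofReal τ.dt * ∫⁻ s in τ.openInterval n, ‖ω (s, x)‖ₑ ^ 2) :=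
        setLIntegral_mono (by fun_prop) h1
    _ = ENNReal.ofReal τ.dt * (∫⁻ s in τ.openInterval n, ‖ω (s, x)‖ₑ ^ 2) *
          volume (τ.openInterval n) := by rw [setLIntegral_const]
    _ ≤ ENNReal.ofReal τ.dt * (∫⁻ s in τ.openInterval n, ‖ω (s, x)‖ₑ ^ 2) * ENNReal.ofReal τ.dt := by
        gcongr
    _ = _ := by ring

end

/-! ### Integration in time preserves spatial regularity -/

theorem ae_space_time {p : STPt d → Prop} (h : ∀ᵐ z, p z) : ∀ᵐ x : Pt d, ∀ᵐ t : ℝ, p (t, x) :=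
  Measure.ae_ae_of_ae_prod
    ((Measure.measurePreserving_swap (μ := (volume : Measure (Pt d)))
      (ν := (volume : Measure ℝ))).quasiMeasurePreserving.ae h)

/-- Joint integrability in time and along the segment, for almost every x. It permits the exchange
of the integral in time with the line integral in space. -/
theorem ae_integrable_shift {E : Type*} [NormedAddCommGroup E] [MeasurableSpace E] [BorelSpace E]
    [SecondCountableTopology E] {g : STPt d → E} (hg : Measurable g)
    (hi : Integrable g) (y : Pt d) (r : ℝ) :
    ∀ᵐ x : Pt d, Integrable (fun p : ℝ × ℝ => g (p.1, x - p.2 • y))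
      (volume.prod (volume.restrict (Ioc 0 r))) := by
  have h1 : ∫⁻ x : Pt d, ∫⁻ p : ℝ × ℝ, ‖g (p.1, x - p.2 • y)‖ₑ
      ∂((volume : Measure ℝ).prod (volume.restrict (Ioc 0 r))) ≠ ∞ := by
    rw [lintegral_lintegral_swap (by fun_prop)]
    have h2 : ∀ p : ℝ × ℝ, ∫⁻ x : Pt d, ‖g (p.1, x - p.2 • y)‖ₑ = ∫⁻ x, ‖g (p.1, x)‖ₑ :=
      fun p => lintegral_sub_right_eq_self (fun x => ‖g (p.1, x)‖ₑ) _
    simp only [h2]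
    rw [lintegral_prod _ (by fun_prop)]
    simp only [lintegral_const, Measure.restrict_apply_univ, Real.volume_Ioc, sub_zero]
    rw [lintegral_mul_const _ (by fun_prop), ← lintegral_prod (fun z : STPt d => ‖g z‖ₑ) (by fun_prop)]
    exact ENNReal.mul_ne_top hi.2.ne ENNReal.ofReal_ne_top
  filter_upwards [ae_lt_top (by fun_prop) h1] with x hx
  exact ⟨(hg.comp (by fun_prop : Measurable fun p : ℝ × ℝ => ((p.1, x - p.2 • y) : STPt d))).aestronglyMeasurable, hx⟩

/-- By Fubini, integration over a set of times commutes with differences in space. The exceptional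
set of x is the same for all S, so S may later depend on the time of the point considered: a coarse
interval for means, (0,t] for primitives. -/
theorem H10.ae_integral {T : ℝ} {ω : Set (Pt d)} (hω : MeasurableSet ω)
    (hb : Bornology.IsBounded ω) {v : STPt d → ℝ} {g : STPt d → Pt d} (h : H10 T ω v g)
    (y : Pt d) {r : ℝ} (hr : 0 < r) :
    ∀ᵐ x : Pt d, ∀ S : Set ℝ, MeasurableSet S → S ⊆ Ioc 0 T →
      IntervalIntegrable (fun s => ⟪∫ t in S, g (t, x - s • y), y⟫) volume 0 r ∧
      (∫ t in S, v (t, x)) - ∫ t in S, v (t, x - r • y) =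
        ∫ s in (0:ℝ)..r, ⟪∫ t in S, g (t, x - s • y), y⟫ := by
  have hv := ae_integrable_time (h.integrable_val hω hb)
  have hv' := (measurePreserving_sub_right volume (r • y)).quasiMeasurePreserving.ae hv
  have h1 := h.lineAC y r hr
  rw [ae_restrict_iff' (isOpen_slab T).measurableSet] at h1
  filter_upwards [hv, hv', ae_space_time h1,
    ae_integrable_shift h.meas_grad (h.integrable_grad hω hb) y r] with x hx hx' hxl hxg S hS hST
  have hT : ∀ᵐ t : ℝ, t ≠ T := (finite_singleton T).countable.ae_notMem _
  have hxl' : ∀ᵐ t ∂volume.restrict S, v (t, x) - v (t, x - r • y) =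
      ∫ s in Ioc 0 r, ⟪g (t, x - s • y), y⟫ := by
    rw [ae_restrict_iff' hS]
    filter_upwards [hxl, hT] with t ht htT htS
    have := (ht ⟨⟨(hST htS).1, lt_of_le_of_ne (hST htS).2 htT⟩, mem_univ _⟩).2
    simp only [Prod.smul_mk, smul_zero, Prod.mk_sub_mk, sub_zero] at this
    rw [this, intervalIntegral.integral_of_le hr.le]
  have hxS : Integrable (fun p : ℝ × ℝ => g (p.1, x - p.2 • y))
      ((volume.restrict S).prod (volume.restrict (Ioc 0 r))) :=
    hxg.mono_measure (Measure.prod_mono Measure.restrict_le_self le_rfl)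
  have hxS' : Integrable (fun p : ℝ × ℝ => ⟪g (p.1, x - p.2 • y), y⟫)
      ((volume.restrict S).prod (volume.restrict (Ioc 0 r))) := hxS.inner_const y
  have h2 : ∀ᵐ s ∂volume.restrict (Ioc 0 r), (∫ t in S, ⟪g (t, x - s • y), y⟫) =
      ⟪∫ t in S, g (t, x - s • y), y⟫ := by
    filter_upwards [hxS.prod_left_ae] with s hs
    rw [real_inner_comm, ← integral_inner hs]
    simp only [real_inner_comm]
  constructor
  · rw [intervalIntegrable_iff_integrableOn_Ioc_of_le hr.le]
    exact hxS'.integral_prod_right.congr h2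
  · rw [← integral_sub hx.restrict hx'.restrict, integral_congr_ae hxl',
      integral_integral_swap hxS', intervalIntegral.integral_of_le hr.le, integral_congr_ae h2]

theorem indicator_cyl_of_notMem {E : Type*} [Zero E] {T : ℝ} {Ω : Set (Pt d)} {f : STPt d → E}
    (h : ∀ z : STPt d, z.2 ∉ Ω → f z = 0) {z : STPt d} (hz : z.1 ∈ Ioo 0 T) :
    (cyl T Ω).indicator f z = f z := by
  by_cases hz2 : z.2 ∈ Ω
  · exact indicator_of_mem (show z ∈ cyl T Ω from ⟨hz, hz2⟩) _
  · rw [h z hz2, indicator_of_notMem fun hz => hz2 hz.2]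

theorem TimeMesh.osc_of_notMem_space {E : Type*} [NormedAddCommGroup E] [NormedSpace ℝ E] {T : ℝ}
    (τ : TimeMesh T) {Ω : Set (Pt d)} {v : STPt d → E} (hv : ∀ z ∉ cyl T Ω, v z = 0) {z : STPt d}
    (hz : z.2 ∉ Ω) : τ.osc v z = 0 := by
  refine Finset.sum_eq_zero fun n _ => ?_
  rw [hv z fun h => hz h.2, TimeMesh.timeMean_of_notMem hv _ _ hz, sub_zero, indicator_zero]

theorem memLp_two_indicator {E : Type*} [NormedAddCommGroup E] [MeasurableSpace E] [BorelSpace E]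
    [SecondCountableTopology E] {Q : Set (STPt d)} (hQ : MeasurableSet Q) {f : STPt d → E}
    (hf : Measurable f) (h : ∫⁻ z in Q, ‖f z‖ₑ ^ 2 ≠ ∞) : MemLp (Q.indicator f) 2 volume := by
  rw [memLp_indicator_iff_restrict hQ]
  refine ⟨hf.aestronglyMeasurable, ?_⟩
  rw [eLpNorm_lt_top_iff_lintegral_rpow_enorm_lt_top (by norm_num) (by norm_num)]
  simpa using h.lt_top

theorem lintegral_sq_ne_top {E : Type*} [NormedAddCommGroup E] {μ : Measure (STPt d)}
    {f : STPt d → E} (hf : MemLp f 2 μ) : ∫⁻ z, ‖f z‖ₑ ^ 2 ∂μ ≠ ∞ := by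
  have := (eLpNorm_lt_top_iff_lintegral_rpow_enorm_lt_top (by norm_num) (by norm_num)).1 hf.2
  simpa using this.ne

/-- Outside the cylinder the oscillation can be nonzero only at the final time; the indicator
removes this null set and makes the extension by zero exact. -/
theorem H10.osc {T : ℝ} (τ : TimeMesh T) {Ω : Set (Pt d)} (hΩ : MeasurableSet Ω)
    (hb : Bornology.IsBounded Ω) {v : STPt d → ℝ} {g : STPt d → Pt d} (h : H10 T Ω v g) :
    H10 T Ω ((cyl T Ω).indicator (τ.osc v)) ((cyl T Ω).indicator (τ.osc g)) where
  meas_val := (τ.measurable_osc h.meas_val).indicator (measurableSet_cyl hΩ)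
  meas_grad := (τ.measurable_osc h.meas_grad).indicator (measurableSet_cyl hΩ)
  val_zero z hz := indicator_of_notMem hz _
  grad_zero z hz := indicator_of_notMem hz _
  memLp_val := memLp_two_indicator (measurableSet_cyl hΩ) (τ.measurable_osc h.meas_val)
    (ne_top_of_le_ne_top (ENNReal.mul_ne_top (by norm_num) (lintegral_sq_ne_top (h.memLp_val.restrict _)))
      (τ.lintegral_osc_le hΩ h.meas_val))
  memLp_grad := memLp_two_indicator (measurableSet_cyl hΩ) (τ.measurable_osc h.meas_grad)
    (ne_top_of_le_ne_top (ENNReal.mul_ne_top (by norm_num) (lintegral_sq_ne_top (h.memLp_grad.restrict _)))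
      (τ.lintegral_osc_le hΩ h.meas_grad))
  lineAC y r hr := by
    have hv0 : ∀ z : STPt d, z.2 ∉ Ω → τ.osc v z = 0 := fun z hz =>
      τ.osc_of_notMem_space h.val_zero hz
    have hg0 : ∀ z : STPt d, z.2 ∉ Ω → τ.osc g z = 0 := fun z hz =>
      τ.osc_of_notMem_space h.grad_zero hz
    have h1 := h.lineAC y r hr
    filter_upwards [h1, ae_restrict_of_ae (ae_of_ae_space (h.ae_integral hΩ hb y hr)),
      ae_restrict_mem (isOpen_slab T).measurableSet] with z hz1 hz2 hzm
    obtain ⟨n, hn⟩ := τ.exists_mem_interval ⟨hzm.1.1, hzm.1.2.le⟩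
    have hS : τ.interval n ⊆ Ioc 0 T := Ioc_subset_Ioc (τ.t_nonneg _) (τ.t_le _)
    obtain ⟨h3, h4⟩ := hz2 (τ.interval n) measurableSet_Ioc hS
    have e1 : ∀ s : ℝ, z - s • ((0, y) : STPt d) = (z.1, z.2 - s • y) := by
      intro s; ext <;> simp
    simp only [e1] at hz1 ⊢
    have e2 : ∀ x : Pt d, (cyl T Ω).indicator (τ.osc v) (z.1, x) =
        v (z.1, x) - timeMean (τ.t n.castSucc) (τ.t n.succ) v x := fun x => by
      rw [indicator_cyl_of_notMem hv0 (z := (z.1, x)) hzm.1, τ.osc_of_mem v (z := (z.1, x)) (n := n) hn]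
    have e3 : ∀ x : Pt d, (cyl T Ω).indicator (τ.osc g) (z.1, x) =
        g (z.1, x) - timeMean (τ.t n.castSucc) (τ.t n.succ) g x := fun x => by
      rw [indicator_cyl_of_notMem hg0 (z := (z.1, x)) hzm.1, τ.osc_of_mem g (z := (z.1, x)) (n := n) hn]
    have e4 : z = (z.1, z.2) := rfl
    rw [e4]
    simp only [TimeMesh.interval] at h3 h4
    simp only [e2, e3, inner_sub_left, timeMean, inner_smul_left, RCLike.conj_to_real]
    refine ⟨hz1.1.sub (h3.const_mul _), ?_⟩
    rw [intervalIntegral.integral_sub hz1.1 (h3.const_mul _), intervalIntegral.integral_const_mul]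
    rw [← h4, ← hz1.2, smul_eq_mul, smul_eq_mul]
    ring

theorem H10.prim {T : ℝ} {Ω : Set (Pt d)} (hΩ : MeasurableSet Ω)
    (hb : Bornology.IsBounded Ω) {v : STPt d → ℝ} {g : STPt d → Pt d} (h : H10 T Ω v g)
    (hv2 : ∫⁻ z in cyl T Ω, ‖prim v z‖ₑ ^ 2 ≠ ∞) (hg2 : ∫⁻ z in cyl T Ω, ‖prim g z‖ₑ ^ 2 ≠ ∞) :
    H10 T Ω ((cyl T Ω).indicator (prim v)) ((cyl T Ω).indicator (prim g)) where
  meas_val := (measurable_prim h.meas_val).indicator (measurableSet_cyl hΩ)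
  meas_grad := (measurable_prim h.meas_grad).indicator (measurableSet_cyl hΩ)
  val_zero z hz := indicator_of_notMem hz _
  grad_zero z hz := indicator_of_notMem hz _
  memLp_val := memLp_two_indicator (measurableSet_cyl hΩ) (measurable_prim h.meas_val) hv2
  memLp_grad := memLp_two_indicator (measurableSet_cyl hΩ) (measurable_prim h.meas_grad) hg2
  lineAC y r hr := by
    have hv0 : ∀ z : STPt d, z.2 ∉ Ω → SpaceTimeNLMC.prim v z = 0 := fun z hz => by
      simp [SpaceTimeNLMC.prim, fun s => h.val_zero (s, z.2) fun h => hz h.2]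
    have hg0 : ∀ z : STPt d, z.2 ∉ Ω → SpaceTimeNLMC.prim g z = 0 := fun z hz => by
      simp [SpaceTimeNLMC.prim, fun s => h.grad_zero (s, z.2) fun h => hz h.2]
    filter_upwards [ae_restrict_of_ae (ae_of_ae_space (h.ae_integral hΩ hb y hr)),
      ae_restrict_mem (isOpen_slab T).measurableSet] with z hz2 hzm
    have e1 : ∀ s : ℝ, z - s • ((0, y) : STPt d) = (z.1, z.2 - s • y) := by
      intro s; ext <;> simp
    simp only [e1]
    have e2 : ∀ x : Pt d, (cyl T Ω).indicator (SpaceTimeNLMC.prim v) (z.1, x) =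
        ∫ t in Ioc 0 z.1, v (t, x) := fun x => indicator_cyl_of_notMem hv0 (z := (z.1, x)) hzm.1
    have e3 : ∀ x : Pt d, (cyl T Ω).indicator (SpaceTimeNLMC.prim g) (z.1, x) =
        ∫ t in Ioc 0 z.1, g (t, x) := fun x => indicator_cyl_of_notMem hg0 (z := (z.1, x)) hzm.1
    have e4 : z = (z.1, z.2) := rfl
    rw [e4]
    simp only [e2, e3]
    exact hz2 _ measurableSet_Ioc (Ioc_subset_Ioc_right hzm.1.2.le)

theorem integral_prod_set {I : Set ℝ} {K : Set (Pt d)} {f : STPt d → ℝ}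
    (hf : IntegrableOn f (I ×ˢ K)) : ∫ z in I ×ˢ K, f z = ∫ x in K, ∫ t in I, f (t, x) := by
  rw [IntegrableOn, Measure.volume_eq_prod, ← Measure.prod_restrict] at hf
  rw [Measure.volume_eq_prod, ← Measure.prod_restrict, integral_prod_symm _ hf]

theorem memLp_two_mul {α : Type*} [MeasurableSpace α] {μ : Measure α} {f g : α → ℝ} (hf : MemLp f 2 μ)
    (hg : MemLp g 2 μ) : Integrable (fun z => f z * g z) μ :=
  hf.integrable_mul hg

/-! ### Integration of the oscillation in time -/

theorem TimeMesh.integral_indicator_osc_eq_zero {E : Type*} [NormedAddCommGroup E]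
    [NormedSpace ℝ E] [CompleteSpace E] {T : ℝ} (τ : TimeMesh T) {Ω : Set (Pt d)} {v : STPt d → E}
    (hv0 : ∀ z ∉ cyl T Ω, v z = 0) {x : Pt d} (hv : Integrable fun s => v (s, x)) (n : Fin τ.N) :
    ∫ s in τ.interval n, (cyl T Ω).indicator (τ.osc v) (s, x) = 0 := by
  rw [← τ.integral_osc_eq_zero hv n]
  have hT : ∀ᵐ t : ℝ, t ≠ T := (finite_singleton T).countable.ae_notMem _
  have hm : MeasurableSet (τ.interval n) := measurableSet_Ioc
  refine setIntegral_congr_ae hm ?_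
  filter_upwards [hT] with t ht htn
  refine indicator_cyl_of_notMem (z := (t, x)) (fun z hz => τ.osc_of_notMem_space hv0 hz) ?_
  exact ⟨(τ.t_nonneg _).trans_lt htn.1, lt_of_le_of_ne (htn.2.trans (τ.t_le _)) ht⟩

/-- The function with time derivative `osc v`. -/
def TimeMesh.oscPrim {T : ℝ} (τ : TimeMesh T) (Ω : Set (Pt d)) (v : STFun d) : STFun d where
  val := (cyl T Ω).indicator (prim ((cyl T Ω).indicator (τ.osc v.val)))
  grad := (cyl T Ω).indicator (prim ((cyl T Ω).indicator (τ.osc v.grad)))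
  dt := (cyl T Ω).indicator (τ.osc v.val)

section
variable {T : ℝ} (τ : TimeMesh T) {Ω : Set (Pt d)}

theorem lintegral_indicator_sq {E : Type*} [NormedAddCommGroup E] (hΩ : MeasurableSet Ω)
    (f : STPt d → E) :
    ∫⁻ z in cyl T Ω, ‖(cyl T Ω).indicator f z‖ₑ ^ 2 = ∫⁻ z in cyl T Ω, ‖f z‖ₑ ^ 2 :=
  setLIntegral_congr_fun (measurableSet_cyl hΩ) fun z hz => by simp only [indicator_of_mem hz]

theorem TimeMesh.lintegral_prim_osc_le {E : Type*} [NormedAddCommGroup E]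
    [NormedSpace ℝ E] [CompleteSpace E] [MeasurableSpace E] [BorelSpace E] [SecondCountableTopology E]
    (hΩ : MeasurableSet Ω) (hb : Bornology.IsBounded Ω) {v : STPt d → E}
    (hv0 : ∀ z ∉ cyl T Ω, v z = 0) (hv : Measurable v) (hv2 : MemLp v 2 volume) :
    ∫⁻ z in cyl T Ω, ‖prim ((cyl T Ω).indicator (τ.osc v)) z‖ₑ ^ 2 ≤
      ENNReal.ofReal τ.dt ^ 2 * ∫⁻ z in cyl T Ω, ‖τ.osc v z‖ₑ ^ 2 := by
  have h1 := τ.lintegral_osc_le hΩ hv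
  have hi := integrable_of_memLp_two (measurableSet_cyl hΩ) (volume_cyl_lt_top hb) hv0 hv2
  have hm := (τ.measurable_osc hv).indicator (measurableSet_cyl (T := T) hΩ)
  have h2 : MemLp ((cyl T Ω).indicator (τ.osc v)) 2 volume :=
    memLp_two_indicator (measurableSet_cyl hΩ) (τ.measurable_osc hv)
      (ne_top_of_le_ne_top (ENNReal.mul_ne_top (by norm_num)
        (lintegral_sq_ne_top (hv2.restrict _))) h1)
  rw [← lintegral_indicator_sq hΩ (τ.osc v)]
  refine τ.lintegral_prim_le hΩ hm ?_ ?_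
  · exact (integrable_of_memLp_two (measurableSet_cyl hΩ) (volume_cyl_lt_top hb)
      (fun z hz => indicator_of_notMem hz _) h2).prod_left_ae
  · filter_upwards [hi.prod_left_ae] with x hx n
    exact τ.integral_indicator_osc_eq_zero hv0 hx n

theorem H11.oscPrim (hΩ : MeasurableSet Ω) (hb : Bornology.IsBounded Ω) {v : STFun d}
    (h : H11 T Ω v) : H11 T Ω (τ.oscPrim Ω v) := by
  have h1 := h.toH10.osc τ hΩ hb
  have hp1 := τ.lintegral_prim_osc_le hΩ hb h.val_zero h.meas_val h.memLp_val
  have hp2 := τ.lintegral_prim_osc_le hΩ hb h.grad_zero h.meas_grad h.memLp_grad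
  have h2 := h1.prim hΩ hb
    (ne_top_of_le_ne_top (ENNReal.mul_ne_top (by simp)
      (by rw [← lintegral_indicator_sq hΩ]; exact lintegral_sq_ne_top (h1.memLp_val.restrict _))) hp1)
    (ne_top_of_le_ne_top (ENNReal.mul_ne_top (by simp)
      (by rw [← lintegral_indicator_sq hΩ]; exact lintegral_sq_ne_top (h1.memLp_grad.restrict _))) hp2)
  refine ⟨h2, h1.meas_val, h1.val_zero, h1.memLp_val, ?_⟩
  filter_upwards [ae_restrict_mem (measurableSet_cyl hΩ)] with z hz
  rw [intervalIntegral.integral_of_le hz.1.1.le]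
  exact indicator_of_mem hz _

theorem H11.ae_ftc (hΩ : MeasurableSet Ω) {v : STFun d} (h : H11 T Ω v) :
    ∀ᵐ x : Pt d, ∀ᵐ t : ℝ, t ∈ Ioo 0 T → v.val (t, x) = ∫ s in (0:ℝ)..t, v.dt (s, x) := by
  have h1 := h.ftc
  rw [ae_restrict_iff' (measurableSet_cyl hΩ)] at h1
  filter_upwards [ae_space_time h1] with x hx
  filter_upwards [hx] with t ht htT
  by_cases hxΩ : x ∈ Ω
  · exact ht ⟨htT, hxΩ⟩
  · simp [h.val_zero (t, x) fun h => hxΩ h.2, fun s => h.dt_zero (s, x) fun h => hxΩ h.2]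

/-- Integration by parts in time. The boundary term at t = T is written with integrals of the
derivatives instead of traces; at t = 0 there is none. -/
theorem H11.integral_mul_dt (hT : 0 < T) (hΩ : MeasurableSet Ω) (hb : Bornology.IsBounded Ω) {v w : STFun d}
    (hv : H11 T Ω v) (hw : H11 T Ω w) :
    (∫ z in cyl T Ω, v.dt z * w.val z) + ∫ z in cyl T Ω, v.val z * w.dt z =
      ∫ x in Ω, (∫ t in Ioo 0 T, v.dt (t, x)) * ∫ t in Ioo 0 T, w.dt (t, x) := by
  have i1 := (memLp_two_mul hv.memLp_dt hw.memLp_val).restrict (s := cyl T Ω)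
  have i2 := (memLp_two_mul hv.memLp_val hw.memLp_dt).restrict (s := cyl T Ω)
  have e0 : ∫ z in cyl T Ω, (v.dt z * w.val z + v.val z * w.dt z) = _ :=
    integral_prod_set (i1.add i2)
  rw [← integral_add i1 i2, e0]
  refine integral_congr_ae (ae_restrict_of_ae ?_)
  filter_upwards [hv.ae_ftc hΩ, hw.ae_ftc hΩ, ae_integrable_time (hv.integrable_dt hΩ hb),
    ae_integrable_time (hw.integrable_dt hΩ hb)] with x h1 h2 h3 h4
  have key := (mul_sub_eq_integral (a := 0) (b := 0) (r := T) (h := fun s => v.dt (s, x))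
    (k := fun s => w.dt (s, x)) h3.intervalIntegrable h4.intervalIntegrable).2
  rw [intervalIntegral.integral_of_le hT.le, intervalIntegral.integral_of_le hT.le,
    intervalIntegral.integral_of_le hT.le] at key
  simp only [integral_Ioc_eq_integral_Ioo] at key
  have e : ∫ t in Ioo 0 T, (v.dt (t, x) * w.val (t, x) + v.val (t, x) * w.dt (t, x)) =
      - ∫ s in Ioo 0 T, (v.dt (s, x) * (0 - ∫ s in (0:ℝ)..s, w.dt (s, x)) +
        (0 - ∫ s in (0:ℝ)..s, v.dt (s, x)) * w.dt (s, x)) := by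
    rw [← integral_neg]
    refine setIntegral_congr_ae measurableSet_Ioo ?_
    filter_upwards [h1, h2] with t ht1 ht2 ht
    rw [ht1 ht, ht2 ht]; ring
  rw [e, ← key]; ring

theorem H11.integral_dt_mul_nonneg (hT : 0 < T) (hΩ : MeasurableSet Ω) (hb : Bornology.IsBounded Ω)
    {v : STFun d} (hv : H11 T Ω v) : 0 ≤ ∫ z in cyl T Ω, v.dt z * v.val z := by
  have h1 := hv.integral_mul_dt hT hΩ hb hv
  have h2 : 0 ≤ ∫ x in Ω, (∫ t in Ioo 0 T, v.dt (t, x)) * ∫ t in Ioo 0 T, v.dt (t, x) :=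
    integral_nonneg fun x => mul_self_nonneg _
  have h3 : ∫ z in cyl T Ω, v.val z * v.dt z = ∫ z in cyl T Ω, v.dt z * v.val z := by
    simp only [mul_comm]
  linarith

/-- The integral of the oscillation over all of (0,T) is zero, so integration by parts has no
boundary term and leaves -∫ v osc v. As v - osc v is constant in time on each coarse interval and
osc v has mean zero there, this equals -∫ (osc v)². It supplies control of the oscillation that the
energy lacks. -/
theorem H11.integral_dt_mul_oscPrim (hT : 0 < T) (hΩ : MeasurableSet Ω)
    (hb : Bornology.IsBounded Ω) {v : STFun d} (hv : H11 T Ω v) :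
    ∫ z in cyl T Ω, v.dt z * (τ.oscPrim Ω v).val z = -∫ z in cyl T Ω, τ.osc v.val z ^ 2 := by
  have hW := hv.oscPrim τ hΩ hb
  have h1 := hv.integral_mul_dt hT hΩ hb hW
  have hWi := ae_integrable_time (hW.integrable_dt hΩ hb)
  have hvi := ae_integrable_time (hv.integrable_val hΩ hb)
  have h2 : ∫ x in Ω, (∫ t in Ioo 0 T, v.dt (t, x)) *
      ∫ t in Ioo 0 T, (τ.oscPrim Ω v).dt (t, x) = 0 := by
    refine integral_eq_zero_of_ae (ae_restrict_of_ae ?_)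
    filter_upwards [hWi, hvi] with x h3 h4
    have h5 := τ.prim_eq_zero h3 (fun n => τ.integral_indicator_osc_eq_zero hv.val_zero h4 n)
      (Fin.last _)
    rw [τ.t_last, prim, integral_Ioc_eq_integral_Ioo] at h5
    simp only [h5, mul_zero, Pi.zero_apply]
  set ω := (τ.oscPrim Ω v).dt with hω
  have i1 : Integrable fun z => (v.val z - ω z) * ω z :=
    memLp_two_mul (hv.memLp_val.sub hW.memLp_dt) hW.memLp_dt
  have h3 : ∫ z in cyl T Ω, (v.val z - ω z) * ω z = 0 := by
    rw [τ.integral_cyl hΩ i1.restrict]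
    refine Finset.sum_eq_zero fun n _ => ?_
    rw [integral_prod_set (f := fun z => (v.val z - ω z) * ω z) i1.restrict]
    refine integral_eq_zero_of_ae (ae_restrict_of_ae ?_)
    filter_upwards [hvi] with x hx
    have hm : MeasurableSet (τ.interval n) := measurableSet_Ioc
    have h4 := τ.integral_indicator_osc_eq_zero hv.val_zero hx n
    rw [setIntegral_congr_fun (g := fun t => timeMean (τ.t n.castSucc) (τ.t n.succ) v.val x *
      ω (t, x)) hm, integral_const_mul, Pi.zero_apply]
    · exact mul_eq_zero_of_right _ h4
    · intro t ht
      simp only [hω, TimeMesh.oscPrim]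
      by_cases hc : (t, x) ∈ cyl T Ω
      · rw [indicator_of_mem hc, τ.osc_of_mem v.val (z := (t, x)) ht]; ring
      · rw [indicator_of_notMem hc]; ring
  have h4 : ∫ z in cyl T Ω, v.val z * ω z = ∫ z in cyl T Ω, τ.osc v.val z ^ 2 := by
    rw [← sub_eq_zero, ← h3]
    have h5 : ∫ z in cyl T Ω, τ.osc v.val z ^ 2 = ∫ z in cyl T Ω, ω z * ω z := by
      refine setIntegral_congr_fun (measurableSet_cyl hΩ) fun z hz => ?_
      simp only [hω, TimeMesh.oscPrim, indicator_of_mem hz]; ring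
    rw [h5, ← integral_sub (memLp_two_mul hv.memLp_val hW.memLp_dt).restrict
      (memLp_two_mul hW.memLp_dt hW.memLp_dt).restrict]
    simp only [sub_mul, hω]
  linarith

/-- Any two values in one coarse interval differ by at most the total variation there; averaging
over one of the two times gives the oscillation. -/
theorem H11.ae_enorm_osc_le (hΩ : MeasurableSet Ω) (hb : Bornology.IsBounded Ω) {v : STFun d}
    (hv : H11 T Ω v) : ∀ᵐ x : Pt d, ∀ n, ∀ᵐ t : ℝ, t ∈ τ.openInterval n →
      ‖τ.osc v.val (t, x)‖ₑ ≤ ∫⁻ s in τ.openInterval n, ‖v.dt (s, x)‖ₑ := by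
  filter_upwards [hv.ae_ftc hΩ, ae_integrable_time (hv.integrable_dt hΩ hb),
    ae_integrable_time (hv.integrable_val hΩ hb)] with x h1 h2 h3 n
  filter_upwards [h1] with t ht htn
  have hn := sub_pos.1 (τ.step_pos n)
  set a := τ.t n.castSucc
  set b := τ.t n.succ
  have hba : 0 < b - a := sub_pos.2 hn
  set I := Ioo a b with hI
  have hbound : ∀ᵐ s ∂volume.restrict I,
      ‖v.val (t, x) - v.val (s, x)‖ ≤ ∫ r in I, ‖v.dt (r, x)‖ := by
    rw [ae_restrict_iff' measurableSet_Ioo]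
    filter_upwards [h1] with s hs hsI
    rw [ht (τ.openInterval_subset n htn), hs (τ.openInterval_subset n hsI),
      intervalIntegral.integral_interval_sub_left h2.intervalIntegrable h2.intervalIntegrable]
    refine intervalIntegral.norm_integral_le_integral_norm_uIoc.trans ?_
    refine setIntegral_mono_set h2.norm.integrableOn (Filter.Eventually.of_forall fun _ => norm_nonneg _)
      (Filter.Eventually.of_forall fun r hr => ?_)
    rcases le_total s t with h | h
    · rw [uIoc_of_le h] at hr
      exact ⟨hsI.1.trans hr.1, hr.2.trans_lt htn.2⟩
    · rw [uIoc_of_ge h] at hr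
      exact ⟨htn.1.trans hr.1, hr.2.trans_lt hsI.2⟩
  have hconst : Integrable (fun _ : ℝ => v.val (t, x)) (volume.restrict I) :=
    integrableOn_const (by simp [hI])
  have hosc : τ.osc v.val (t, x) = (b - a)⁻¹ * ∫ s in I, (v.val (t, x) - v.val (s, x)) := by
    rw [τ.osc_of_mem v.val (z := (t, x)) (τ.openInterval_subset_interval n htn), timeMean,
      integral_Ioc_eq_integral_Ioo, integral_sub hconst h3.restrict,
      setIntegral_const, measureReal_def, Real.volume_Ioo, ENNReal.toReal_ofReal hba.le, smul_eq_mul,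
      smul_eq_mul, mul_sub, inv_mul_cancel_left₀ hba.ne']
  have hle : ‖τ.osc v.val (t, x)‖ ≤ ∫ r in I, ‖v.dt (r, x)‖ := by
    rw [hosc, norm_mul, norm_inv, Real.norm_of_nonneg hba.le, inv_mul_le_iff₀ hba, mul_comm]
    have := norm_setIntegral_le_of_norm_le_const_ae (s := I) (μ := volume) (by simp [hI]) hbound
    rwa [measureReal_def, Real.volume_Ioo, ENNReal.toReal_ofReal hba.le] at this
  rw [← ofReal_integral_norm_eq_lintegral_enorm h2.restrict, ← ofReal_norm]
  exact ENNReal.ofReal_le_ofReal hle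

/-- Here comparability in time is used: the weight stands at time t and the derivative at time s,
and the former is moved to s at the cost of M. One factor Δt comes from Cauchy-Schwarz and one from
the integral in t. -/
theorem H11.lintegral_inv_mul_osc_le (hΩ : MeasurableSet Ω) (hb : Bornology.IsBounded Ω)
    {v : STFun d} (hv : H11 T Ω v) {ρ : STPt d → ℝ} (hρ : Measurable ρ) {M : ℝ} (hM : 0 < M)
    (hc : τ.Comparable Ω ρ M) :
    ∫⁻ z in cyl T Ω, (ENNReal.ofReal (ρ z))⁻¹ * ‖τ.osc v.val z‖ₑ ^ 2 ≤
      ENNReal.ofReal M * ENNReal.ofReal τ.dt ^ 2 *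
        ∫⁻ z in cyl T Ω, (ENNReal.ofReal (ρ z))⁻¹ * ‖v.dt z‖ₑ ^ 2 := by
  rw [τ.lintegral_cyl hΩ, τ.lintegral_cyl hΩ, Finset.mul_sum]
  refine Finset.sum_le_sum fun n _ => ?_
  have ho := τ.measurable_osc hv.meas_val
  have hdt := hv.meas_dt
  rw [lintegral_prod_set (by fun_prop), lintegral_prod_set (by fun_prop),
    ← lintegral_const_mul' _ _ (ENNReal.mul_ne_top ENNReal.ofReal_ne_top (by simp))]
  refine lintegral_mono_ae ?_
  filter_upwards [ae_restrict_of_ae (hv.ae_enorm_osc_le τ hΩ hb), hc n] with x hx1 hx2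
  set I := τ.openInterval n
  have hIm : MeasurableSet I := measurableSet_Ioo
  have hvol : volume I ≤ ENNReal.ofReal τ.dt := by
    simp only [I]
    rw [TimeMesh.openInterval, Real.volume_Ioo]
    exact ENNReal.ofReal_le_ofReal (τ.step_le_dt n)
  have hx3 : ∀ᵐ t ∂volume.restrict I, ∀ᵐ s ∂volume.restrict I, ρ (t, x) ≤ M * ρ (s, x) := by
    filter_upwards [ae_restrict_of_ae_restrict_of_subset (τ.openInterval_subset_interval n) hx2]
      with t ht
    exact ae_restrict_of_ae_restrict_of_subset (τ.openInterval_subset_interval n) ht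
  have h1 : ∀ᵐ t ∂volume.restrict I, (ENNReal.ofReal (ρ (t, x)))⁻¹ * ‖τ.osc v.val (t, x)‖ₑ ^ 2 ≤
      ∫⁻ s in I, (ENNReal.ofReal (ρ (t, x)))⁻¹ * (volume I * ‖v.dt (s, x)‖ₑ ^ 2) := by
    filter_upwards [(ae_restrict_iff' hIm).2 (hx1 n)] with t ht
    rw [lintegral_const_mul _ (by fun_prop), lintegral_const_mul _ (by fun_prop)]
    gcongr
    calc _ ≤ (∫⁻ s in I, ‖v.dt (s, x)‖ₑ) ^ 2 := by gcongr
      _ ≤ _ := by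
        have := sq_lintegral_le (μ := volume.restrict I) (f := fun s => ‖v.dt (s, x)‖ₑ) (by fun_prop)
        rwa [Measure.restrict_apply_univ] at this
  calc ∫⁻ t in I, (ENNReal.ofReal (ρ (t, x)))⁻¹ * ‖τ.osc v.val (t, x)‖ₑ ^ 2
      ≤ ∫⁻ t in I, ∫⁻ s in I, (ENNReal.ofReal (ρ (t, x)))⁻¹ * (volume I * ‖v.dt (s, x)‖ₑ ^ 2) :=
        lintegral_mono_ae h1
    _ = ∫⁻ s in I, ∫⁻ t in I, (ENNReal.ofReal (ρ (t, x)))⁻¹ * (volume I * ‖v.dt (s, x)‖ₑ ^ 2) :=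
        -- The swap puts the variable s outside, matching the order of the quantifiers in
        -- `Comparable`.
        lintegral_lintegral_swap (by fun_prop)
    _ ≤ ∫⁻ s in I, ENNReal.ofReal M * ENNReal.ofReal τ.dt ^ 2 *
          ((ENNReal.ofReal (ρ (s, x)))⁻¹ * ‖v.dt (s, x)‖ₑ ^ 2) := by
        refine lintegral_mono_ae ?_
        filter_upwards [hx3] with s hs
        calc ∫⁻ t in I, (ENNReal.ofReal (ρ (t, x)))⁻¹ * (volume I * ‖v.dt (s, x)‖ₑ ^ 2)
            ≤ ∫⁻ t in I, (ENNReal.ofReal M * (ENNReal.ofReal (ρ (s, x)))⁻¹) *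
                (volume I * ‖v.dt (s, x)‖ₑ ^ 2) := by
              refine lintegral_mono_ae ?_
              filter_upwards [hs] with t ht
              gcongr
              have h0 : ENNReal.ofReal M ≠ 0 := by simpa using hM
              calc (ENNReal.ofReal (ρ (t, x)))⁻¹
                  = ENNReal.ofReal M * (ENNReal.ofReal M * ENNReal.ofReal (ρ (t, x)))⁻¹ := by
                    rw [ENNReal.mul_inv (Or.inl h0) (Or.inl ENNReal.ofReal_ne_top), ← mul_assoc,
                      ENNReal.mul_inv_cancel h0 ENNReal.ofReal_ne_top, one_mul]
                _ ≤ _ := by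
                    gcongr
                    rw [← ENNReal.ofReal_mul hM.le]
                    exact ENNReal.ofReal_le_ofReal ht
          _ = (ENNReal.ofReal M * (ENNReal.ofReal (ρ (s, x)))⁻¹) *
                (volume I * ‖v.dt (s, x)‖ₑ ^ 2) * volume I := by rw [setLIntegral_const]
          _ ≤ (ENNReal.ofReal M * (ENNReal.ofReal (ρ (s, x)))⁻¹) *
                (ENNReal.ofReal τ.dt * ‖v.dt (s, x)‖ₑ ^ 2) * ENNReal.ofReal τ.dt := by gcongr
          _ = _ := by ring
    _ = _ := lintegral_const_mul' _ _ (ENNReal.mul_ne_top ENNReal.ofReal_ne_top (by simp))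

end

/-! ### Square integrable functions and weights -/

section
variable {α : Type*} [MeasurableSpace α] {μ : Measure α}
  {E E' : Type*} [NormedAddCommGroup E] [NormedAddCommGroup E']

/-- The `L²` norm as a real number. -/
def l2 (μ : Measure α) (f : α → E) : ℝ := √(∫⁻ z, ‖f z‖ₑ ^ 2 ∂μ).toReal

theorem l2_nonneg (f : α → E) : 0 ≤ l2 μ f := Real.sqrt_nonneg _

theorem memLp_two_iff {f : α → E} (hf : AEStronglyMeasurable f μ) :
    MemLp f 2 μ ↔ ∫⁻ z, ‖f z‖ₑ ^ 2 ∂μ ≠ ∞ := by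
  rw [MemLp, eLpNorm_lt_top_iff_lintegral_rpow_enorm_lt_top (by norm_num) (by norm_num)]
  simp [hf, lt_top_iff_ne_top]

theorem l2_sq {f : α → E} (hf : MemLp f 2 μ) :
    ENNReal.ofReal (l2 μ f ^ 2) = ∫⁻ z, ‖f z‖ₑ ^ 2 ∂μ := by
  rw [l2, Real.sq_sqrt ENNReal.toReal_nonneg, ENNReal.ofReal_toReal ((memLp_two_iff hf.1).1 hf)]

theorem l2_le {f : α → E} {c : ℝ} (hc : 0 ≤ c)
    (h : ∫⁻ z, ‖f z‖ₑ ^ 2 ∂μ ≤ ENNReal.ofReal (c ^ 2)) : l2 μ f ≤ c := by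
  rw [l2, Real.sqrt_le_left hc]
  exact ENNReal.toReal_le_of_le_ofReal (sq_nonneg c) h

theorem l2_le_mul {f : α → E} {g : α → E'} {c : ℝ} (hc : 0 ≤ c) (hg : MemLp g 2 μ)
    (h : ∫⁻ z, ‖f z‖ₑ ^ 2 ∂μ ≤ ENNReal.ofReal (c ^ 2) * ∫⁻ z, ‖g z‖ₑ ^ 2 ∂μ) :
    l2 μ f ≤ c * l2 μ g := by
  refine l2_le (mul_nonneg hc (l2_nonneg g)) ?_
  rwa [mul_pow, ENNReal.ofReal_mul (sq_nonneg c), l2_sq hg]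

theorem enorm_integral_sq_le {F : α → ℝ} {f : α → E} {g : α → E'} (hf : AEStronglyMeasurable f μ)
    (hg : AEStronglyMeasurable g μ) (h : ∀ᵐ z ∂μ, ‖F z‖ₑ ≤ ‖f z‖ₑ * ‖g z‖ₑ) :
    ‖∫ z, F z ∂μ‖ₑ ^ 2 ≤ (∫⁻ z, ‖f z‖ₑ ^ 2 ∂μ) * ∫⁻ z, ‖g z‖ₑ ^ 2 ∂μ :=
  calc ‖∫ z, F z ∂μ‖ₑ ^ 2 ≤ (∫⁻ z, ‖f z‖ₑ * ‖g z‖ₑ ∂μ) ^ 2 := by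
        gcongr
        exact (enorm_integral_le_lintegral_enorm _).trans (lintegral_mono_ae h)
    _ ≤ _ := sq_lintegral_mul_le hf.enorm hg.enorm

theorem abs_le_of_enorm_sq_le {a c : ℝ} (hc : 0 ≤ c) (h : ‖a‖ₑ ^ 2 ≤ ENNReal.ofReal (c ^ 2)) :
    |a| ≤ c := by
  rw [← ofReal_norm_sq] at h
  exact abs_le_of_sq_le_sq (by simpa using (ENNReal.ofReal_le_ofReal_iff (sq_nonneg c)).1 h) hc

theorem abs_integral_le_l2_mul {F : α → ℝ} {f : α → E} {g : α → E'} (hf : MemLp f 2 μ)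
    (hg : MemLp g 2 μ) (h : ∀ᵐ z ∂μ, ‖F z‖ₑ ≤ ‖f z‖ₑ * ‖g z‖ₑ) :
    |∫ z, F z ∂μ| ≤ l2 μ f * l2 μ g := by
  refine abs_le_of_enorm_sq_le (mul_nonneg (l2_nonneg f) (l2_nonneg g)) ?_
  rw [mul_pow, ENNReal.ofReal_mul (sq_nonneg _), l2_sq hf, l2_sq hg]
  exact enorm_integral_sq_le hf.1 hg.1 h

/-- Cauchy–Schwarz for finite sums. -/
theorem sum_sq_le_of_sq_le {ι : Type*} [Fintype ι] {a x y : ι → ℝ≥0∞}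
    (h : ∀ r, a r ^ 2 ≤ x r * y r) : (∑ r, a r) ^ 2 ≤ (∑ r, x r) * ∑ r, y r := by
  have hs : ∀ b : ℝ≥0∞, (b ^ (1 / 2 : ℝ)) ^ 2 = b := fun b => by
    rw [← ENNReal.rpow_natCast, ← ENNReal.rpow_mul]; norm_num
  have h1 : ∀ r, a r ≤ x r ^ (1 / 2 : ℝ) * y r ^ (1 / 2 : ℝ) := fun r => by
    have := h r
    rw [← hs (x r), ← hs (y r), ← mul_pow] at this
    exact (ENNReal.pow_right_strictMono two_ne_zero).le_iff_le.1 this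
  let _ : MeasurableSpace ι := ⊤
  have h2 := sq_lintegral_mul_le (μ := (Measure.count : Measure ι)) (f := fun r => x r ^ (1 / 2 : ℝ))
    (g := fun r => y r ^ (1 / 2 : ℝ)) Measurable.of_discrete.aemeasurable
    Measurable.of_discrete.aemeasurable
  simp only [hs, lintegral_count, tsum_fintype] at h2
  refine le_trans ?_ h2
  gcongr with r
  exact h1 r

/-- `ρ^{-1/2} g`. -/
def scaled (ρ g : α → ℝ) (z : α) : ℝ := (√(ρ z))⁻¹ * g z

variable {ρ g : α → ℝ}

/-- In [0,∞] the inverse of zero is ∞, whereas in ℝ it is zero. A finite weighted norm forces g to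
vanish where the weight does, which reconciles the two conventions. -/
theorem ae_eq_zero_of_weight_eq_zero (hρ : AEMeasurable ρ μ) (hg : AEMeasurable g μ)
    (h : ∫⁻ z, (ENNReal.ofReal (ρ z))⁻¹ * ENNReal.ofReal (g z ^ 2) ∂μ ≠ ∞) :
    ∀ᵐ z ∂μ, ρ z ≤ 0 → g z = 0 := by
  filter_upwards [ae_lt_top' (by fun_prop) h] with z hz h0
  by_contra hne
  rw [ENNReal.ofReal_eq_zero.2 h0, ENNReal.inv_zero, ENNReal.top_mul] at hz
  · exact lt_irrefl _ hz
  · simpa using hne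

theorem ae_enorm_scaled_sq (hρ : AEMeasurable ρ μ) (hg : AEMeasurable g μ)
    (h : ∫⁻ z, (ENNReal.ofReal (ρ z))⁻¹ * ENNReal.ofReal (g z ^ 2) ∂μ ≠ ∞) :
    ∀ᵐ z ∂μ, ‖scaled ρ g z‖ₑ ^ 2 = (ENNReal.ofReal (ρ z))⁻¹ * ENNReal.ofReal (g z ^ 2) := by
  filter_upwards [ae_eq_zero_of_weight_eq_zero hρ hg h] with z hz
  rcases le_or_gt (ρ z) 0 with h0 | h0
  · simp [scaled, hz h0]
  · rw [← ofReal_norm_sq, scaled, norm_mul, mul_pow, norm_inv, inv_pow, Real.norm_eq_abs, sq_abs,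
      Real.sq_sqrt h0.le, ENNReal.ofReal_mul (by positivity), ENNReal.ofReal_inv_of_pos h0,
      Real.norm_eq_abs, sq_abs]

theorem lintegral_scaled (hρ : AEMeasurable ρ μ) (hg : AEMeasurable g μ)
    (h : ∫⁻ z, (ENNReal.ofReal (ρ z))⁻¹ * ENNReal.ofReal (g z ^ 2) ∂μ ≠ ∞) :
    ∫⁻ z, ‖scaled ρ g z‖ₑ ^ 2 ∂μ = ∫⁻ z, (ENNReal.ofReal (ρ z))⁻¹ * ENNReal.ofReal (g z ^ 2) ∂μ :=
  lintegral_congr_ae (ae_enorm_scaled_sq hρ hg h)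

theorem memLp_scaled (hρ : AEMeasurable ρ μ) (hg : AEMeasurable g μ)
    (h : ∫⁻ z, (ENNReal.ofReal (ρ z))⁻¹ * ENNReal.ofReal (g z ^ 2) ∂μ ≠ ∞) :
    MemLp (scaled ρ g) 2 μ := by
  have hm : AEMeasurable (scaled ρ g) μ := by unfold scaled; fun_prop
  rw [memLp_two_iff hm.aestronglyMeasurable, lintegral_scaled hρ hg h]
  exact h

theorem ae_sqrt_mul_scaled (hρ : AEMeasurable ρ μ) (hg : AEMeasurable g μ)
    (h : ∫⁻ z, (ENNReal.ofReal (ρ z))⁻¹ * ENNReal.ofReal (g z ^ 2) ∂μ ≠ ∞) :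
    ∀ᵐ z ∂μ, √(ρ z) * scaled ρ g z = g z := by
  filter_upwards [ae_eq_zero_of_weight_eq_zero hρ hg h] with z hz
  rcases le_or_gt (ρ z) 0 with h0 | h0
  · simp [scaled, hz h0]
  · have : √(ρ z) ≠ 0 := (Real.sqrt_pos.2 h0).ne'
    rw [scaled, mul_inv_cancel_left₀ this]

end

section
variable {α : Type*} {E : Type*} [NormedAddCommGroup E] {ρ g : α → ℝ}

theorem scaled_mul_scaled {g' : α → ℝ} {z : α} (h : 0 ≤ ρ z) :
    scaled ρ g z * scaled ρ g' z = (ρ z)⁻¹ * g z * g' z := by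
  have h1 : (√(ρ z))⁻¹ * (√(ρ z))⁻¹ = (ρ z)⁻¹ := by rw [← mul_inv, Real.mul_self_sqrt h]
  rw [scaled, scaled, ← h1]; ring

theorem enorm_sqrt_mul_sq {α : Type*} {ρ : α → ℝ} {z : α} (h : 0 ≤ ρ z) (a : ℝ) :
    ‖√(ρ z) * a‖ₑ ^ 2 = ENNReal.ofReal (ρ z) * ‖a‖ₑ ^ 2 := by
  rw [← ofReal_norm_sq, norm_mul, mul_pow, Real.norm_of_nonneg (Real.sqrt_nonneg _), Real.sq_sqrt h,
    ENNReal.ofReal_mul h, ofReal_norm_sq]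

theorem enorm_sqrt_smul_sq [NormedSpace ℝ E] {z : α} (h : 0 ≤ ρ z) (a : E) :
    ‖√(ρ z) • a‖ₑ ^ 2 = ENNReal.ofReal (ρ z) * ‖a‖ₑ ^ 2 := by
  rw [← ofReal_norm_sq, norm_smul, mul_pow, Real.norm_of_nonneg (Real.sqrt_nonneg _), Real.sq_sqrt h,
    ENNReal.ofReal_mul h, ofReal_norm_sq]

end

/-- The elementary inequality behind the error estimate with time oscillations. -/
theorem le_of_energy_inequalities {C N E Φ H s Y : ℝ} (hC : 1 ≤ C) (hN : 0 ≤ N) (hE : 0 ≤ E)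
    (hΦ : 0 ≤ Φ) (hH : 0 ≤ H) (hs : 0 ≤ s) (hY : 0 ≤ Y)
    (h1 : N ^ 2 ≤ E * N + C * (Φ * (H * N + Y)))
    (h2 : Y ^ 2 ≤ C * s ^ 2 * (N ^ 2 + E * N + Φ * (H * N + Y))) :
    N ≤ E + 20 * C ^ 2 * (Φ * (H + s)) := by
  by_contra hcon
  push Not at hcon
  have hG : 0 ≤ Φ * (H + s) := by positivity
  have hEN : E ≤ N := by nlinarith [mul_nonneg (sq_nonneg C) hG]
  have hEN2 : E * N ≤ N ^ 2 := by nlinarith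
  have hP : 0 ≤ Φ * H := by positivity
  have hS : 0 ≤ Φ * s := by positivity
  -- bound of the oscillation
  have hCs : 0 ≤ C * s := by positivity
  -- With q = C s (N + ΦH + Φs) the second inequality implies Y² ≤ 2q² + qY, hence Y ≤ 2q. The
  -- factor 3 leaves room for the contradiction.
  have h3 : Y ≤ 3 * C * s * (N + Φ * H + Φ * s) := by
    by_contra hy
    push Not at hy
    have h4 : C * s ^ 2 * (N ^ 2 + E * N + Φ * (H * N + Y)) ≤
        C * s ^ 2 * (2 * N ^ 2 + Φ * H * N) + C * s * (Φ * s) * Y := by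
      have : 0 ≤ C * s ^ 2 := by positivity
      nlinarith [mul_le_mul_of_nonneg_left hEN2 this]
    set Z := N + Φ * H + Φ * s with hZ
    have hZ0 : 0 ≤ Z := by positivity
    have h5 : C * s * (Φ * s) ≤ C * s * Z := mul_le_mul_of_nonneg_left (by linarith) hCs
    have h6 : 2 * N ^ 2 + Φ * H * N ≤ 2 * Z ^ 2 := by nlinarith [mul_nonneg hP hN, mul_nonneg hS hN, mul_nonneg hP hS, sq_nonneg (Φ * H), sq_nonneg (Φ * s)]
    have h7 : C * s ^ 2 * (2 * N ^ 2 + Φ * H * N) ≤ 2 * (C * s * Z) ^ 2 := by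
      have : C * s ^ 2 ≤ (C * s) ^ 2 := by nlinarith [sq_nonneg s]
      calc _ ≤ C * s ^ 2 * (2 * Z ^ 2) := by gcongr
        _ ≤ (C * s) ^ 2 * (2 * Z ^ 2) := by gcongr
        _ = _ := by ring
    have h8 : Y ^ 2 ≤ 2 * (C * s * Z) ^ 2 + C * s * Z * Y := by
      nlinarith [mul_le_mul_of_nonneg_right h5 hY]
    have h9 : 0 ≤ C * s * Z := by positivity
    have h10 : 3 * (C * s * Z) < Y := by rw [hZ]; linarith
    nlinarith
  have h11 : N ^ 2 ≤ E * N + C * (Φ * H) * N + 3 * C ^ 2 * (Φ * s) * (N + Φ * H + Φ * s) := by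
    have := mul_le_mul_of_nonneg_left h3 (by positivity : 0 ≤ C * Φ)
    nlinarith
  set G := Φ * (H + s) with hGd
  have hPG : Φ * H ≤ G := by rw [hGd]; nlinarith
  have hSG : Φ * s ≤ G := by rw [hGd]; nlinarith
  have hC2 : C ≤ C ^ 2 := by nlinarith
  have hC0 : 0 ≤ C ^ 2 := sq_nonneg C
  -- The assumed lower bound makes G ≤ N, so the right side is at most (E + 10 C² G)N, which
  -- contradicts N > E + 20 C² G.
  have h12 : N ^ 2 ≤ E * N + 4 * C ^ 2 * G * N + 6 * C ^ 2 * G ^ 2 := by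
    have e1 : C * (Φ * H) * N ≤ C ^ 2 * G * N := by gcongr
    have e2 : 3 * C ^ 2 * (Φ * s) * (N + Φ * H + Φ * s) ≤ 3 * C ^ 2 * G * (N + G + G) := by gcongr
    nlinarith
  have h13 : 20 * C ^ 2 * G ≤ N := by linarith
  have h14 : (E + 20 * C ^ 2 * G) * N < N * N ∨ N = 0 := by
    rcases hN.eq_or_lt with h | h
    · exact Or.inr h.symm
    · exact Or.inl (mul_lt_mul_of_pos_right hcon h)
  rcases h14 with h14 | h14
  · have h15 : G ≤ N := by nlinarith
    have h16 : C ^ 2 * G * G ≤ C ^ 2 * G * N := mul_le_mul_of_nonneg_left h15 (by positivity)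
    nlinarith [mul_nonneg (mul_nonneg hC0 hG) hN]
  · nlinarith [mul_nonneg hC0 hG]

/-! ### Projection onto the auxiliary space -/

/-- The residual f - βr is orthogonal to r, so multiples of r may be subtracted from η, and by
Pythagoras it is no longer than f. It is applied with κ̃^{-1/2}f for f, κ̃^{1/2} for r, and
κ̃^{1/2}θ for η. -/
theorem enorm_integral_residual_sq_le {α : Type*} [MeasurableSpace α] {ν : Measure α}
    {f r η : α → ℝ} (hf : MemLp f 2 ν) (hr : MemLp r 2 ν) (hη : MemLp η 2 ν) {β : ℝ}
    (h0 : ∫ z, (f z - β * r z) * r z ∂ν = 0) (c : ℝ) :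
    ‖∫ z, (f z - β * r z) * η z ∂ν‖ₑ ^ 2 ≤
      (∫⁻ z, ‖f z‖ₑ ^ 2 ∂ν) * ∫⁻ z, ‖η z - c * r z‖ₑ ^ 2 ∂ν := by
  have hq : MemLp (fun z => f z - β * r z) 2 ν := hf.sub (hr.const_mul β)
  have hηr : MemLp (fun z => η z - c * r z) 2 ν := hη.sub (hr.const_mul c)
  have e1 : ∫ z, (f z - β * r z) * η z ∂ν = ∫ z, (f z - β * r z) * (η z - c * r z) ∂ν := by
    have i1 : Integrable (fun z => (f z - β * r z) * (η z - c * r z)) ν := hq.integrable_mul hηr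
    have i2 : Integrable (fun z => (f z - β * r z) * r z) ν := hq.integrable_mul hr
    rw [← sub_eq_zero, ← mul_zero c, ← h0, ← integral_const_mul,
      ← integral_sub (memLp_two_mul hq hη) i1]
    refine integral_congr_ae (Filter.Eventually.of_forall fun z => ?_)
    simp only
    ring
  rw [e1]
  refine (enorm_integral_sq_le hq.1 hηr.1
    (Filter.Eventually.of_forall fun z => (enorm_mul _ _).le)).trans ?_
  gcongr ?_ * _
  have e2 : ∀ {g : α → ℝ}, MemLp g 2 ν → ∫⁻ z, ‖g z‖ₑ ^ 2 ∂ν = ENNReal.ofReal (∫ z, g z * g z ∂ν) := by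
    intro g hg
    rw [ofReal_integral_eq_lintegral_ofReal (memLp_two_mul hg hg)
      (Filter.Eventually.of_forall fun z => mul_self_nonneg _)]
    refine lintegral_congr fun z => ?_
    rw [← ofReal_norm_sq, Real.norm_eq_abs, sq_abs, sq]
  rw [e2 hq, e2 hf]
  refine ENNReal.ofReal_le_ofReal ?_
  have i2 : Integrable (fun z => (f z - β * r z) * r z) ν := hq.integrable_mul hr
  have i3 : Integrable (fun z => r z * r z) ν := hr.integrable_mul hr
  have i4 : Integrable (fun z => (f z - β * r z) * (f z - β * r z)) ν := hq.integrable_mul hq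
  have i5 : Integrable (fun z => (f z - β * r z) * (f z - β * r z) +
      2 * β * ((f z - β * r z) * r z)) ν := i4.add (i2.const_mul _)
  have e3 : ∫ z, f z * f z ∂ν = (∫ z, (f z - β * r z) * (f z - β * r z) ∂ν) +
      2 * β * (∫ z, (f z - β * r z) * r z ∂ν) + β ^ 2 * ∫ z, r z * r z ∂ν := by
    rw [← integral_const_mul, ← integral_const_mul, ← integral_add i4 (i2.const_mul _),
      ← integral_add i5 (i3.const_mul _)]
    refine integral_congr_ae (Filter.Eventually.of_forall fun z => ?_)
    simp only
    ring
  rw [e3, h0]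
  have : 0 ≤ ∫ z, r z * r z ∂ν := integral_nonneg fun z => mul_self_nonneg _
  nlinarith [mul_nonneg (sq_nonneg β) this]

namespace Problem
variable {κ₀ κ₁ : ℝ} (P : Problem d κ₀ κ₁) (𝒯 : SpaceMesh d P.Ω) (τ : TimeMesh P.T)

/-- The block with index `q`. -/
def blk (q : AuxIndex P 𝒯 τ) : Set (STPt d) := P.block 𝒯 τ q.1 q.2.1 q.2.2

theorem measurableSet_continuum (j : Option (Fin P.numChannels)) :
    MeasurableSet (P.continuum j) := by
  cases j with
  | none => exact (MeasurableSet.iUnion P.measurableSet_channel).compl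
  | some k => exact P.measurableSet_channel k

theorem measurableSet_Q : MeasurableSet P.Q := measurableSet_cyl P.isOpen.measurableSet

theorem measurableSet_blk (q : AuxIndex P 𝒯 τ) : MeasurableSet (P.blk 𝒯 τ q) :=
  (measurableSet_Ioc.prod (𝒯.measurableSet_cell _)).inter (P.measurableSet_continuum _)

theorem eq_of_mem_continuum {j k : Option (Fin P.numChannels)} {z : STPt d}
    (hj : z ∈ P.continuum j) (hk : z ∈ P.continuum k) : j = k := by
  cases j with
  | none =>
    cases k with
    | none => rfl
    | some k => exact absurd (mem_iUnion.2 ⟨k, hk⟩) hj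
  | some j =>
    cases k with
    | none => exact absurd (mem_iUnion.2 ⟨j, hj⟩) hk
    | some k =>
      by_contra hne
      exact disjoint_left.1 (P.disjoint_channel fun h => hne (congrArg some h)) hj hk

theorem exists_mem_continuum (z : STPt d) : ∃ j, z ∈ P.continuum j := by
  by_cases h : z ∈ ⋃ k, P.channel k
  · obtain ⟨k, hk⟩ := mem_iUnion.1 h
    exact ⟨some k, hk⟩
  · exact ⟨none, h⟩

theorem _root_.SpaceTimeNLMC.SpaceMesh.cell_inj {Ω : Set (Pt d)} (𝒯 : SpaceMesh d Ω)
    {i j : Fin 𝒯.numCells} {x : Pt d} (hi : x ∈ 𝒯.cell i) (hj : x ∈ 𝒯.cell j) : i = j := by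
  by_contra hne
  exact disjoint_left.1 (𝒯.disjoint_cells hne) hi hj

theorem blk_inj {q q' : AuxIndex P 𝒯 τ} {z : STPt d} (h : z ∈ P.blk 𝒯 τ q)
    (h' : z ∈ P.blk 𝒯 τ q') : q = q' := by
  refine Prod.ext (τ.interval_inj h.1.1 h'.1.1) (Prod.ext (𝒯.cell_inj h.1.2 h'.1.2) ?_)
  exact P.eq_of_mem_continuum h.2 h'.2

theorem pairwise_disjoint_blk : Pairwise (Function.onFun Disjoint (P.blk 𝒯 τ)) := fun _ _ hne =>
  disjoint_left.2 fun _ h h' => hne (P.blk_inj 𝒯 τ h h')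

/-- Only faces of elements and the final time are neglected; the continua partition every point set.
-/
theorem Q_ae_eq : P.Q =ᵐ[volume] ⋃ q, P.blk 𝒯 τ q := by
  have h1 : ∀ᵐ x : Pt d, x ∉ P.Ω \ ⋃ i, 𝒯.cell i := measure_eq_zero_iff_ae_notMem.1 𝒯.volume_diff_cells
  have hT : ∀ᵐ t : ℝ, t ≠ P.T := (finite_singleton P.T).countable.ae_notMem _
  filter_upwards [ae_of_ae_space h1, ae_of_ae_time (d := d) hT] with z hz hzT
  apply propext
  constructor
  · rintro ⟨hz1, hz2⟩
    obtain ⟨n, hn⟩ := τ.exists_mem_interval ⟨hz1.1, hz1.2.le⟩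
    have h2 : z.2 ∈ ⋃ i, 𝒯.cell i := by
      by_contra h
      exact hz ⟨hz2, h⟩
    obtain ⟨i, hi⟩ := mem_iUnion.1 h2
    obtain ⟨j, hj⟩ := P.exists_mem_continuum z
    exact mem_iUnion.2 ⟨(n, i, j), ⟨hn, hi⟩, hj⟩
  · intro h
    obtain ⟨q, hq⟩ := mem_iUnion.1 h
    refine ⟨⟨(τ.t_nonneg _).trans_lt hq.1.1.1, ?_⟩, 𝒯.cell_subset _ hq.1.2⟩
    exact lt_of_le_of_ne (hq.1.1.2.trans (τ.t_le _)) hzT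

theorem blk_ae_le (q : AuxIndex P 𝒯 τ) : P.blk 𝒯 τ q ≤ᵐ[volume] P.Q :=
  (subset_iUnion (P.blk 𝒯 τ) q).eventuallyLE.trans (P.Q_ae_eq 𝒯 τ).symm.le

theorem restrict_blk_le (q : AuxIndex P 𝒯 τ) :
    volume.restrict (P.blk 𝒯 τ q) ≤ volume.restrict P.Q :=
  Measure.restrict_mono' (P.blk_ae_le 𝒯 τ q) le_rfl

theorem lintegral_blk (f : STPt d → ℝ≥0∞) :
    ∫⁻ z in P.Q, f z = ∑ q, ∫⁻ z in P.blk 𝒯 τ q, f z := by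
  rw [Measure.restrict_congr_set (P.Q_ae_eq 𝒯 τ), lintegral_iUnion (P.measurableSet_blk 𝒯 τ)
    (P.pairwise_disjoint_blk 𝒯 τ), tsum_fintype]

theorem integral_blk {f : STPt d → ℝ} (hf : IntegrableOn f P.Q) :
    ∫ z in P.Q, f z = ∑ q, ∫ z in P.blk 𝒯 τ q, f z := by
  have h1 := hf
  rw [integrableOn_congr_set_ae (P.Q_ae_eq 𝒯 τ)] at h1
  rw [setIntegral_congr_set (P.Q_ae_eq 𝒯 τ), integral_iUnion (P.measurableSet_blk 𝒯 τ)
    (P.pairwise_disjoint_blk 𝒯 τ) h1, tsum_fintype]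

theorem sum_lintegral_blk (n : Fin τ.N) (i : Fin 𝒯.numCells) (f : STPt d → ℝ≥0∞) :
    ∑ j, ∫⁻ z in P.blk 𝒯 τ (n, i, j), f z = ∫⁻ z in τ.openInterval n ×ˢ 𝒯.cell i, f z := by
  rw [← Measure.restrict_congr_set (τ.interval_prod_ae_eq n (𝒯.cell i))]
  have h1 : (τ.interval n ×ˢ 𝒯.cell i : Set (STPt d)) = ⋃ j, P.blk 𝒯 τ (n, i, j) := by
    ext z
    constructor
    · intro hz
      obtain ⟨j, hj⟩ := P.exists_mem_continuum z
      exact mem_iUnion.2 ⟨j, hz, hj⟩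
    · intro hz
      obtain ⟨j, hj⟩ := mem_iUnion.1 hz
      exact hj.1
  have h2 : Pairwise (Function.onFun Disjoint fun j => P.blk 𝒯 τ (n, i, j)) := fun j k hjk =>
    disjoint_left.2 fun z h h' => hjk (P.eq_of_mem_continuum h.2 h'.2)
  rw [h1, lintegral_iUnion (fun j => P.measurableSet_blk 𝒯 τ (n, i, j)) h2, tsum_fintype]

theorem lintegral_cells (f : STPt d → ℝ≥0∞) :
    ∫⁻ z in P.Q, f z = ∑ n, ∑ i, ∫⁻ z in τ.openInterval n ×ˢ 𝒯.cell i, f z := by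
  rw [P.lintegral_blk 𝒯 τ, Fintype.sum_prod_type]
  refine Finset.sum_congr rfl fun n _ => ?_
  rw [Fintype.sum_prod_type]
  exact Finset.sum_congr rfl fun i _ => P.sum_lintegral_blk 𝒯 τ n i f

variable {κt : STPt d → ℝ}

theorem exists_coeff_of_mem_Vaux {p : STPt d → ℝ} (hp : p ∈ P.Vaux κt 𝒯 τ) :
    ∃ β : AuxIndex P 𝒯 τ → ℝ, ∀ q, ∀ z ∈ P.blk 𝒯 τ q, p z = β q := by
  obtain ⟨a, rfl⟩ := (Submodule.mem_span_range_iff_exists_fun ℝ).1 hp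
  refine ⟨fun q => a q * (∫ z in P.blk 𝒯 τ q, κt z)⁻¹, fun q z hz => ?_⟩
  rw [Finset.sum_apply, Finset.sum_eq_single q]
  · simp only [Pi.smul_apply, smul_eq_mul, ψ]
    rw [indicator_of_mem (show z ∈ P.block 𝒯 τ q.1 q.2.1 q.2.2 from hz)]
    rfl
  · intro q' _ hq'
    simp only [Pi.smul_apply, smul_eq_mul, ψ]
    rw [indicator_of_notMem (show z ∉ P.block 𝒯 τ q'.1 q'.2.1 q'.2.2 from
      fun h => hq' (P.blk_inj 𝒯 τ h hz)), mul_zero]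
  · simp

theorem integral_mul_ψ (g : STPt d → ℝ) (q : AuxIndex P 𝒯 τ) :
    ∫ z in P.Q, g z * P.ψ κt 𝒯 τ q z =
      (∫ z in P.blk 𝒯 τ q, g z) * (∫ z in P.blk 𝒯 τ q, κt z)⁻¹ := by
  have h1 : ∀ z, g z * P.ψ κt 𝒯 τ q z =
      (P.blk 𝒯 τ q).indicator (fun z => g z * (∫ z in P.blk 𝒯 τ q, κt z)⁻¹) z := fun z => by
    rw [ψ]
    by_cases hz : z ∈ P.blk 𝒯 τ q
    · rw [indicator_of_mem hz, indicator_of_mem (show z ∈ P.block 𝒯 τ q.1 q.2.1 q.2.2 from hz)]; rfl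
    · rw [indicator_of_notMem hz,
        indicator_of_notMem (show z ∉ P.block 𝒯 τ q.1 q.2.1 q.2.2 from hz), mul_zero]
  simp only [h1]
  rw [setIntegral_indicator (P.measurableSet_blk 𝒯 τ q), ← integral_mul_const]
  refine setIntegral_congr_set ?_
  filter_upwards [P.blk_ae_le 𝒯 τ q] with z hz
  exact propext ⟨fun h => h.2, fun h => ⟨hz h, h⟩⟩

/-- On each block p is the weighted mean of κ̃⁻¹f, so the residual is orthogonal to constants. The
constant c depends on the space-time element but not on the continuum, because the Poincaré
inequality is used on whole elements. The factors h i² and their inverses are distributed before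
Cauchy-Schwarz over the blocks, so that the local mesh size goes with f. -/
theorem enorm_residual_sq_le (hρm : AEMeasurable κt (volume.restrict P.Q))
    (hρ0 : ∀ z ∈ P.Q, 0 ≤ κt z) (hρ1 : MemLp (fun z => √(κt z)) 2 (volume.restrict P.Q))
    (hF : ∫⁻ z in P.Q, (ENNReal.ofReal (κt z))⁻¹ * ENNReal.ofReal (P.f z ^ 2) ≠ ∞)
    {p : STPt d → ℝ} (hp : p ∈ P.Vaux κt 𝒯 τ)
    (hs : ∀ q, P.s κt p (P.ψ κt 𝒯 τ q) = ∫ z in P.Q, P.f z * P.ψ κt 𝒯 τ q z)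
    {θ : STPt d → ℝ} (hθ : MemLp (fun z => √(κt z) * θ z) 2 (volume.restrict P.Q))
    {h : Fin 𝒯.numCells → ℝ} (hh : ∀ i, 0 < h i) (c : Fin τ.N → Fin 𝒯.numCells → ℝ) :
    ‖(∫ z in P.Q, P.f z * θ z) - P.s κt p θ‖ₑ ^ 2 ≤
      (∑ n, ∑ i, (ENNReal.ofReal (h i ^ 2))⁻¹ *
        ∫⁻ z in τ.openInterval n ×ˢ 𝒯.cell i, ‖scaled κt P.f z‖ₑ ^ 2) *
      ∑ n, ∑ i, ENNReal.ofReal (h i ^ 2) *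
        ∫⁻ z in τ.openInterval n ×ˢ 𝒯.cell i, ENNReal.ofReal (κt z) * ‖θ z - c n i‖ₑ ^ 2 := by
  obtain ⟨β, hβ⟩ := P.exists_coeff_of_mem_Vaux 𝒯 τ hp
  have hfm : AEMeasurable P.f (volume.restrict P.Q) := P.memLp_f.1.aemeasurable
  have hf := memLp_scaled hρm hfm hF
  have hff := ae_sqrt_mul_scaled hρm hfm hF
  have hρ0' : ∀ᵐ z ∂volume.restrict P.Q, 0 ≤ κt z :=
    (ae_restrict_iff' P.measurableSet_Q).2 (Filter.Eventually.of_forall hρ0)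
  have hle := P.restrict_blk_le 𝒯 τ
  have hmem : ∀ q, ∀ᵐ z ∂volume.restrict (P.blk 𝒯 τ q), z ∈ P.blk 𝒯 τ q := fun q =>
    ae_restrict_mem (P.measurableSet_blk 𝒯 τ q)
  -- orthogonality on each block
  have horth : ∀ q, ∫ z in P.blk 𝒯 τ q, (scaled κt P.f z - β q * √(κt z)) * √(κt z) = 0 := by
    intro q
    have hr := hρ1.mono_measure (hle q)
    have hf' := hf.mono_measure (hle q)
    have e1 : ∫ z in P.blk 𝒯 τ q, scaled κt P.f z * √(κt z) = ∫ z in P.blk 𝒯 τ q, P.f z := by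
      refine integral_congr_ae ?_
      filter_upwards [ae_mono (hle q) hff] with z hz
      rw [mul_comm, hz]
    have hκi : Integrable κt (volume.restrict (P.blk 𝒯 τ q)) := by
      refine (hr.integrable_mul hr).congr ?_
      filter_upwards [ae_mono (hle q) hρ0'] with z hz
      exact Real.mul_self_sqrt hz
    have e2 : ∫ z in P.blk 𝒯 τ q, √(κt z) * √(κt z) = ∫ z in P.blk 𝒯 τ q, κt z := by
      refine integral_congr_ae ?_
      filter_upwards [ae_mono (hle q) hρ0'] with z hz
      exact Real.mul_self_sqrt hz
    have i1 : Integrable (fun z => scaled κt P.f z * √(κt z)) (volume.restrict (P.blk 𝒯 τ q)) :=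
      hf'.integrable_mul hr
    have i2 : Integrable (fun z => √(κt z) * √(κt z)) (volume.restrict (P.blk 𝒯 τ q)) :=
      hr.integrable_mul hr
    have e3 : ∫ z in P.blk 𝒯 τ q, (scaled κt P.f z - β q * √(κt z)) * √(κt z) =
        (∫ z in P.blk 𝒯 τ q, P.f z) - β q * ∫ z in P.blk 𝒯 τ q, κt z := by
      rw [← e1, ← e2, ← integral_const_mul, ← integral_sub i1 (i2.const_mul _)]
      refine integral_congr_ae (Filter.Eventually.of_forall fun z => ?_)
      simp only
      ring
    -- On a block of zero weight ψ is zero and the coarse problem says nothing, but there √κ̃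
    -- vanishes almost everywhere.
    by_cases hm : ∫ z in P.blk 𝒯 τ q, κt z = 0
    · have h0 := (integral_eq_zero_iff_of_nonneg_ae (ae_mono (hle q) hρ0') hκi).1 hm
      refine integral_eq_zero_of_ae ?_
      filter_upwards [h0] with z hz
      simp only [Pi.zero_apply] at hz ⊢
      rw [hz, Real.sqrt_zero, mul_zero]
    · have h1 := hs q
      have h2 : P.s κt p (P.ψ κt 𝒯 τ q) = ∫ z in P.Q, (κt z * p z) * P.ψ κt 𝒯 τ q z := rfl
      rw [h2, P.integral_mul_ψ, P.integral_mul_ψ, mul_left_inj' (inv_ne_zero hm)] at h1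
      rw [e3, ← h1, ← integral_const_mul, sub_eq_zero]
      refine setIntegral_congr_fun (P.measurableSet_blk 𝒯 τ q) fun z hz => ?_
      simp only [hβ q z hz]
      ring
  -- the residual on each block
  have hX : ∀ q, ∀ᵐ z ∂volume.restrict (P.blk 𝒯 τ q), P.f z * θ z - κt z * p z * θ z =
      (scaled κt P.f z - β q * √(κt z)) * (√(κt z) * θ z) := by
    intro q
    filter_upwards [hmem q, ae_mono (hle q) hff, ae_mono (hle q) hρ0'] with z hz1 hz2 hz3
    rw [hβ q z hz1, ← hz2]
    nth_rw 2 [← Real.mul_self_sqrt hz3]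
    ring
  have hpi : ∀ q, IntegrableOn (fun z => κt z * p z * θ z) (P.blk 𝒯 τ q) := by
    intro q
    have : Integrable (fun z => β q * (√(κt z) * (√(κt z) * θ z))) (volume.restrict (P.blk 𝒯 τ q)) :=
      ((hρ1.mono_measure (hle q)).integrable_mul (hθ.mono_measure (hle q))).const_mul _
    refine this.congr ?_
    filter_upwards [hmem q, ae_mono (hle q) hρ0'] with z hz1 hz3
    rw [hβ q z hz1, ← mul_assoc (√(κt z)), Real.mul_self_sqrt hz3]
    ring
  have hpi' : IntegrableOn (fun z => κt z * p z * θ z) P.Q := by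
    rw [integrableOn_congr_set_ae (P.Q_ae_eq 𝒯 τ), integrableOn_finite_iUnion]
    exact hpi
  have hfi : IntegrableOn (fun z => P.f z * θ z) P.Q := by
    have : Integrable (fun z => scaled κt P.f z * (√(κt z) * θ z)) (volume.restrict P.Q) :=
      hf.integrable_mul hθ
    refine this.congr ?_
    filter_upwards [hff] with z hz
    rw [← mul_assoc, mul_comm (scaled _ _ _), hz]
  have hd : IntegrableOn (fun z => P.f z * θ z - κt z * p z * θ z) P.Q := hfi.sub hpi'
  have e4 : (∫ z in P.Q, P.f z * θ z) - P.s κt p θ =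
      ∑ q, ∫ z in P.blk 𝒯 τ q, (scaled κt P.f z - β q * √(κt z)) * (√(κt z) * θ z) := by
    rw [s, ← integral_sub hfi hpi', P.integral_blk 𝒯 τ hd]
    exact Finset.sum_congr rfl fun q _ => integral_congr_ae (hX q)
  have hest : ∀ q : AuxIndex P 𝒯 τ,
      ‖∫ z in P.blk 𝒯 τ q, (scaled κt P.f z - β q * √(κt z)) * (√(κt z) * θ z)‖ₑ ^ 2 ≤
      ((ENNReal.ofReal (h q.2.1 ^ 2))⁻¹ * ∫⁻ z in P.blk 𝒯 τ q, ‖scaled κt P.f z‖ₑ ^ 2) *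
      (ENNReal.ofReal (h q.2.1 ^ 2) * ∫⁻ z in P.blk 𝒯 τ q,
        ENNReal.ofReal (κt z) * ‖θ z - c q.1 q.2.1‖ₑ ^ 2) := by
    intro q
    have hpos : ENNReal.ofReal (h q.2.1 ^ 2) ≠ 0 := by simpa using (hh q.2.1).ne'
    have h1 := enorm_integral_residual_sq_le (hf.mono_measure (hle q)) (hρ1.mono_measure (hle q))
      (hθ.mono_measure (hle q)) (horth q) (c q.1 q.2.1)
    refine h1.trans_eq ?_
    have e5 : ∫⁻ z in P.blk 𝒯 τ q, ‖√(κt z) * θ z - c q.1 q.2.1 * √(κt z)‖ₑ ^ 2 =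
        ∫⁻ z in P.blk 𝒯 τ q, ENNReal.ofReal (κt z) * ‖θ z - c q.1 q.2.1‖ₑ ^ 2 := by
      refine lintegral_congr_ae ?_
      filter_upwards [ae_mono (hle q) hρ0'] with z hz
      rw [← enorm_sqrt_mul_sq hz]
      congr 2
      ring
    rw [e5, mul_mul_mul_comm, ENNReal.inv_mul_cancel hpos ENNReal.ofReal_ne_top, one_mul]
  have hsum : ‖∑ q, ∫ z in P.blk 𝒯 τ q, (scaled κt P.f z - β q * √(κt z)) * (√(κt z) * θ z)‖ₑ ^ 2 ≤
      (∑ q, ‖∫ z in P.blk 𝒯 τ q, (scaled κt P.f z - β q * √(κt z)) * (√(κt z) * θ z)‖ₑ) ^ 2 := by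
    gcongr
    exact enorm_sum_le _ _
  rw [e4]
  refine (hsum.trans (sum_sq_le_of_sq_le hest)).trans_eq ?_
  have e6 : ∀ (a : Fin 𝒯.numCells → ℝ≥0∞) (g : Fin τ.N → Fin 𝒯.numCells → STPt d → ℝ≥0∞),
      ∑ q : AuxIndex P 𝒯 τ, a q.2.1 * ∫⁻ z in P.blk 𝒯 τ q, g q.1 q.2.1 z =
      ∑ n, ∑ i, a i * ∫⁻ z in τ.openInterval n ×ˢ 𝒯.cell i, g n i z := by
    intro a g
    rw [Fintype.sum_prod_type]
    refine Finset.sum_congr rfl fun n _ => ?_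
    rw [Fintype.sum_prod_type]
    refine Finset.sum_congr rfl fun i _ => ?_
    rw [← P.sum_lintegral_blk 𝒯 τ n i, Finset.mul_sum]
  exact congrArg₂ _ (e6 (fun i => (ENNReal.ofReal (h i ^ 2))⁻¹) fun _ _ z => ‖scaled κt P.f z‖ₑ ^ 2)
    (e6 (fun i => ENNReal.ofReal (h i ^ 2))
      fun n i z => ENNReal.ofReal (κt z) * ‖θ z - c n i‖ₑ ^ 2)

end Problem

/-! ### Weighted Poincaré inequalities -/

/-- The weight `ρ` scales like `h⁻²`, where `h` is the size of the elements. -/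
structure WeightBound {T : ℝ} {Ω : Set (Pt d)} (𝒯 : SpaceMesh d Ω) (ρ : STPt d → ℝ)
    (h : Fin 𝒯.numCells → ℝ) (Γ C : ℝ) : Prop where
  pos : ∀ i, 0 < h i
  le_H : ∀ i, h i ≤ 𝒯.H
  side_le : ∀ i k, 𝒯.side i k ≤ Γ * h i
  one_le : 1 ≤ Γ
  nonneg_const : 0 ≤ C
  aemeas : AEMeasurable ρ (volume.restrict (cyl T Ω))
  nonneg : ∀ z ∈ cyl T Ω, 0 ≤ ρ z
  bound : ∀ θ g, H10 T Ω θ g → ∀ i (c : ℝ) (I : Set ℝ), I ⊆ Ioo 0 T → MeasurableSet I →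
    ∫⁻ z in I ×ˢ 𝒯.cell i, ENNReal.ofReal (ρ z) * ‖θ z - c‖ₑ ^ 2 ≤
      ENNReal.ofReal C * ((ENNReal.ofReal (h i ^ 2))⁻¹ * (∫⁻ z in I ×ˢ 𝒯.cell i, ‖θ z - c‖ₑ ^ 2) +
        ∫⁻ z in I ×ˢ 𝒯.cell i, ‖g z‖ₑ ^ 2)

theorem H10.zero {T : ℝ} {Ω : Set (Pt d)} : H10 T Ω (fun _ => 0) (fun _ => 0) where
  meas_val := measurable_const
  meas_grad := measurable_const
  val_zero _ _ := rfl
  grad_zero _ _ := rfl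
  memLp_val := MemLp.zero
  memLp_grad := MemLp.zero
  lineAC y r hr := by simp

section
variable {T : ℝ} {Ω : Set (Pt d)} {𝒯 : SpaceMesh d Ω} (τ : TimeMesh T) {ρ : STPt d → ℝ}
  {h : Fin 𝒯.numCells → ℝ} {Γ C : ℝ}

/-- The choice θ = 0, c = -1 turns the multiplier bound into a bound of the mass of the weight. -/
theorem WeightBound.lintegral_le (hW : WeightBound (T := T) 𝒯 ρ h Γ C) (i : Fin 𝒯.numCells) {I : Set ℝ}
    (hI : I ⊆ Ioo 0 T) (hIm : MeasurableSet I) :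
    ∫⁻ z in I ×ˢ 𝒯.cell i, ENNReal.ofReal (ρ z) ≤
      ENNReal.ofReal C * ((ENNReal.ofReal (h i ^ 2))⁻¹ * (volume I * volume (𝒯.cell i))) := by
  have h1 := hW.bound _ _ H10.zero i (-1) I hI hIm
  have h2 : volume (I ×ˢ 𝒯.cell i : Set (STPt d)) = volume I * volume (𝒯.cell i) := by
    rw [Measure.volume_eq_prod, Measure.prod_prod]
  simpa [h2] using h1

/-- The constant of the Poincaré inequality. -/
def poincareConst (d : ℕ) (Γ : ℝ) : ℝ := 2 ^ (d + 1) * (d * Γ ^ 2)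

theorem poincareConst_nonneg : 0 ≤ poincareConst d Γ := by unfold poincareConst; positivity

theorem H10.exists_lintegral_sub_le (hΩ : MeasurableSet Ω) (hb : Bornology.IsBounded Ω)
    (hW : WeightBound (T := T) 𝒯 ρ h Γ C) {θ : STPt d → ℝ} {g : STPt d → Pt d} (hθ : H10 T Ω θ g)
    (n : Fin τ.N) (i : Fin 𝒯.numCells) :
    ∃ c : ℝ, ∫⁻ z in τ.openInterval n ×ˢ 𝒯.cell i, ‖θ z - c‖ₑ ^ 2 ≤
      ENNReal.ofReal (poincareConst d Γ * h i ^ 2) *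
        (∫⁻ z in τ.openInterval n ×ˢ 𝒯.cell i, ‖g z‖ₑ ^ 2) +
      2 * (volume (𝒯.cell i))⁻¹ *
        ∫⁻ t in τ.openInterval n, (∫⁻ x in 𝒯.cell i, ‖τ.osc θ (t, x)‖ₑ) ^ 2 := by
  have hh := hW.pos i
  have hΓ := hW.one_le
  have hD : ∀ y ∈ 𝒯.cell i - 𝒯.cell i, ‖y‖ₑ ≤ ENNReal.ofReal (√d * (Γ * h i)) := by
    rintro _ ⟨x, hx, y, hy, rfl⟩
    rw [← ofReal_norm]
    exact ENNReal.ofReal_le_ofReal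
      (𝒯.norm_sub_le_of_side_le (hW.side_le i) (by positivity) hx hy)
  obtain ⟨c, hc⟩ := hθ.exists_lintegral_sub_const_le hΩ hb (τ.openInterval_subset n)
    (𝒯.convex_cell i) (𝒯.measurableSet_cell i) (𝒯.volume_cell_ne_zero i) (𝒯.volume_cell_ne_top i) hD
  refine ⟨c, hc.trans (add_le_add ?_ (le_of_eq ?_))⟩
  · gcongr ?_ * _
    calc 2 * ((volume (𝒯.cell i))⁻¹ * volume (𝒯.cell i - 𝒯.cell i)) *
          ENNReal.ofReal (√d * (Γ * h i)) ^ 2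
        ≤ 2 * 2 ^ d * ENNReal.ofReal (√d * (Γ * h i)) ^ 2 := by
          gcongr; exact 𝒯.volume_cell_sub_cell i
      _ = ENNReal.ofReal (2 ^ (d + 1)) * ENNReal.ofReal ((√d * (Γ * h i)) ^ 2) := by
          rw [ENNReal.ofReal_pow (by positivity), ENNReal.ofReal_pow (by positivity),
            ENNReal.ofReal_ofNat]
          ring
      _ = _ := by
          rw [← ENNReal.ofReal_mul (by positivity), mul_pow, Real.sq_sqrt (by positivity),
            poincareConst]
          congr 1; ring
  · congr 1
    refine setLIntegral_congr_fun measurableSet_Ioo fun t ht => ?_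
    have : ∀ x, τ.osc θ (t, x) = θ (t, x) - timeMean (τ.t n.castSucc) (τ.t n.succ) θ x := fun x =>
      τ.osc_of_mem θ (z := (t, x)) (τ.openInterval_subset_interval n ht)
    simp only [this]

theorem ofReal_sq_inv_mul_cancel (hW : WeightBound (T := T) 𝒯 ρ h Γ C) (i : Fin 𝒯.numCells) :
    (ENNReal.ofReal (h i ^ 2))⁻¹ * ENNReal.ofReal (h i ^ 2) = 1 :=
  ENNReal.inv_mul_cancel (by simpa using (hW.pos i).ne') ENNReal.ofReal_ne_top

/-- The factor h² on the left is the one paired with h⁻² on f in the residual estimate. It cancels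
the h⁻² of the weight, so the oscillation appears without negative powers of h. -/
theorem H10.exists_lintegral_weight_le (hΩ : MeasurableSet Ω) (hb : Bornology.IsBounded Ω)
    (hW : WeightBound (T := T) 𝒯 ρ h Γ C) {θ : STPt d → ℝ} {g : STPt d → Pt d} (hθ : H10 T Ω θ g)
    (n : Fin τ.N) (i : Fin 𝒯.numCells) :
    ∃ c : ℝ, ENNReal.ofReal (h i ^ 2) * ∫⁻ z in τ.openInterval n ×ˢ 𝒯.cell i,
        ENNReal.ofReal (ρ z) * ‖θ z - c‖ₑ ^ 2 ≤
      ENNReal.ofReal (C * (poincareConst d Γ + 2)) *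
        (ENNReal.ofReal (𝒯.H ^ 2) * (∫⁻ z in τ.openInterval n ×ˢ 𝒯.cell i, ‖g z‖ₑ ^ 2) +
          ∫⁻ z in τ.openInterval n ×ˢ 𝒯.cell i, ‖τ.osc θ z‖ₑ ^ 2) := by
  obtain ⟨c, hc⟩ := hθ.exists_lintegral_sub_le τ hΩ hb hW n i
  have hom := τ.measurable_osc hθ.meas_val
  have hA := poincareConst_nonneg (d := d) (Γ := Γ)
  have hC := hW.nonneg_const
  -- In this regime the L¹ form of the oscillation is not needed and is replaced by the L² norm.
  have hjensen : 2 * (volume (𝒯.cell i))⁻¹ *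
        ∫⁻ t in τ.openInterval n, (∫⁻ x in 𝒯.cell i, ‖τ.osc θ (t, x)‖ₑ) ^ 2 ≤
      2 * ∫⁻ z in τ.openInterval n ×ˢ 𝒯.cell i, ‖τ.osc θ z‖ₑ ^ 2 := by
    rw [mul_assoc]
    gcongr
    rw [Measure.volume_eq_prod, ← Measure.prod_restrict, lintegral_prod _ (by fun_prop),
      ← lintegral_const_mul _ (by fun_prop)]
    refine lintegral_mono fun t => ?_
    have h1 := sq_lintegral_le (μ := volume.restrict (𝒯.cell i))
      (f := fun x => ‖τ.osc θ (t, x)‖ₑ) (by fun_prop)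
    rw [Measure.restrict_apply_univ] at h1
    calc _ ≤ (volume (𝒯.cell i))⁻¹ * (volume (𝒯.cell i) * ∫⁻ x in 𝒯.cell i, ‖τ.osc θ (t, x)‖ₑ ^ 2) := by
          gcongr
      _ = _ := by
          rw [← mul_assoc, ENNReal.inv_mul_cancel (𝒯.volume_cell_ne_zero i) (𝒯.volume_cell_ne_top i),
            one_mul]
  refine ⟨c, ?_⟩
  have h1 := hW.bound θ g hθ i c _ (τ.openInterval_subset n) measurableSet_Ioo
  set G := ∫⁻ z in τ.openInterval n ×ˢ 𝒯.cell i, ‖g z‖ₑ ^ 2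
  set O := ∫⁻ z in τ.openInterval n ×ˢ 𝒯.cell i, ‖τ.osc θ z‖ₑ ^ 2
  set A := poincareConst d Γ
  have hcan := ofReal_sq_inv_mul_cancel hW i
  have hHh : ENNReal.ofReal (h i ^ 2) ≤ ENNReal.ofReal (𝒯.H ^ 2) :=
    ENNReal.ofReal_le_ofReal (pow_le_pow_left₀ (hW.pos i).le (hW.le_H i) 2)
  calc ENNReal.ofReal (h i ^ 2) * ∫⁻ z in τ.openInterval n ×ˢ 𝒯.cell i,
        ENNReal.ofReal (ρ z) * ‖θ z - c‖ₑ ^ 2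
      ≤ ENNReal.ofReal (h i ^ 2) * (ENNReal.ofReal C * ((ENNReal.ofReal (h i ^ 2))⁻¹ *
          (ENNReal.ofReal (A * h i ^ 2) * G + 2 * O) + G)) := by
        gcongr
        refine h1.trans ?_
        gcongr
        exact hc.trans (add_le_add le_rfl hjensen)
    _ = ENNReal.ofReal C * (((ENNReal.ofReal (h i ^ 2))⁻¹ * ENNReal.ofReal (h i ^ 2)) *
          (ENNReal.ofReal (A * h i ^ 2) * G + 2 * O) + ENNReal.ofReal (h i ^ 2) * G) := by ring
    _ = ENNReal.ofReal C * ((ENNReal.ofReal A + 1) * (ENNReal.ofReal (h i ^ 2) * G) + 2 * O) := by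
        rw [hcan, ENNReal.ofReal_mul hA]; ring
    _ ≤ ENNReal.ofReal C * ((ENNReal.ofReal A + 2) * (ENNReal.ofReal (𝒯.H ^ 2) * G) +
          (ENNReal.ofReal A + 2) * O) := by
        gcongr
        · norm_num
        · exact le_add_self
    _ = _ := by
        rw [ENNReal.ofReal_mul hC, ENNReal.ofReal_add hA (by norm_num), ENNReal.ofReal_ofNat]; ring

theorem H11.ae_lintegral_osc_le (hΩ : MeasurableSet Ω) (hb : Bornology.IsBounded Ω) {θ : STFun d}
    (hθ : H11 T Ω θ) (n : Fin τ.N) (K : Set (Pt d)) :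
    ∀ᵐ t : ℝ, t ∈ τ.openInterval n → ∫⁻ x in K, ‖τ.osc θ.val (t, x)‖ₑ ≤
      ∫⁻ z in τ.openInterval n ×ˢ K, ‖θ.dt z‖ₑ := by
  have hom := τ.measurable_osc hθ.meas_val
  have hdt := hθ.meas_dt
  have h1 : ∀ᵐ x : Pt d, ∀ᵐ t : ℝ, t ∈ τ.openInterval n →
      ‖τ.osc θ.val (t, x)‖ₑ ≤ ∫⁻ s in τ.openInterval n, ‖θ.dt (s, x)‖ₑ := by
    filter_upwards [hθ.ae_enorm_osc_le τ hΩ hb] with x hx using hx n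
  rw [Measure.ae_ae_comm] at h1
  · filter_upwards [h1] with t ht htn
    rw [lintegral_prod_set (by fun_prop)]
    refine lintegral_mono_ae (ae_restrict_of_ae ?_)
    filter_upwards [ht] with x hx using hx htn
  · have h2 : MeasurableSet {p : Pt d × ℝ | p.2 ∈ τ.openInterval n} :=
      measurableSet_Ioo.preimage measurable_snd
    have h3 : MeasurableSet {p : Pt d × ℝ | ‖τ.osc θ.val (p.2, p.1)‖ₑ ≤
        ∫⁻ s in τ.openInterval n, ‖θ.dt (s, p.1)‖ₑ} := by
      refine measurableSet_le (by fun_prop) ?_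
      exact Measurable.lintegral_prod_right' (ν := volume.restrict (τ.openInterval n)) (f := fun q : (Pt d × ℝ) × ℝ => ‖θ.dt (q.2, q.1.1)‖ₑ)
        (by fun_prop)
    have h4 : {p : Pt d × ℝ | p.2 ∈ τ.openInterval n → ‖τ.osc θ.val (p.2, p.1)‖ₑ ≤
        ∫⁻ s in τ.openInterval n, ‖θ.dt (s, p.1)‖ₑ} =
        {p : Pt d × ℝ | p.2 ∈ τ.openInterval n}ᶜ ∪ {p : Pt d × ℝ | ‖τ.osc θ.val (p.2, p.1)‖ₑ ≤
        ∫⁻ s in τ.openInterval n, ‖θ.dt (s, p.1)‖ₑ} := by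
      ext p; simp [imp_iff_not_or]
    rw [h4]
    exact h2.compl.union h3

/-- Cauchy-Schwarz with the weight gives (∫|∂ₜθ|)² ≤ ∫ρ · ∫ρ⁻¹|∂ₜθ|², and the mass of ρ on the
element is at most C h⁻²|J||K| for a time interval J. Together with the length of J and the h⁻² of
the multiplier bound the factor is (|J|/h²)² ≤ M². The behaviour of ρ in time plays no role. -/
theorem H11.exists_lintegral_weight_le (hΩ : MeasurableSet Ω) (hb : Bornology.IsBounded Ω)
    (hW : WeightBound (T := T) 𝒯 ρ h Γ C) {θ : STFun d} (hθ : H11 T Ω θ)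
    (hfin : ∫⁻ z in cyl T Ω, (ENNReal.ofReal (ρ z))⁻¹ * ENNReal.ofReal (θ.dt z ^ 2) ≠ ∞)
    {M : ℝ} (hM : ∀ i, τ.dt ≤ M * h i ^ 2) (hM0 : 0 ≤ M)
    (n : Fin τ.N) (i : Fin 𝒯.numCells) :
    ∃ c : ℝ, ∫⁻ z in τ.openInterval n ×ˢ 𝒯.cell i, ENNReal.ofReal (ρ z) * ‖θ.val z - c‖ₑ ^ 2 ≤
      ENNReal.ofReal (C * (poincareConst d Γ + 1) + 2 * C ^ 2 * M ^ 2) *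
        ((∫⁻ z in τ.openInterval n ×ˢ 𝒯.cell i, ‖θ.grad z‖ₑ ^ 2) +
          ∫⁻ z in τ.openInterval n ×ˢ 𝒯.cell i, ‖scaled ρ θ.dt z‖ₑ ^ 2) := by
  obtain ⟨c, hc⟩ := hθ.exists_lintegral_sub_le τ hΩ hb hW n i
  refine ⟨c, ?_⟩
  have hA := poincareConst_nonneg (d := d) (Γ := Γ)
  have hC := hW.nonneg_const
  have hh := hW.pos i
  have hsub : τ.openInterval n ×ˢ 𝒯.cell i ⊆ cyl T Ω :=
    prod_mono (τ.openInterval_subset n) (𝒯.cell_subset i)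
  have hle : volume.restrict (τ.openInterval n ×ˢ 𝒯.cell i) ≤ volume.restrict (cyl T Ω) :=
    Measure.restrict_mono hsub le_rfl
  have hdtm : AEMeasurable θ.dt (volume.restrict (cyl T Ω)) := hθ.meas_dt.aemeasurable
  have hsc := (memLp_scaled hW.aemeas hdtm hfin).mono_measure hle
  have hρm := hW.aemeas.mono_measure hle
  set R := τ.openInterval n ×ˢ 𝒯.cell i with hR
  set K := 𝒯.cell i with hK
  set J := volume (τ.openInterval n) with hJ
  set G := ∫⁻ z in R, ‖θ.grad z‖ₑ ^ 2
  set D := ∫⁻ z in R, ‖scaled ρ θ.dt z‖ₑ ^ 2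
  set A := poincareConst d Γ
  set k := (ENNReal.ofReal (h i ^ 2))⁻¹ with hk
  have h1 := hW.bound θ.val θ.grad hθ.toH10 i c _ (τ.openInterval_subset n) measurableSet_Ioo
  have hcan := ofReal_sq_inv_mul_cancel hW i
  have hJM : k * J ≤ ENNReal.ofReal M := by
    have : J ≤ ENNReal.ofReal (M * h i ^ 2) := by
      rw [hJ, TimeMesh.openInterval, Real.volume_Ioo]
      exact ENNReal.ofReal_le_ofReal ((τ.step_le_dt n).trans (hM i))
    calc k * J ≤ k * ENNReal.ofReal (M * h i ^ 2) := by gcongr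
      _ = (k * ENNReal.ofReal (h i ^ 2)) * ENNReal.ofReal M := by
          rw [ENNReal.ofReal_mul hM0]; ring
      _ = _ := by rw [hcan, one_mul]
  -- the total variation in time
  have hdt : (∫⁻ z in R, ‖θ.dt z‖ₑ) ^ 2 ≤ (∫⁻ z in R, ENNReal.ofReal (ρ z)) * D := by
    have e1 : ∫⁻ z in R, ‖θ.dt z‖ₑ = ∫⁻ z in R, ‖√(ρ z)‖ₑ * ‖scaled ρ θ.dt z‖ₑ := by
      refine lintegral_congr_ae ?_
      filter_upwards [ae_mono hle (ae_sqrt_mul_scaled hW.aemeas hdtm hfin)] with z hz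
      rw [← hz, enorm_mul]
    rw [e1]
    refine (sq_lintegral_mul_le (by fun_prop) hsc.1.enorm).trans_eq ?_
    congr 1
    refine setLIntegral_congr_fun (measurableSet_Ioo.prod (𝒯.measurableSet_cell i)) fun z hz => ?_
    have := enorm_sqrt_mul_sq (hW.nonneg z (hsub hz)) 1
    simpa using this
  have hVρ := hW.lintegral_le i (τ.openInterval_subset n) measurableSet_Ioo
  have hosc : 2 * (volume K)⁻¹ * ∫⁻ t in τ.openInterval n, (∫⁻ x in K, ‖τ.osc θ.val (t, x)‖ₑ) ^ 2 ≤
      2 * ENNReal.ofReal C * (k * J) * J * D := by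
    calc 2 * (volume K)⁻¹ * ∫⁻ t in τ.openInterval n, (∫⁻ x in K, ‖τ.osc θ.val (t, x)‖ₑ) ^ 2
        ≤ 2 * (volume K)⁻¹ * ∫⁻ t in τ.openInterval n, (∫⁻ z in R, ‖θ.dt z‖ₑ) ^ 2 := by
          gcongr 2 * (volume K)⁻¹ * ?_
          refine setLIntegral_mono_ae' measurableSet_Ioo ?_
          filter_upwards [hθ.ae_lintegral_osc_le τ hΩ hb n K] with t ht htn
          gcongr
          exact ht htn
      _ = 2 * (volume K)⁻¹ * ((∫⁻ z in R, ‖θ.dt z‖ₑ) ^ 2 * J) := by rw [setLIntegral_const]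
      _ ≤ 2 * (volume K)⁻¹ * ((ENNReal.ofReal C * (k * (J * volume K)) * D) * J) := by
          gcongr
          exact hdt.trans (by gcongr)
      _ = ((volume K)⁻¹ * volume K) * (2 * ENNReal.ofReal C * (k * J) * J * D) := by ring
      _ = _ := by
          rw [ENNReal.inv_mul_cancel (𝒯.volume_cell_ne_zero i) (𝒯.volume_cell_ne_top i), one_mul]
  calc ∫⁻ z in R, ENNReal.ofReal (ρ z) * ‖θ.val z - c‖ₑ ^ 2
      ≤ ENNReal.ofReal C * (k * (ENNReal.ofReal (A * h i ^ 2) * G +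
          2 * ENNReal.ofReal C * (k * J) * J * D) + G) := by
        refine h1.trans ?_
        gcongr
        exact hc.trans (add_le_add le_rfl hosc)
    _ = ENNReal.ofReal C * ((k * ENNReal.ofReal (h i ^ 2)) * ENNReal.ofReal A * G + G) +
          2 * ENNReal.ofReal C ^ 2 * (k * J) ^ 2 * D := by
        rw [ENNReal.ofReal_mul hA]; ring
    _ ≤ ENNReal.ofReal C * (1 * ENNReal.ofReal A * G + G) +
          2 * ENNReal.ofReal C ^ 2 * ENNReal.ofReal M ^ 2 * D := by
        rw [hcan]; gcongr
    _ = ENNReal.ofReal (C * (A + 1)) * G + ENNReal.ofReal (2 * C ^ 2 * M ^ 2) * D := by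
        rw [ENNReal.ofReal_mul hC, ENNReal.ofReal_add hA zero_le_one, ENNReal.ofReal_one,
          ENNReal.ofReal_mul (by positivity), ENNReal.ofReal_mul (by norm_num),
          ENNReal.ofReal_pow hC, ENNReal.ofReal_pow hM0, ENNReal.ofReal_ofNat]
        ring
    _ ≤ _ := by
        rw [mul_add (ENNReal.ofReal _)]
        gcongr
        · exact le_add_of_nonneg_right (by positivity)
        · exact le_add_of_nonneg_left (by positivity)

end

/-! ### The error equation -/

namespace Problem
variable {κ₀ κ₁ : ℝ} {P : Problem d κ₀ κ₁} {𝒯 : SpaceMesh d P.Ω} {τ : TimeMesh P.T}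
  {κt : STPt d → ℝ} {h : Fin 𝒯.numCells → ℝ} {Γ C : ℝ}

theorem wnorm_ne_top_iff {ρ g : STPt d → ℝ} : P.wnorm ρ g ≠ ∞ ↔
    ∫⁻ z in P.Q, (ENNReal.ofReal (ρ z))⁻¹ * ENNReal.ofReal (g z ^ 2) ≠ ∞ := by
  rw [wnorm, ne_eq, ne_eq, ENNReal.rpow_eq_top_iff_of_pos (by norm_num)]

theorem rpow_half_eq {a : ℝ} (ha : 0 ≤ a) {x : ℝ≥0∞} (h : x = ENNReal.ofReal (a ^ 2)) :
    x ^ (1 / 2 : ℝ) = ENNReal.ofReal a := by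
  rw [h, ENNReal.ofReal_pow ha, ← ENNReal.rpow_natCast, ← ENNReal.rpow_mul]
  norm_num

theorem wnorm_eq {ρ g : STPt d → ℝ} (hρ : AEMeasurable ρ (volume.restrict P.Q))
    (hg : AEMeasurable g (volume.restrict P.Q)) (h : P.wnorm ρ g ≠ ∞) :
    P.wnorm ρ g = ENNReal.ofReal (l2 (volume.restrict P.Q) (scaled ρ g)) := by
  have h' := wnorm_ne_top_iff.1 h
  refine rpow_half_eq (l2_nonneg _) ?_
  rw [l2_sq (memLp_scaled hρ hg h'), lintegral_scaled hρ hg h']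

theorem isFiniteMeasure_restrict_Q (P : Problem d κ₀ κ₁) : IsFiniteMeasure (volume.restrict P.Q) :=
  isFiniteMeasure_restrict_cyl P.isBounded

/-- The weight may be unbounded, so finiteness has to come from the multiplier bound on each of the
finitely many elements. -/
theorem memLp_sqrt_weight_mul (τ : TimeMesh P.T) (hW : WeightBound (T := P.T) 𝒯 κt h Γ C)
    {θ : STPt d → ℝ} {g : STPt d → Pt d}
    (hθ : H10 P.T P.Ω θ g) (c : ℝ) :
    MemLp (fun z => √(κt z) * (θ z - c)) 2 (volume.restrict P.Q) := by
  have hm : AEMeasurable κt (volume.restrict P.Q) := hW.aemeas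
  have hθm := hθ.meas_val
  have := P.isFiniteMeasure_restrict_Q
  rw [memLp_two_iff (by fun_prop)]
  have h1 : ∫⁻ z in P.Q, ‖√(κt z) * (θ z - c)‖ₑ ^ 2 =
      ∫⁻ z in P.Q, ENNReal.ofReal (κt z) * ‖θ z - c‖ₑ ^ 2 :=
    setLIntegral_congr_fun P.measurableSet_Q fun z hz => enorm_sqrt_mul_sq (hW.nonneg z hz) _
  rw [h1, P.lintegral_cells 𝒯 τ]
  refine ENNReal.sum_ne_top.2 fun n _ => ENNReal.sum_ne_top.2 fun i _ => ?_
  refine ne_top_of_le_ne_top ?_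
    (hW.bound θ g hθ i c _ (τ.openInterval_subset n) measurableSet_Ioo)
  have hle : volume.restrict (τ.openInterval n ×ˢ 𝒯.cell i) ≤ volume.restrict P.Q :=
    Measure.restrict_mono (prod_mono (τ.openInterval_subset n) (𝒯.cell_subset i)) le_rfl
  have hc : MemLp (fun z => θ z - c) 2 (volume.restrict P.Q) :=
    (hθ.memLp_val.restrict _).sub (memLp_const c)
  refine ENNReal.mul_ne_top ENNReal.ofReal_ne_top (ENNReal.add_ne_top.2 ⟨ENNReal.mul_ne_top ?_ ?_, ?_⟩)
  · simpa using (hW.pos i).ne'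
  · exact lintegral_sq_ne_top (hc.mono_measure hle)
  · exact lintegral_sq_ne_top (hθ.memLp_grad.restrict _)

theorem memLp_sqrt_weight (τ : TimeMesh P.T) (hW : WeightBound (T := P.T) 𝒯 κt h Γ C) :
    MemLp (fun z => √(κt z)) 2 (volume.restrict P.Q) := by
  have := memLp_sqrt_weight_mul τ hW H10.zero (-1)
  simpa using this

theorem memLp_osc (τ : TimeMesh P.T) {θ : STPt d → ℝ} {g : STPt d → Pt d} (hθ : H10 P.T P.Ω θ g) :
    MemLp (τ.osc θ) 2 (volume.restrict P.Q) := by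
  rw [memLp_two_iff (τ.measurable_osc hθ.meas_val).aestronglyMeasurable]
  exact ne_top_of_le_ne_top (ENNReal.mul_ne_top (by norm_num)
      (lintegral_sq_ne_top (hθ.memLp_val.restrict _)))
      (τ.lintegral_osc_le P.isOpen.measurableSet hθ.meas_val)

/-- The functional `θ ↦ ∫ f θ - s(p, θ)` in terms of the time oscillation of `θ`. -/
theorem abs_residual_le (hW : WeightBound (T := P.T) 𝒯 κt h Γ C)
    (hF : P.wnorm κt P.f ≠ ∞) {p : STPt d → ℝ} (hp : p ∈ P.Vaux κt 𝒯 τ)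
    (hs : ∀ q, P.s κt p (P.ψ κt 𝒯 τ q) = ∫ z in P.Q, P.f z * P.ψ κt 𝒯 τ q z)
    {Φ : ℝ} (hΦ0 : 0 ≤ Φ) (hΦ : ∑ n, ∑ i, (ENNReal.ofReal (h i ^ 2))⁻¹ *
        ∫⁻ z in τ.openInterval n ×ˢ 𝒯.cell i, ‖scaled κt P.f z‖ₑ ^ 2 ≤ ENNReal.ofReal (Φ ^ 2))
    {θ : STPt d → ℝ} {g : STPt d → Pt d} (hH : 0 ≤ 𝒯.H) (hθ : H10 P.T P.Ω θ g) :
    |(∫ z in P.Q, P.f z * θ z) - P.s κt p θ| ≤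
      √(C * (poincareConst d Γ + 2)) * (Φ * (𝒯.H * l2 (volume.restrict P.Q) g +
        l2 (volume.restrict P.Q) (τ.osc θ))) := by
  have hΩ := P.isOpen.measurableSet
  choose c hc using fun n i => hθ.exists_lintegral_weight_le τ hΩ P.isBounded hW n i
  have hA := poincareConst_nonneg (d := d) (Γ := Γ)
  have hC := hW.nonneg_const
  have hg2 := hθ.memLp_grad.restrict (s := P.Q)
  have ho2 := memLp_osc τ hθ
  have h1 := P.enorm_residual_sq_le 𝒯 τ hW.aemeas hW.nonneg (memLp_sqrt_weight τ hW)
    (wnorm_ne_top_iff.1 hF) hp hs (θ := θ) (by simpa using memLp_sqrt_weight_mul τ hW hθ 0) hW.pos c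
  set C₂ := C * (poincareConst d Γ + 2) with hC₂
  have hC₂0 : 0 ≤ C₂ := by positivity
  set a := l2 (volume.restrict P.Q) g
  set b := l2 (volume.restrict P.Q) (τ.osc θ)
  have ha : 0 ≤ a := l2_nonneg _
  have hb : 0 ≤ b := l2_nonneg _
  refine abs_le_of_enorm_sq_le (by positivity) (h1.trans ?_)
  calc _ ≤ ENNReal.ofReal (Φ ^ 2) * ∑ n, ∑ i, (ENNReal.ofReal C₂ *
        (ENNReal.ofReal (𝒯.H ^ 2) * (∫⁻ z in τ.openInterval n ×ˢ 𝒯.cell i, ‖g z‖ₑ ^ 2) +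
          ∫⁻ z in τ.openInterval n ×ˢ 𝒯.cell i, ‖τ.osc θ z‖ₑ ^ 2)) := by
        exact mul_le_mul' hΦ (Finset.sum_le_sum fun n _ => Finset.sum_le_sum fun i _ => hc n i)
    _ = ENNReal.ofReal (Φ ^ 2) * (ENNReal.ofReal C₂ *
        (ENNReal.ofReal (𝒯.H ^ 2) * (∫⁻ z in P.Q, ‖g z‖ₑ ^ 2) + ∫⁻ z in P.Q, ‖τ.osc θ z‖ₑ ^ 2)) := by
        rw [P.lintegral_cells 𝒯 τ, P.lintegral_cells 𝒯 τ]
        simp only [Finset.mul_sum, mul_add, Finset.sum_add_distrib]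
    _ = ENNReal.ofReal (Φ ^ 2 * (C₂ * (𝒯.H ^ 2 * a ^ 2 + b ^ 2))) := by
        rw [← l2_sq hg2, ← l2_sq ho2, ← ENNReal.ofReal_mul (by positivity),
          ← ENNReal.ofReal_add (by positivity) (by positivity), ← ENNReal.ofReal_mul hC₂0,
          ← ENNReal.ofReal_mul (by positivity)]
    _ ≤ _ := by
        refine ENNReal.ofReal_le_ofReal ?_
        rw [mul_pow, mul_pow, Real.sq_sqrt hC₂0]
        have : 𝒯.H ^ 2 * a ^ 2 + b ^ 2 ≤ (𝒯.H * a + b) ^ 2 := by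
          nlinarith [mul_nonneg (mul_nonneg hH ha) hb]
        calc _ = C₂ * Φ ^ 2 * (𝒯.H ^ 2 * a ^ 2 + b ^ 2) := by ring
          _ ≤ C₂ * Φ ^ 2 * (𝒯.H * a + b) ^ 2 := by gcongr
          _ = _ := by ring

/-- The functional `θ ↦ ∫ f θ - s(p, θ)` in terms of the time derivative of `θ`. -/
theorem abs_residual_le_of_dt_le (hW : WeightBound (T := P.T) 𝒯 κt h Γ C)
    (hF : P.wnorm κt P.f ≠ ∞) {p : STPt d → ℝ} (hp : p ∈ P.Vaux κt 𝒯 τ)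
    (hs : ∀ q, P.s κt p (P.ψ κt 𝒯 τ q) = ∫ z in P.Q, P.f z * P.ψ κt 𝒯 τ q z)
    {M : ℝ} (hM : ∀ i, τ.dt ≤ M * h i ^ 2) (hM0 : 0 ≤ M) {θ : STFun d} (hθ : H11 P.T P.Ω θ)
    (hθE : P.wnorm κt θ.dt ≠ ∞) :
    |(∫ z in P.Q, P.f z * θ.val z) - P.s κt p θ.val| ≤
      √(C * (poincareConst d Γ + 1) + 2 * C ^ 2 * M ^ 2) *
      (l2 (volume.restrict P.Q) (scaled κt P.f) * (l2 (volume.restrict P.Q) θ.grad +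
        l2 (volume.restrict P.Q) (scaled κt θ.dt))) := by
  have hΩ := P.isOpen.measurableSet
  choose c hc using fun n i => hθ.exists_lintegral_weight_le τ hΩ P.isBounded hW
    (wnorm_ne_top_iff.1 hθE) hM hM0 n i
  have hA := poincareConst_nonneg (d := d) (Γ := Γ)
  have hC := hW.nonneg_const
  have hg2 := hθ.memLp_grad.restrict (s := P.Q)
  have ho2 : MemLp (scaled κt θ.dt) 2 (volume.restrict P.Q) :=
    memLp_scaled hW.aemeas hθ.meas_dt.aemeasurable (wnorm_ne_top_iff.1 hθE)
  have hf2 : MemLp (scaled κt P.f) 2 (volume.restrict P.Q) :=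
    memLp_scaled hW.aemeas P.memLp_f.1.aemeasurable (wnorm_ne_top_iff.1 hF)
  -- The choice h = 1 distributes no mesh size: here the oscillation is already bounded by the
  -- energy and f appears without h⁻¹.
  have h1 := P.enorm_residual_sq_le 𝒯 τ hW.aemeas hW.nonneg (memLp_sqrt_weight τ hW)
    (wnorm_ne_top_iff.1 hF) hp hs (θ := θ.val)
    (by simpa using memLp_sqrt_weight_mul τ hW hθ.toH10 0) (h := fun _ => 1) (fun _ => one_pos) c
  set C₂ := C * (poincareConst d Γ + 1) + 2 * C ^ 2 * M ^ 2 with hC₂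
  have hC₂0 : 0 ≤ C₂ := by positivity
  have ha : 0 ≤ l2 (volume.restrict P.Q) θ.grad := l2_nonneg _
  have hb : 0 ≤ l2 (volume.restrict P.Q) (scaled κt θ.dt) := l2_nonneg _
  have hf : 0 ≤ l2 (volume.restrict P.Q) (scaled κt P.f) := l2_nonneg _
  refine abs_le_of_enorm_sq_le (by positivity) (h1.trans ?_)
  simp only [one_pow, ENNReal.ofReal_one, inv_one, one_mul]
  rw [← P.lintegral_cells 𝒯 τ]
  calc _ ≤ (∫⁻ z in P.Q, ‖scaled κt P.f z‖ₑ ^ 2) * ∑ n, ∑ i, (ENNReal.ofReal C₂ *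
        ((∫⁻ z in τ.openInterval n ×ˢ 𝒯.cell i, ‖θ.grad z‖ₑ ^ 2) +
          ∫⁻ z in τ.openInterval n ×ˢ 𝒯.cell i, ‖scaled κt θ.dt z‖ₑ ^ 2)) := by
        gcongr with n _ i _
        exact hc n i
    _ = (∫⁻ z in P.Q, ‖scaled κt P.f z‖ₑ ^ 2) * (ENNReal.ofReal C₂ *
        ((∫⁻ z in P.Q, ‖θ.grad z‖ₑ ^ 2) + ∫⁻ z in P.Q, ‖scaled κt θ.dt z‖ₑ ^ 2)) := by
        rw [P.lintegral_cells 𝒯 τ (fun z => ‖θ.grad z‖ₑ ^ 2),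
          P.lintegral_cells 𝒯 τ (fun z => ‖scaled κt θ.dt z‖ₑ ^ 2)]
        simp only [Finset.mul_sum, mul_add, Finset.sum_add_distrib]
    _ = ENNReal.ofReal (l2 (volume.restrict P.Q) (scaled κt P.f) ^ 2 * (C₂ *
          (l2 (volume.restrict P.Q) θ.grad ^ 2 + l2 (volume.restrict P.Q) (scaled κt θ.dt) ^ 2))) := by
        rw [ENNReal.ofReal_mul (sq_nonneg _), ENNReal.ofReal_mul hC₂0,
          ENNReal.ofReal_add (sq_nonneg _) (sq_nonneg _), l2_sq hg2, l2_sq hf2, l2_sq ho2]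
    _ ≤ _ := by
        refine ENNReal.ofReal_le_ofReal ?_
        generalize l2 (volume.restrict P.Q) θ.grad = a at *
        generalize l2 (volume.restrict P.Q) (scaled κt θ.dt) = b at *
        generalize l2 (volume.restrict P.Q) (scaled κt P.f) = F at *
        rw [mul_pow, mul_pow, Real.sq_sqrt hC₂0]
        have : a ^ 2 + b ^ 2 ≤ (a + b) ^ 2 := by nlinarith
        calc _ = C₂ * F ^ 2 * (a ^ 2 + b ^ 2) := by ring
          _ ≤ C₂ * F ^ 2 * (a + b) ^ 2 := by gcongr
          _ = _ := by ring

variable (P) in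
/-- The energy norm of the spatial gradient. -/
def gradNorm (g : STPt d → Pt d) : ℝ := l2 (volume.restrict P.Q) fun z => √(P.κ z) • g z

theorem κ_nonneg (hκ₀ : 0 < κ₀) {z : STPt d} (hz : z ∈ P.Q) : 0 ≤ P.κ z :=
  hκ₀.le.trans (P.κ_mem z hz).1

theorem lintegral_gradNorm (hκ₀ : 0 < κ₀) (g : STPt d → Pt d) :
    ∫⁻ z in P.Q, ‖√(P.κ z) • g z‖ₑ ^ 2 = ∫⁻ z in P.Q, ENNReal.ofReal (P.κ z) * ‖g z‖ₑ ^ 2 :=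
  setLIntegral_congr_fun P.measurableSet_Q fun _ hz => enorm_sqrt_smul_sq (κ_nonneg hκ₀ hz) _

theorem memLp_sqrt_smul (hκ₀ : 0 < κ₀) {g : STPt d → Pt d} (hg : MemLp g 2 (volume.restrict P.Q)) :
    MemLp (fun z => √(P.κ z) • g z) 2 (volume.restrict P.Q) := by
  have hκ : AEMeasurable P.κ (volume.restrict P.Q) := P.aemeasurable_κ
  have hm : AEMeasurable (fun z => √(P.κ z)) (volume.restrict P.Q) := by fun_prop
  have hsm : AEStronglyMeasurable (fun z => √(P.κ z) • g z) (volume.restrict P.Q) :=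
    hm.aestronglyMeasurable.smul hg.1
  rw [memLp_two_iff hsm, lintegral_gradNorm hκ₀]
  refine ne_top_of_le_ne_top (ENNReal.mul_ne_top (a := ENNReal.ofReal κ₁) ENNReal.ofReal_ne_top
    (lintegral_sq_ne_top hg)) ?_
  rw [← lintegral_const_mul' _ _ ENNReal.ofReal_ne_top]
  refine setLIntegral_mono' P.measurableSet_Q fun z hz => ?_
  gcongr
  exact (P.κ_mem z hz).2

theorem gradNorm_le (hκ₀ : 0 < κ₀) {g : STPt d → Pt d} (hg : MemLp g 2 (volume.restrict P.Q)) :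
    P.gradNorm g ≤ √κ₁ * l2 (volume.restrict P.Q) g := by
  rcases P.Q.eq_empty_or_nonempty with h0 | ⟨z, hz⟩
  · simp [gradNorm, l2, h0]
  have hκ₁ : 0 ≤ κ₁ := (κ_nonneg hκ₀ hz).trans (P.κ_mem z hz).2
  refine l2_le_mul (Real.sqrt_nonneg _) hg ?_
  rw [lintegral_gradNorm hκ₀, Real.sq_sqrt hκ₁, ← lintegral_const_mul' _ _ ENNReal.ofReal_ne_top]
  refine setLIntegral_mono' P.measurableSet_Q fun z hz => ?_
  gcongr
  exact (P.κ_mem z hz).2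

theorem l2_grad_le (hκ₀ : 0 < κ₀) {g : STPt d → Pt d} (hg : MemLp g 2 (volume.restrict P.Q)) :
    l2 (volume.restrict P.Q) g ≤ (√κ₀)⁻¹ * P.gradNorm g := by
  refine l2_le_mul (by positivity) (memLp_sqrt_smul hκ₀ hg) ?_
  rw [lintegral_gradNorm hκ₀, inv_pow, Real.sq_sqrt hκ₀.le,
    ← lintegral_const_mul' _ _ ENNReal.ofReal_ne_top]
  refine setLIntegral_mono' P.measurableSet_Q fun z hz => ?_
  rw [← mul_assoc, ← ENNReal.ofReal_mul (by positivity)]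
  refine le_mul_of_one_le_left (zero_le) ?_
  rw [ENNReal.one_le_ofReal, ← div_eq_inv_mul, one_le_div hκ₀]
  exact (P.κ_mem z hz).1

theorem abs_integral_inner_le (hκ₀ : 0 < κ₀) {g g' : STPt d → Pt d}
    (hg : MemLp g 2 (volume.restrict P.Q)) (hg' : MemLp g' 2 (volume.restrict P.Q)) :
    |∫ z in P.Q, P.κ z * ⟪g z, g' z⟫| ≤ P.gradNorm g * P.gradNorm g' := by
  refine abs_integral_le_l2_mul (memLp_sqrt_smul hκ₀ hg) (memLp_sqrt_smul hκ₀ hg') ?_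
  rw [ae_restrict_iff' P.measurableSet_Q]
  refine Filter.Eventually.of_forall fun z hz => ?_
  rw [← enorm_norm (_ • g z), ← enorm_norm (_ • g' z), ← enorm_mul, enorm_le_iff_norm_le]
  have h0 := κ_nonneg hκ₀ hz
  have h1 : ‖P.κ z * ⟪g z, g' z⟫‖ = P.κ z * |⟪g z, g' z⟫| := by
    rw [norm_mul, Real.norm_of_nonneg h0, Real.norm_eq_abs]
  rw [h1, norm_mul, norm_norm, norm_norm, norm_smul, norm_smul, Real.norm_of_nonneg (Real.sqrt_nonneg _)]
  calc P.κ z * |⟪g z, g' z⟫| ≤ P.κ z * (‖g z‖ * ‖g' z‖) := by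
        gcongr; exact abs_real_inner_le_norm _ _
    _ = (√(P.κ z) * √(P.κ z)) * (‖g z‖ * ‖g' z‖) := by rw [Real.mul_self_sqrt h0]
    _ = _ := by ring

theorem integrable_κ_inner (hκ₀ : 0 < κ₀) {g g' : STPt d → Pt d}
    (hg : MemLp g 2 (volume.restrict P.Q)) (hg' : MemLp g' 2 (volume.restrict P.Q)) :
    Integrable (fun z => P.κ z * ⟪g z, g' z⟫) (volume.restrict P.Q) := by
  refine (integrable_inner_of_memLp (memLp_sqrt_smul hκ₀ hg) (memLp_sqrt_smul hκ₀ hg')).congr ?_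
  filter_upwards [ae_restrict_mem P.measurableSet_Q] with z hz
  rw [inner_smul_left, inner_smul_right, ← mul_assoc, RCLike.conj_to_real,
    Real.mul_self_sqrt (κ_nonneg hκ₀ hz)]

theorem integral_κ_inner_self (hκ₀ : 0 < κ₀) {g : STPt d → Pt d}
    (hg : MemLp g 2 (volume.restrict P.Q)) :
    ∫ z in P.Q, P.κ z * ⟪g z, g z⟫ = P.gradNorm g ^ 2 := by
  have h0 : 0 ≤ ∫ z in P.Q, P.κ z * ⟪g z, g z⟫ := by
    refine setIntegral_nonneg P.measurableSet_Q fun z hz => ?_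
    exact mul_nonneg (κ_nonneg hκ₀ hz) real_inner_self_nonneg
  rw [← ENNReal.ofReal_eq_ofReal_iff h0 (sq_nonneg _), gradNorm, l2_sq (memLp_sqrt_smul hκ₀ hg),
    lintegral_gradNorm hκ₀, ofReal_integral_eq_lintegral_ofReal (integrable_κ_inner hκ₀ hg hg)]
  · refine setLIntegral_congr_fun P.measurableSet_Q fun z hz => ?_
    simp only [real_inner_self_eq_norm_sq]
    rw [ENNReal.ofReal_mul (κ_nonneg hκ₀ hz), ofReal_norm_sq]
  · filter_upwards [ae_restrict_mem P.measurableSet_Q] with z hz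
    exact mul_nonneg (κ_nonneg hκ₀ hz) real_inner_self_nonneg

theorem integral_mul_self_eq {μ : Measure (STPt d)} {g : STPt d → ℝ} (hg : MemLp g 2 μ) :
    ∫ z, g z * g z ∂μ = l2 μ g ^ 2 := by
  have h0 : 0 ≤ ∫ z, g z * g z ∂μ := integral_nonneg fun z => mul_self_nonneg _
  rw [← ENNReal.ofReal_eq_ofReal_iff h0 (sq_nonneg _), l2_sq hg,
    ofReal_integral_eq_lintegral_ofReal (memLp_two_mul hg hg)
      (Filter.Eventually.of_forall fun z => mul_self_nonneg _)]
  refine lintegral_congr fun z => ?_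
  rw [← ofReal_norm_sq, Real.norm_eq_abs, sq_abs, sq]

end Problem

theorem ofReal_sq_eq (x : ℝ) : ENNReal.ofReal (x ^ 2) = ‖x‖ₑ ^ 2 := by
  rw [← ofReal_norm_sq, Real.norm_eq_abs, sq_abs]

theorem TimeMesh.dt_nonneg {T : ℝ} (τ : TimeMesh T) : 0 ≤ τ.dt :=
  Real.iSup_nonneg fun n => (τ.step_pos n).le

theorem TimeMesh.Comparable.congr {T : ℝ} {τ : TimeMesh T} {Ω : Set (Pt d)} (hΩ : MeasurableSet Ω)
    {κ ρ : STPt d → ℝ} {M : ℝ} (hc : τ.Comparable Ω κ M)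
    (h : κ =ᵐ[volume.restrict (cyl T Ω)] ρ) : τ.Comparable Ω ρ M := by
  intro n
  have hT : ∀ᵐ t : ℝ, t ≠ T := (finite_singleton T).countable.ae_notMem _
  have hm : MeasurableSet (τ.interval n) := measurableSet_Ioc
  rw [Filter.EventuallyEq, ae_restrict_iff' (measurableSet_cyl hΩ)] at h
  filter_upwards [hc n, ae_restrict_of_ae (ae_space_time h), ae_restrict_mem hΩ] with x hx1 hx2 hxΩ
  have h1 : ∀ᵐ t ∂volume.restrict (τ.interval n), κ (t, x) = ρ (t, x) := by
    rw [ae_restrict_iff' hm]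
    filter_upwards [hx2, hT] with t ht htT htn
    exact ht ⟨⟨(τ.t_nonneg _).trans_lt htn.1, lt_of_le_of_ne (htn.2.trans (τ.t_le _)) htT⟩, hxΩ⟩
  filter_upwards [hx1, h1] with t ht1 ht2
  filter_upwards [ht1, h1] with s hs1 hs2
  rw [← ht2, ← hs2]
  exact hs1

/-! ### The equation for the error and its two energy estimates. -/

namespace Problem
variable {κ₀ κ₁ : ℝ} {P : Problem d κ₀ κ₁} {𝒯 : SpaceMesh d P.Ω} {τ : TimeMesh P.T}
  {κt : STPt d → ℝ} {h : Fin 𝒯.numCells → ℝ} {Γ C : ℝ}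

theorem wnorm_congr {ρ g g' : STPt d → ℝ} (hg : g =ᵐ[volume.restrict P.Q] g') :
    P.wnorm ρ g = P.wnorm ρ g' := by
  unfold wnorm
  congr 1
  refine lintegral_congr_ae ?_
  filter_upwards [hg] with z hz
  rw [hz]

theorem wnorm_sub_ne_top {ρ g g' : STPt d → ℝ} (hρ : AEMeasurable ρ (volume.restrict P.Q))
    (hgm : AEMeasurable g (volume.restrict P.Q))
    (hg : P.wnorm ρ g ≠ ∞) (hg' : P.wnorm ρ g' ≠ ∞) : P.wnorm ρ (g - g') ≠ ∞ := by
  rw [wnorm_ne_top_iff] at *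
  refine ne_top_of_le_ne_top (ENNReal.add_ne_top.2 ⟨ENNReal.mul_ne_top ENNReal.ofNat_ne_top hg,
    ENNReal.mul_ne_top ENNReal.ofNat_ne_top hg'⟩) (b := 2 * _ + 2 * _) ?_
  rw [← lintegral_const_mul' _ _ ENNReal.ofNat_ne_top, ← lintegral_const_mul' _ _ ENNReal.ofNat_ne_top,
    ← lintegral_add_left' (by fun_prop)]
  refine lintegral_mono fun z => ?_
  simp only [Pi.sub_apply, ofReal_sq_eq]
  calc _ ≤ (ENNReal.ofReal (ρ z))⁻¹ * (2 * ‖g z‖ₑ ^ 2 + 2 * ‖g' z‖ₑ ^ 2) := by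
        gcongr; exact enorm_sub_sq_le _ _
    _ = _ := by ring

/-- For finite weighted norms the product is integrable, so the sum over the coarse intervals is one
integral over the cylinder and can be treated as an inner product in L². -/
theorem e_eq (hρm : AEMeasurable κt (volume.restrict P.Q)) (hρ0 : ∀ z ∈ P.Q, 0 ≤ κt z)
    {v w : STFun d} (hv : AEMeasurable v.dt (volume.restrict P.Q))
    (hw : AEMeasurable w.dt (volume.restrict P.Q)) (hvE : P.wnorm κt v.dt ≠ ∞)
    (hwE : P.wnorm κt w.dt ≠ ∞) :
    P.e κt τ v w = ∫ z in P.Q, scaled κt v.dt z * scaled κt w.dt z := by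
  have i1 : IntegrableOn (fun z => scaled κt v.dt z * scaled κt w.dt z) P.Q :=
    memLp_two_mul (memLp_scaled hρm hv (wnorm_ne_top_iff.1 hvE))
      (memLp_scaled hρm hw (wnorm_ne_top_iff.1 hwE))
  have i2 : IntegrableOn (fun z => (κt z)⁻¹ * v.dt z * w.dt z) P.Q := by
    refine i1.congr_fun (fun z hz => ?_) P.measurableSet_Q
    exact scaled_mul_scaled (hρ0 z hz)
  have h1 := τ.integral_cyl P.isOpen.measurableSet i2
  rw [e, ← h1]
  exact setIntegral_congr_fun P.measurableSet_Q fun z hz => (scaled_mul_scaled (hρ0 z hz)).symm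

/-- Finiteness of ‖κ̃^{-1/2}∂ₜu‖ puts the error into V₀, so a representative of it may be its own
test function. The equation for u is tested with the same θ; as it contains no e-term, e(u,θ)
remains on the right. -/
theorem exists_error (hκ₀ : 0 < κ₀) (hρm : AEMeasurable κt (volume.restrict P.Q))
    (hρ0 : ∀ z ∈ P.Q, 0 ≤ κt z) {u v : STFun d} {p : STPt d → ℝ} {S : Set (STFun d)}
    {U : AuxIndex P 𝒯 τ → ℝ} (hu : P.IsWeakSolution u)
    (hv : P.IsGlobalDownscale κt 𝒯 τ S U v p) (hS : P.V₀ κt ⊆ S) (hE : P.wnorm κt u.dt ≠ ∞) :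
    ∃ w : STFun d, H11 P.T P.Ω w ∧ P.wnorm κt w.dt ≠ ∞ ∧
      P.normV κt (u - v) = ENNReal.ofReal
        √(P.gradNorm w.grad ^ 2 + l2 (volume.restrict P.Q) (scaled κt w.dt) ^ 2) ∧
      ∀ θ : STFun d, H11 P.T P.Ω θ → P.wnorm κt θ.dt ≠ ∞ →
        (∫ z in P.Q, w.dt z * θ.val z) + (∫ z in P.Q, P.κ z * ⟪w.grad z, θ.grad z⟫) +
          (∫ z in P.Q, scaled κt w.dt z * scaled κt θ.dt z) =
        ((∫ z in P.Q, P.f z * θ.val z) - P.s κt p θ.val) +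
          ∫ z in P.Q, scaled κt u.dt z * scaled κt θ.dt z := by
  obtain ⟨w, hw, -, hwg, hwt⟩ := (hu.mem.sub P.isBounded hv.mem_V₀.1).exists_H11 P.T_pos P.isOpen
    P.isBounded
  have hΩ := P.isOpen.measurableSet
  have hwg' : ∀ᵐ z ∂volume.restrict P.Q, u.grad z - v.grad z = w.grad z := hwg
  have hwt' : ∀ᵐ z ∂volume.restrict P.Q, u.dt z - v.dt z = w.dt z := hwt
  have hum : MemLp u.dt 2 (volume.restrict P.Q) := hu.mem.memLp_dt
  have hvm : MemLp v.dt 2 (volume.restrict P.Q) := hv.mem_V₀.1.memLp_dt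
  have hug : MemLp u.grad 2 (volume.restrict P.Q) := hu.mem.memH10.memLp_grad
  have hvg : MemLp v.grad 2 (volume.restrict P.Q) := hv.mem_V₀.1.memH10.memLp_grad
  have hvE : P.wnorm κt v.dt ≠ ∞ := hv.mem_V₀.2.ne
  have hwE : P.wnorm κt w.dt ≠ ∞ := by
    rw [← wnorm_congr (show (u.dt - v.dt) =ᵐ[volume.restrict P.Q] w.dt from hwt)]
    exact wnorm_sub_ne_top hρm hum.1.aemeasurable hE hvE
  have hwm : AEMeasurable w.dt (volume.restrict P.Q) := hw.meas_dt.aemeasurable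
  refine ⟨w, hw, hwE, ?_, fun θ hθ hθE => ?_⟩
  · refine rpow_half_eq (Real.sqrt_nonneg _) ?_
    rw [Real.sq_sqrt (by positivity), ENNReal.ofReal_add (sq_nonneg _) (sq_nonneg _), gradNorm,
      l2_sq (memLp_sqrt_smul hκ₀ (hw.memLp_grad.restrict _)),
      l2_sq (memLp_scaled hρm hwm (wnorm_ne_top_iff.1 hwE)),
      lintegral_scaled hρm hwm (wnorm_ne_top_iff.1 hwE), lintegral_gradNorm hκ₀]
    congr 1
    · refine lintegral_congr_ae ?_
      filter_upwards [hwg', ae_restrict_mem P.measurableSet_Q] with z hz hzQ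
      rw [← hz, ENNReal.ofReal_mul (κ_nonneg hκ₀ hzQ), ofReal_norm_sq]
      rfl
    · refine lintegral_congr_ae ?_
      filter_upwards [hwt'] with z hz
      rw [← hz]
      rfl
  · have hθm : MemLp θ.val 2 (volume.restrict P.Q) := hθ.memLp_val.restrict _
    have hθg : MemLp θ.grad 2 (volume.restrict P.Q) := hθ.memLp_grad.restrict _
    have hθt : AEMeasurable θ.dt (volume.restrict P.Q) := hθ.meas_dt.aemeasurable
    have e1 := hu.eq θ.val θ.grad (hθ.toH10.memH10Zero hΩ P.isBounded)
    have e2 := hv.eq_d θ (hS ⟨hθ.memH11ZeroZero P.isOpen P.isBounded, hθE.lt_top⟩)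
    rw [dform, e_eq hρm hρ0 hvm.1.aemeasurable hθt hvE hθE, b, a] at e2
    have e3 : ∫ z in P.Q, w.dt z * θ.val z =
        (∫ z in P.Q, u.dt z * θ.val z) - ∫ z in P.Q, v.dt z * θ.val z := by
      rw [← integral_sub (memLp_two_mul hum hθm) (memLp_two_mul hvm hθm)]
      refine integral_congr_ae ?_
      filter_upwards [hwt'] with z hz
      rw [← hz]; ring
    have e4 : ∫ z in P.Q, P.κ z * ⟪w.grad z, θ.grad z⟫ =
        (∫ z in P.Q, P.κ z * ⟪u.grad z, θ.grad z⟫) - ∫ z in P.Q, P.κ z * ⟪v.grad z, θ.grad z⟫ := by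
      rw [← integral_sub (integrable_κ_inner hκ₀ hug hθg) (integrable_κ_inner hκ₀ hvg hθg)]
      refine integral_congr_ae ?_
      filter_upwards [hwg'] with z hz
      rw [← hz, inner_sub_left]; ring
    have hθs := memLp_scaled hρm hθt (wnorm_ne_top_iff.1 hθE)
    have e5 : ∫ z in P.Q, scaled κt w.dt z * scaled κt θ.dt z =
        (∫ z in P.Q, scaled κt u.dt z * scaled κt θ.dt z) -
          ∫ z in P.Q, scaled κt v.dt z * scaled κt θ.dt z := by
      rw [← integral_sub
        (memLp_two_mul (memLp_scaled hρm hum.1.aemeasurable (wnorm_ne_top_iff.1 hE)) hθs)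
        (memLp_two_mul (memLp_scaled hρm hvm.1.aemeasurable (wnorm_ne_top_iff.1 hvE)) hθs)]
      refine integral_congr_ae ?_
      filter_upwards [hwt'] with z hz
      simp only [scaled, ← hz]; ring
    linarith

/-- The error estimate for short time steps. -/
theorem error_le_of_dt_le (hκ₀ : 0 < κ₀) (hW : WeightBound (T := P.T) 𝒯 κt h Γ C) {u v : STFun d}
    {S : Set (STFun d)} (hu : P.IsWeakSolution u) (hv : P.IsGlobalSolution κt 𝒯 τ S v)
    (hS : P.V₀ κt ⊆ S) (hE : P.wnorm κt u.dt ≠ ∞) (hF : P.wnorm κt P.f ≠ ∞)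
    {M : ℝ} (hM : ∀ i, τ.dt ≤ M * h i ^ 2) (hM0 : 0 ≤ M) :
    P.normV κt (u - v) ≤ ENNReal.ofReal (√(C * (poincareConst d Γ + 1) + 2 * C ^ 2 * M ^ 2) *
      ((√κ₀)⁻¹ + 1)) * P.wnorm κt P.f + P.wnorm κt u.dt := by
  obtain ⟨U, p, hv, hp⟩ := hv
  have hΩ := P.isOpen.measurableSet
  obtain ⟨w, hw, hwE, hN, heq⟩ := exists_error hκ₀ hW.aemeas hW.nonneg hu hv hS hE
  have hum : AEMeasurable u.dt (volume.restrict P.Q) := hu.mem.memLp_dt.1.aemeasurable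
  have hwm : AEMeasurable w.dt (volume.restrict P.Q) := hw.meas_dt.aemeasurable
  have hus := memLp_scaled hW.aemeas hum (wnorm_ne_top_iff.1 hE)
  have hws := memLp_scaled hW.aemeas hwm (wnorm_ne_top_iff.1 hwE)
  have hwg : MemLp w.grad 2 (volume.restrict P.Q) := hw.memLp_grad.restrict _
  -- The error itself is the only test function in this regime.
  have h1 := heq w hw hwE
  have h2 := abs_residual_le_of_dt_le hW hF hv.mem_Vaux hp hM hM0 hw hwE
  have h3 : |∫ z in P.Q, scaled κt u.dt z * scaled κt w.dt z| ≤ _ :=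
    abs_integral_le_l2_mul hus hws (Filter.Eventually.of_forall fun z => (enorm_mul _ _).le)
  have h4 := l2_grad_le hκ₀ hwg
  have h5 : 0 ≤ ∫ z in P.Q, w.dt z * w.val z := hw.integral_dt_mul_nonneg P.T_pos hΩ P.isBounded
  have h6 : ∫ z in P.Q, scaled κt w.dt z * scaled κt w.dt z = _ := integral_mul_self_eq hws
  rw [integral_κ_inner_self hκ₀ hwg, h6] at h1
  rw [hN, wnorm_eq hW.aemeas P.memLp_f.1.aemeasurable hF, wnorm_eq hW.aemeas hum hE,
    ← ENNReal.ofReal_mul (by positivity), ← ENNReal.ofReal_add (mul_nonneg (by positivity)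
      (l2_nonneg _)) (l2_nonneg _)]
  refine ENNReal.ofReal_le_ofReal ?_
  have hg0 : 0 ≤ P.gradNorm w.grad := l2_nonneg _
  have hD0 : 0 ≤ l2 (volume.restrict P.Q) (scaled κt w.dt) := l2_nonneg _
  have hF0 : 0 ≤ l2 (volume.restrict P.Q) (scaled κt P.f) := l2_nonneg _
  have hE0 : 0 ≤ l2 (volume.restrict P.Q) (scaled κt u.dt) := l2_nonneg _
  have hk : 0 ≤ (√κ₀)⁻¹ := by positivity
  have hc0 := Real.sqrt_nonneg (C * (poincareConst d Γ + 1) + 2 * C ^ 2 * M ^ 2)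
  have h7 := le_abs_self ((∫ z in P.Q, P.f z * w.val z) - P.s κt p w.val)
  have h8 := le_abs_self (∫ z in P.Q, scaled κt u.dt z * scaled κt w.dt z)
  change |∫ z in P.Q, scaled κt u.dt z * scaled κt w.dt z| ≤
    l2 (volume.restrict P.Q) (scaled κt u.dt) * l2 (volume.restrict P.Q) (scaled κt w.dt) at h3
  generalize l2 (volume.restrict P.Q) w.grad = g' at *
  generalize P.gradNorm w.grad = g at *
  generalize l2 (volume.restrict P.Q) (scaled κt w.dt) = D at *
  generalize l2 (volume.restrict P.Q) (scaled κt P.f) = F at *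
  generalize l2 (volume.restrict P.Q) (scaled κt u.dt) = E at *
  generalize √(C * (poincareConst d Γ + 1) + 2 * C ^ 2 * M ^ 2) = c at *
  set N := √(g ^ 2 + D ^ 2) with hNd
  have hN0 : 0 ≤ N := Real.sqrt_nonneg _
  have hN2 : N ^ 2 = g ^ 2 + D ^ 2 := Real.sq_sqrt (by positivity)
  have hgN : g ≤ N := Real.le_sqrt_of_sq_le (by nlinarith)
  have hDN : D ≤ N := Real.le_sqrt_of_sq_le (by nlinarith)
  have h9 : c * (F * (g' + D)) ≤ c * (F * ((√κ₀)⁻¹ * N + N)) := by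
    have : (√κ₀)⁻¹ * g ≤ (√κ₀)⁻¹ * N := by gcongr
    gcongr
    linarith
  have h10 : E * D ≤ E * N := by gcongr
  -- The term ∫ ∂ₜw w is nonnegative, because w(0) = 0, and is dropped.
  have h11 : N ^ 2 ≤ (c * ((√κ₀)⁻¹ + 1) * F + E) * N := by
    rw [hN2]
    nlinarith
  rcases hN0.eq_or_lt with h0 | h0
  · rw [← h0]; positivity
  · nlinarith

/-- The constant of the error estimate for comparable weights. -/
def errorConst (κ₀ κ₁ M c : ℝ) : ℝ :=
  1 + 2 * (√κ₁ * (√κ₀)⁻¹) + √M + 2 * c * ((√κ₀)⁻¹ + 1)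

theorem wnorm_oscPrim (hρm : AEMeasurable κt (volume.restrict P.Q)) {w : STFun d}
    (hw : H11 P.T P.Ω w) (hwE : P.wnorm κt w.dt ≠ ∞) {M : ℝ} (hM : 0 < M)
    (hc : τ.Comparable P.Ω κt M) :
    P.wnorm κt (τ.oscPrim P.Ω w).dt ≠ ∞ ∧
      l2 (volume.restrict P.Q) (scaled κt (τ.oscPrim P.Ω w).dt) ≤
        √M * τ.dt * l2 (volume.restrict P.Q) (scaled κt w.dt) := by
  have hΩ := P.isOpen.measurableSet
  have hρ : κt =ᵐ[volume.restrict P.Q] hρm.mk κt := hρm.ae_eq_mk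
  have hW := hw.oscPrim τ hΩ P.isBounded
  have hwm : AEMeasurable w.dt (volume.restrict P.Q) := hw.meas_dt.aemeasurable
  have hWm : AEMeasurable (τ.oscPrim P.Ω w).dt (volume.restrict P.Q) := hW.meas_dt.aemeasurable
  have h1 := hw.lintegral_inv_mul_osc_le τ hΩ P.isBounded hρm.measurable_mk hM (hc.congr hΩ hρ)
  have h2 : ∫⁻ z in P.Q, (ENNReal.ofReal (κt z))⁻¹ * ENNReal.ofReal ((τ.oscPrim P.Ω w).dt z ^ 2) ≤
      ENNReal.ofReal ((√M * τ.dt) ^ 2) *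
        ∫⁻ z in P.Q, (ENNReal.ofReal (κt z))⁻¹ * ENNReal.ofReal (w.dt z ^ 2) := by
    convert h1 using 1
    · refine lintegral_congr_ae ?_
      filter_upwards [hρ, ae_restrict_mem P.measurableSet_Q] with z hz hzQ
      simp only [hz, ofReal_sq_eq, TimeMesh.oscPrim, indicator_of_mem (show z ∈ cyl P.T P.Ω from hzQ)]
    · rw [mul_pow, Real.sq_sqrt hM.le, ENNReal.ofReal_mul hM.le, ENNReal.ofReal_pow τ.dt_nonneg]
      congr 1
      refine lintegral_congr_ae ?_
      filter_upwards [hρ] with z hz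
      rw [hz, ofReal_sq_eq]
  have h3 := wnorm_ne_top_iff.1 hwE
  have h4 := ne_top_of_le_ne_top (ENNReal.mul_ne_top ENNReal.ofReal_ne_top h3) h2
  refine ⟨wnorm_ne_top_iff.2 h4, l2_le_mul (mul_nonneg (Real.sqrt_nonneg _) τ.dt_nonneg)
    (memLp_scaled hρm hwm h3) ?_⟩
  rwa [lintegral_scaled hρm hWm h4, lintegral_scaled hρm hwm h3]

theorem l2_grad_oscPrim_le {w : STFun d} (hw : H11 P.T P.Ω w) :
    l2 (volume.restrict P.Q) (τ.oscPrim P.Ω w).grad ≤ 2 * τ.dt * l2 (volume.restrict P.Q) w.grad := by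
  have hΩ := P.isOpen.measurableSet
  refine l2_le_mul (mul_nonneg zero_le_two τ.dt_nonneg) (hw.memLp_grad.restrict _) ?_
  have h1 := τ.lintegral_prim_osc_le hΩ P.isBounded hw.grad_zero hw.meas_grad hw.memLp_grad
  have h2 := τ.lintegral_osc_le hΩ hw.meas_grad
  calc ∫⁻ z in P.Q, ‖(τ.oscPrim P.Ω w).grad z‖ₑ ^ 2
      = ∫⁻ z in cyl P.T P.Ω, ‖prim ((cyl P.T P.Ω).indicator (τ.osc w.grad)) z‖ₑ ^ 2 :=
        lintegral_indicator_sq hΩ _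
    _ ≤ ENNReal.ofReal τ.dt ^ 2 * (4 * ∫⁻ z in cyl P.T P.Ω, ‖w.grad z‖ₑ ^ 2) :=
        h1.trans (by gcongr)
    _ = _ := by
        rw [mul_pow, ENNReal.ofReal_mul (by norm_num), ENNReal.ofReal_pow τ.dt_nonneg, ← mul_assoc]
        norm_num [mul_comm]
        rfl

/-- Removing means costs a factor 2, and the primitive of the oscillation gains Δt. This lets the
residual of the second test function be expressed by the oscillation of the error. -/
theorem l2_osc_oscPrim_le {w : STFun d} (hw : H11 P.T P.Ω w) :
    l2 (volume.restrict P.Q) (τ.osc (τ.oscPrim P.Ω w).val) ≤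
      2 * τ.dt * l2 (volume.restrict P.Q) (τ.osc w.val) := by
  have hΩ := P.isOpen.measurableSet
  have hW := hw.oscPrim τ hΩ P.isBounded
  refine l2_le_mul (mul_nonneg zero_le_two τ.dt_nonneg) (memLp_osc τ hw.toH10) ?_
  have h1 := τ.lintegral_prim_osc_le hΩ P.isBounded hw.val_zero hw.meas_val hw.memLp_val
  have h2 := τ.lintegral_osc_le hΩ hW.meas_val
  have h3 : ∫⁻ z in cyl P.T P.Ω, ‖(τ.oscPrim P.Ω w).val z‖ₑ ^ 2
      = ∫⁻ z in cyl P.T P.Ω, ‖prim ((cyl P.T P.Ω).indicator (τ.osc w.val)) z‖ₑ ^ 2 :=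
        lintegral_indicator_sq hΩ _
  calc _ ≤ 4 * (ENNReal.ofReal τ.dt ^ 2 * ∫⁻ z in cyl P.T P.Ω, ‖τ.osc w.val z‖ₑ ^ 2) := by
        refine h2.trans ?_
        rw [h3]
        gcongr
    _ = _ := by
        rw [mul_pow, ENNReal.ofReal_mul (by norm_num), ENNReal.ofReal_pow τ.dt_nonneg, ← mul_assoc]
        norm_num
        rfl

/-- The bound of the error from testing with the error itself and with the primitive of its
oscillation. -/
theorem sqrt_le_of_energy_inequalities {g g' D E Y k k1 m c Φ H t nW gW DW oW : ℝ}
    (hg0 : 0 ≤ g) (hD0 : 0 ≤ D) (hE0 : 0 ≤ E) (hY0 : 0 ≤ Y) (hk : 0 ≤ k) (hk1 : 0 ≤ k1)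
    (hM1 : 0 ≤ m) (hC0 : 0 ≤ c) (hΦ0 : 0 ≤ Φ) (hH : 0 ≤ H) (ht : 0 ≤ t)
    (d1 : g' ≤ k * g) (d2 : nW ≤ k1 * gW) (hWg : gW ≤ 2 * t * g') (hWD : DW ≤ m * t * D)
    (hWo : oW ≤ 2 * t * Y)
    (h1 : g ^ 2 + D ^ 2 ≤ c * (Φ * (H * g' + Y)) + E * D)
    (h2 : Y ^ 2 ≤ g * nW + D * DW + c * (Φ * (H * gW + oW)) + E * DW) :
    √(g ^ 2 + D ^ 2) ≤
      20 * (1 + 2 * (k1 * k) + m + 2 * c * (k + 1)) ^ 2 * (Φ * (H + √t)) + E := by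
  have hs2 : √t ^ 2 = t := Real.sq_sqrt ht
  set N := √(g ^ 2 + D ^ 2) with hNd
  have hN0 : 0 ≤ N := Real.sqrt_nonneg _
  have hN2 : N ^ 2 = g ^ 2 + D ^ 2 := Real.sq_sqrt (by positivity)
  have hgN : g ≤ N := Real.le_sqrt_of_sq_le (by nlinarith)
  have hDN : D ≤ N := Real.le_sqrt_of_sq_le (by nlinarith)
  -- A single constant that dominates all coefficients below, as the elementary inequality asks for.
  set K := 1 + 2 * (k1 * k) + m + 2 * c * (k + 1) with hK
  have hk1k : 0 ≤ k1 * k := by positivity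
  have hck : 0 ≤ c * k := by positivity
  have hK1 : 1 ≤ K := by rw [hK]; nlinarith
  have hKm : m ≤ K := by rw [hK]; nlinarith
  have hKs : 2 * (k1 * k) + m ≤ K := by rw [hK]; nlinarith
  have hKc : 2 * c ≤ K := by rw [hK]; nlinarith
  have hKck : 2 * (c * k) ≤ K := by rw [hK]; nlinarith
  have hg' : g' ≤ k * N := d1.trans (by gcongr)
  have hgW : gW ≤ 2 * t * (k * N) := hWg.trans (by gcongr)
  have hHN : 0 ≤ Φ * (H * N) := by positivity
  have hΦY : 0 ≤ Φ * Y := by positivity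
  have hEN : 0 ≤ E * N := by positivity
  refine (le_of_energy_inequalities (s := √t) (Y := Y) (E := E) (Φ := Φ) (H := H) hK1 hN0 hE0 hΦ0
    hH (Real.sqrt_nonneg _) hY0 ?_ ?_).trans_eq (add_comm _ _)
  · have e1 : c * (Φ * (H * g' + Y)) ≤ c * (Φ * (H * (k * N) + Y)) := by gcongr
    have e2 : E * D ≤ E * N := by gcongr
    have e3 : c * k * (Φ * (H * N)) ≤ K * (Φ * (H * N)) := by gcongr; linarith
    have e4 : c * (Φ * Y) ≤ K * (Φ * Y) := by gcongr; linarith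
    rw [hN2]
    linarith
  · rw [hs2]
    have e1 : g * nW ≤ N * (k1 * (2 * t * (k * N))) := by
      calc g * nW ≤ g * (k1 * (2 * t * (k * N))) := by
            gcongr
            exact d2.trans (by gcongr)
        _ ≤ _ := by gcongr
    have e2 : D * DW ≤ N * (m * t * N) := by
      calc D * DW ≤ D * (m * t * N) := by
            gcongr
            exact hWD.trans (by gcongr)
        _ ≤ _ := by gcongr
    have e3 : E * DW ≤ E * (m * t * N) := by
      gcongr
      exact hWD.trans (by gcongr)
    have e4 : c * (Φ * (H * gW + oW)) ≤ c * (Φ * (H * (2 * t * (k * N)) + 2 * t * Y)) := by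
      gcongr
    have e5 : (2 * (k1 * k) + m) * (t * N ^ 2) ≤ K * (t * N ^ 2) := by gcongr
    have e6 : m * (t * (E * N)) ≤ K * (t * (E * N)) := by gcongr
    have e7 : 2 * (c * k) * (t * (Φ * (H * N))) ≤ K * (t * (Φ * (H * N))) := by gcongr
    have e8 : 2 * c * (t * (Φ * Y)) ≤ K * (t * (Φ * Y)) := by gcongr
    linarith

/-- The error estimate for weights of bounded variation in time. -/
theorem error_le_of_comparable (hκ₀ : 0 < κ₀) (hW : WeightBound (T := P.T) 𝒯 κt h Γ C)
    {u v : STFun d} {S : Set (STFun d)} (hu : P.IsWeakSolution u)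
    (hv : P.IsGlobalSolution κt 𝒯 τ S v)
    (hS : P.V₀ κt ⊆ S) (hE : P.wnorm κt u.dt ≠ ∞) (hF : P.wnorm κt P.f ≠ ∞)
    {M : ℝ} (hM : 0 < M) (hc : τ.Comparable P.Ω κt M) (hH : 0 ≤ 𝒯.H)
    {Φ : ℝ} (hΦ0 : 0 ≤ Φ) (hΦ : ∑ n, ∑ i, (ENNReal.ofReal (h i ^ 2))⁻¹ *
        ∫⁻ z in τ.openInterval n ×ˢ 𝒯.cell i, ‖scaled κt P.f z‖ₑ ^ 2 ≤ ENNReal.ofReal (Φ ^ 2)) :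
    P.normV κt (u - v) ≤ ENNReal.ofReal
      (20 * errorConst κ₀ κ₁ M √(C * (poincareConst d Γ + 2)) ^ 2 * (Φ * (𝒯.H + √τ.dt))) +
        P.wnorm κt u.dt := by
  obtain ⟨U, p, hv, hp⟩ := hv
  have hΩ := P.isOpen.measurableSet
  obtain ⟨w, hw, hwE, hN, heq⟩ := exists_error hκ₀ hW.aemeas hW.nonneg hu hv hS hE
  have hW' := hw.oscPrim τ hΩ P.isBounded
  obtain ⟨hWE, hWD⟩ := wnorm_oscPrim hW.aemeas hw hwE hM hc
  have hWg := l2_grad_oscPrim_le (τ := τ) hw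
  have hWo := l2_osc_oscPrim_le (τ := τ) hw
  have hum : AEMeasurable u.dt (volume.restrict P.Q) := hu.mem.memLp_dt.1.aemeasurable
  have hwm : AEMeasurable w.dt (volume.restrict P.Q) := hw.meas_dt.aemeasurable
  have hWm : AEMeasurable (τ.oscPrim P.Ω w).dt (volume.restrict P.Q) := hW'.meas_dt.aemeasurable
  have hus := memLp_scaled hW.aemeas hum (wnorm_ne_top_iff.1 hE)
  have hws := memLp_scaled hW.aemeas hwm (wnorm_ne_top_iff.1 hwE)
  have hWs := memLp_scaled hW.aemeas hWm (wnorm_ne_top_iff.1 hWE)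
  have hwg : MemLp w.grad 2 (volume.restrict P.Q) := hw.memLp_grad.restrict _
  have hWgm : MemLp (τ.oscPrim P.Ω w).grad 2 (volume.restrict P.Q) := hW'.memLp_grad.restrict _
  have cs : ∀ {f g : STPt d → ℝ}, MemLp f 2 (volume.restrict P.Q) → MemLp g 2 (volume.restrict P.Q) →
      |∫ z in P.Q, f z * g z| ≤ l2 (volume.restrict P.Q) f * l2 (volume.restrict P.Q) g :=
    fun hf hg => abs_integral_le_l2_mul hf hg (Filter.Eventually.of_forall fun z => (enorm_mul _ _).le)
  -- the two test functions
  have a1 := heq w hw hwE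
  have a2 := heq _ hW' hWE
  have b1 := abs_le.1 (abs_residual_le hW hF hv.mem_Vaux hp hΦ0 hΦ hH hw.toH10)
  have b2 := abs_le.1 (abs_residual_le hW hF hv.mem_Vaux hp hΦ0 hΦ hH hW'.toH10)
  have c1 := abs_le.1 (cs hus hws)
  have c2 := abs_le.1 (cs hus hWs)
  have c3 := abs_le.1 (cs hws hWs)
  have c4 := abs_le.1 (abs_integral_inner_le hκ₀ hwg hWgm)
  have d1 := l2_grad_le hκ₀ hwg
  have d2 := gradNorm_le hκ₀ hWgm
  have f1 : 0 ≤ ∫ z in P.Q, w.dt z * w.val z := hw.integral_dt_mul_nonneg P.T_pos hΩ P.isBounded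
  have f2 : ∫ z in P.Q, w.dt z * (τ.oscPrim P.Ω w).val z =
      -(l2 (volume.restrict P.Q) (τ.osc w.val) ^ 2) := by
    rw [← integral_mul_self_eq (memLp_osc τ hw.toH10)]
    simp only [← sq]
    exact hw.integral_dt_mul_oscPrim τ P.T_pos hΩ P.isBounded
  have f3 : ∫ z in P.Q, scaled κt w.dt z * scaled κt w.dt z = _ := integral_mul_self_eq hws
  rw [integral_κ_inner_self hκ₀ hwg, f3] at a1
  rw [f2] at a2
  have hg0 : 0 ≤ P.gradNorm w.grad := l2_nonneg _
  have hD0 : 0 ≤ l2 (volume.restrict P.Q) (scaled κt w.dt) := l2_nonneg _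
  have hE0 : 0 ≤ l2 (volume.restrict P.Q) (scaled κt u.dt) := l2_nonneg _
  have hY0 : 0 ≤ l2 (volume.restrict P.Q) (τ.osc w.val) := l2_nonneg _
  have ht0 := τ.dt_nonneg
  rw [hN, wnorm_eq hW.aemeas hum hE, ← ENNReal.ofReal_add (by positivity) (l2_nonneg _)]
  refine ENNReal.ofReal_le_ofReal ?_
  change _ ∧ _ ≤ l2 (volume.restrict P.Q) (scaled κt u.dt) *
    l2 (volume.restrict P.Q) (scaled κt w.dt) at c1
  rw [errorConst]
  refine sqrt_le_of_energy_inequalities hg0 hD0 hE0 hY0 (inv_nonneg.2 (Real.sqrt_nonneg _))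
    (Real.sqrt_nonneg _) (Real.sqrt_nonneg _) (Real.sqrt_nonneg _) hΦ0 hH ht0 d1 d2 hWg hWD hWo ?_ ?_
  -- Test with w: the nonnegative term ∫ ∂ₜw w is dropped.
  · linarith [b1.2, c1.2]
  -- Test with the primitive: the term -‖osc w‖² changes sides, so lower bounds are used for the
  -- right-hand side of the error equation and upper bounds for its left-hand side.
  · linarith [b2.1, c2.1, c3.2, c4.2]

end Problem

/-! ### The weight of a partition of unity -/

namespace SpaceMesh

variable {Ω : Set (Pt d)} (𝒯 : SpaceMesh d Ω) {γ : ℝ}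

/-- The smallest side length of an element. -/
def size (i : Fin 𝒯.numCells) : ℝ := ⨅ k, 𝒯.side i k

theorem size_le_side (i : Fin 𝒯.numCells) (k : Fin d) : 𝒯.size i ≤ 𝒯.side i k :=
  ciInf_le (Set.finite_range _).bddBelow k

theorem exists_side_eq_size (hd : 0 < d) (i : Fin 𝒯.numCells) : ∃ k, 𝒯.side i k = 𝒯.size i :=
  haveI : Nonempty (Fin d) := ⟨⟨0, hd⟩⟩
  exists_eq_ciInf_of_finite

theorem size_pos (hd : 0 < d) (i : Fin 𝒯.numCells) : 0 < 𝒯.size i := by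
  obtain ⟨k, hk⟩ := 𝒯.exists_side_eq_size hd i
  exact hk ▸ 𝒯.side_pos i k

theorem size_le_H (hd : 0 < d) (i : Fin 𝒯.numCells) : 𝒯.size i ≤ 𝒯.H :=
  (𝒯.size_le_side i ⟨0, hd⟩).trans (𝒯.side_le_H i _)

theorem nonempty_cells (hΩ : Ω.Nonempty) : Nonempty (Fin 𝒯.numCells) := by
  obtain ⟨x, hx⟩ := hΩ
  rw [← 𝒯.interior_union] at hx
  obtain ⟨i, -⟩ := mem_iUnion.1 (interior_subset hx)
  exact ⟨i⟩

variable {𝒯} in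
theorem QuasiUniform.shapeRegular (h : 𝒯.QuasiUniform γ) : 𝒯.ShapeRegular γ :=
  fun i k l => (𝒯.side_le_H i k).trans (h i l)

variable {𝒯} in
theorem QuasiUniform.H_le (h : 𝒯.QuasiUniform γ) (hd : 0 < d) (i : Fin 𝒯.numCells) :
    𝒯.H ≤ γ * 𝒯.size i := by
  obtain ⟨k, hk⟩ := 𝒯.exists_side_eq_size hd i
  exact hk ▸ h i k

variable {𝒯} in
theorem ShapeRegular.side_le (h : 𝒯.ShapeRegular γ) (hd : 0 < d) (i : Fin 𝒯.numCells) (k : Fin d) :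
    𝒯.side i k ≤ γ * 𝒯.size i := by
  obtain ⟨l, hl⟩ := 𝒯.exists_side_eq_size hd i
  exact hl ▸ h i k l

variable {𝒯} in
theorem ShapeRegular.one_le (h : 𝒯.ShapeRegular γ) (hd : 0 < d) (hΩ : Ω.Nonempty) : 1 ≤ γ := by
  obtain ⟨i⟩ := 𝒯.nonempty_cells hΩ
  have h1 := h i ⟨0, hd⟩ ⟨0, hd⟩
  have h2 := 𝒯.side_pos i ⟨0, hd⟩
  by_contra hlt
  nlinarith

theorem H_pos (hd : 0 < d) (hΩ : Ω.Nonempty) : 0 < 𝒯.H := by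
  obtain ⟨i⟩ := 𝒯.nonempty_cells hΩ
  exact (𝒯.size_pos hd i).trans_le (𝒯.size_le_H hd i)

variable (κ : STPt d → ℝ) (G : Fin 𝒯.numCells → (Fin d → Bool) → STPt d → Pt d)

theorem weight_eq {i : Fin 𝒯.numCells} {z : STPt d} (hz : z.2 ∈ 𝒯.cell i) :
    𝒯.weight κ G z = ∑ v, κ z * ‖G i v z‖ ^ 2 := by
  rw [weight, Finset.sum_eq_single i, indicator_of_mem (by exact hz)]
  · intro j _ hj
    exact indicator_of_notMem (s := {z : STPt d | z.2 ∈ 𝒯.cell j})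
      (fun h => hj (𝒯.cell_inj h hz)) _
  · simp

variable {κ G} {T : ℝ}

theorem weight_nonneg {z : STPt d} (hκ : 0 ≤ κ z) : 0 ≤ 𝒯.weight κ G z :=
  Finset.sum_nonneg fun i _ =>
    indicator_apply_nonneg fun _ => Finset.sum_nonneg fun v _ => by positivity

theorem aemeasurable_weight (hκ : AEMeasurable κ (volume.restrict (cyl T Ω)))
    (hG : ∀ i v, AEMeasurable (G i v) (volume.restrict (cyl T (𝒯.cell i)))) :
    AEMeasurable (𝒯.weight κ G) (volume.restrict (cyl T Ω)) := by
  unfold weight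
  refine Finset.aemeasurable_fun_sum _ fun i _ => ?_
  have hm : MeasurableSet {z : STPt d | z.2 ∈ 𝒯.cell i} := measurable_snd (𝒯.measurableSet_cell i)
  have hs : {z : STPt d | z.2 ∈ 𝒯.cell i} ∩ cyl T Ω ⊆ cyl T (𝒯.cell i) :=
    fun z hz => ⟨hz.2.1, hz.1⟩
  rw [aemeasurable_indicator_iff hm, Measure.restrict_restrict hm]
  refine Finset.aemeasurable_fun_sum _ fun v _ => AEMeasurable.mul ?_ ?_
  · exact hκ.mono_set inter_subset_right
  · exact ((hG i v).mono_set hs).norm.pow_const 2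

end SpaceMesh

namespace Problem

variable {κ₀ κ₁ : ℝ} {P : Problem d κ₀ κ₁} {𝒯 : SpaceMesh d P.Ω} {τ : TimeMesh P.T} {γ : ℝ}

/-- Since κ ≤ κ₁ and an element has 2^d vertices, it is enough to bound each squared gradient as a
multiplier. -/
theorem weightBound_of_grad (hd : 0 < d) (hκ₀ : 0 < κ₀) (hγ : 𝒯.ShapeRegular γ)
    {G : Fin 𝒯.numCells → (Fin d → Bool) → STPt d → Pt d}
    (hG : ∀ i v, AEMeasurable (G i v) (volume.restrict (cyl P.T (𝒯.cell i)))) {B : ℝ} (hB : 0 ≤ B)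
    (hGB : ∀ θ g, H10 P.T P.Ω θ g → ∀ i v (c : ℝ) (I : Set ℝ), I ⊆ Ioo 0 P.T → MeasurableSet I →
      ∫⁻ z in I ×ˢ 𝒯.cell i, ‖G i v z‖ₑ ^ 2 * ‖θ z - c‖ₑ ^ 2 ≤
        ENNReal.ofReal B *
          ((ENNReal.ofReal (𝒯.size i ^ 2))⁻¹ * (∫⁻ z in I ×ˢ 𝒯.cell i, ‖θ z - c‖ₑ ^ 2) +
            ∫⁻ z in I ×ˢ 𝒯.cell i, ‖g z‖ₑ ^ 2)) :
    WeightBound (T := P.T) 𝒯 (𝒯.weight P.κ G) 𝒯.size γ (2 ^ d * |κ₁| * B) where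
  pos := 𝒯.size_pos hd
  le_H := 𝒯.size_le_H hd
  side_le := hγ.side_le hd
  one_le := hγ.one_le hd P.isConnected.nonempty
  nonneg_const := by positivity
  aemeas := 𝒯.aemeasurable_weight P.aemeasurable_κ hG
  nonneg z hz := 𝒯.weight_nonneg (κ_nonneg hκ₀ hz)
  bound θ g hθ i c I hI hIm := by
    have hm : MeasurableSet (I ×ˢ 𝒯.cell i : Set (STPt d)) := hIm.prod (𝒯.measurableSet_cell i)
    have hs : (I ×ˢ 𝒯.cell i : Set (STPt d)) ⊆ cyl P.T (𝒯.cell i) := prod_mono hI le_rfl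
    have hθm : AEMeasurable (fun z => ‖θ z - c‖ₑ ^ 2) (volume.restrict (I ×ˢ 𝒯.cell i)) :=
      ((hθ.meas_val.sub_const c).enorm.pow_const 2).aemeasurable
    have hmv : ∀ v ∈ Finset.univ, AEMeasurable (fun z => ‖G i v z‖ₑ ^ 2 * ‖θ z - c‖ₑ ^ 2)
        (volume.restrict (I ×ˢ 𝒯.cell i)) := fun v _ =>
      (((hG i v).mono_set hs).enorm.pow_const 2).mul hθm
    calc ∫⁻ z in I ×ˢ 𝒯.cell i, ENNReal.ofReal (𝒯.weight P.κ G z) * ‖θ z - c‖ₑ ^ 2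
        ≤ ∫⁻ z in I ×ˢ 𝒯.cell i, ENNReal.ofReal |κ₁| *
            ∑ v, ‖G i v z‖ₑ ^ 2 * ‖θ z - c‖ₑ ^ 2 := by
          refine setLIntegral_mono' hm fun z hz => ?_
          have hκ : P.κ z ≤ |κ₁| :=
            (P.κ_mem z ⟨hI hz.1, 𝒯.cell_subset i hz.2⟩).2.trans (le_abs_self _)
          rw [𝒯.weight_eq _ _ hz.2, ← Finset.mul_sum, ← Finset.sum_mul, ← mul_assoc]
          gcongr
          calc ENNReal.ofReal (P.κ z * ∑ v, ‖G i v z‖ ^ 2)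
              ≤ ENNReal.ofReal (|κ₁| * ∑ v, ‖G i v z‖ ^ 2) := by gcongr
            _ = _ := by
                rw [ENNReal.ofReal_mul (abs_nonneg _),
                  ENNReal.ofReal_sum_of_nonneg fun _ _ => by positivity]
                simp_rw [ofReal_norm_sq]
      _ = ENNReal.ofReal |κ₁| * ∑ v, ∫⁻ z in I ×ˢ 𝒯.cell i, ‖G i v z‖ₑ ^ 2 * ‖θ z - c‖ₑ ^ 2 := by
          rw [lintegral_const_mul'' _ (Finset.aemeasurable_fun_sum _ hmv),
            lintegral_finsetSum' _ hmv]
      _ ≤ ENNReal.ofReal |κ₁| * ∑ v : Fin d → Bool, ENNReal.ofReal B *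
            ((ENNReal.ofReal (𝒯.size i ^ 2))⁻¹ * (∫⁻ z in I ×ˢ 𝒯.cell i, ‖θ z - c‖ₑ ^ 2) +
              ∫⁻ z in I ×ˢ 𝒯.cell i, ‖g z‖ₑ ^ 2) := by
          gcongr with v
          exact hGB θ g hθ i v c I hI hIm
      _ = _ := by
          have h2 : ENNReal.ofReal ((2 : ℝ) ^ d) = 2 ^ d := by
            rw [ENNReal.ofReal_pow zero_le_two, ENNReal.ofReal_ofNat]
          rw [Finset.sum_const, nsmul_eq_mul, ENNReal.ofReal_mul (by positivity),
            ENNReal.ofReal_mul (by positivity), h2]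
          simp only [Finset.card_univ, Fintype.card_pi, Fintype.card_bool, Finset.prod_const,
            Fintype.card_fin, Nat.cast_pow, Nat.cast_ofNat]
          rw [← mul_assoc, ← mul_assoc, mul_comm (ENNReal.ofReal |κ₁|)]

/-- The bilinear gradients are bounded pointwise by a multiple of h⁻¹, and the gradient term on the
right is not needed. -/
theorem weightBound_hatGrad (hd : 0 < d) (hκ₀ : 0 < κ₀) (hγ : 𝒯.ShapeRegular γ) :
    WeightBound (T := P.T) 𝒯 (𝒯.weight P.κ 𝒯.hatGrad) 𝒯.size γ (2 ^ d * |κ₁| * d) := by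
  refine weightBound_of_grad hd hκ₀ hγ (fun i v => (𝒯.measurable_hatGrad i v).aemeasurable)
    (by positivity) fun θ g hθ i v c I hI hIm => ?_
  have hm : MeasurableSet (I ×ˢ 𝒯.cell i : Set (STPt d)) := hIm.prod (𝒯.measurableSet_cell i)
  have hh := 𝒯.size_pos hd i
  rw [mul_add]
  refine le_add_right ?_
  rw [← mul_assoc, ← lintegral_const_mul' _ _ (by finiteness)]
  refine setLIntegral_mono' hm fun z hz => ?_
  gcongr
  rw [← ofReal_norm_sq, ← ENNReal.ofReal_inv_of_pos (by positivity),
    ← ENNReal.ofReal_mul (by positivity)]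
  exact ENNReal.ofReal_le_ofReal (𝒯.norm_hatGrad_sq_le v hz.2 hh (𝒯.size_le_side i))

/-- The Caccioppoli inequality with β = d h⁻², the pointwise bound of the squared nodal gradients,
replaces a pointwise bound of ∇χ. -/
theorem weightBound_multiscale (hd : 0 < d) (hκ₀ : 0 < κ₀) (hκ₁ : κ₀ ≤ κ₁) (hγ : 𝒯.ShapeRegular γ)
    {κc : STPt d → ℝ} (hκm : AEMeasurable κc (volume.restrict P.Q))
    (hκ : ∀ z ∈ P.Q, κc z ∈ Icc κ₀ κ₁)
    {χ : Fin 𝒯.numCells → (Fin d → Bool) → STPt d → ℝ}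
    {G : Fin 𝒯.numCells → (Fin d → Bool) → STPt d → Pt d} (hG : 𝒯.IsMultiscaleBasis P.T κc χ G) :
    WeightBound (T := P.T) 𝒯 (𝒯.weight P.κ G) 𝒯.size γ
      (2 ^ d * |κ₁| * (κ₁ / κ₀ * (2 * d + 8))) := by
  have hκ₁' : 0 ≤ κ₁ / κ₀ := by have := hκ₀.trans_le hκ₁; positivity
  have hβ : ∀ i v, ∀ z ∈ cyl P.T (𝒯.cell i),
      ‖𝒯.hatGrad i v z‖ ^ 2 ≤ d * (𝒯.size i ^ 2)⁻¹ := fun i v z hz =>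
    𝒯.norm_hatGrad_sq_le v hz.2 (𝒯.size_pos hd i) (𝒯.size_le_side i)
  have hcyl : ∀ i, cyl P.T (𝒯.cell i) ⊆ P.Q := fun i => prod_mono le_rfl (𝒯.cell_subset i)
  have hGm : ∀ i v, MemLp (G i v) 2 (volume.restrict (cyl P.T (𝒯.cell i))) := fun i v => by
    have := isFiniteMeasure_restrict_cyl (T := P.T) (𝒯.isBounded_cell i)
    have h1 : MemLp (𝒯.hatGrad i v) 2 (volume.restrict (cyl P.T (𝒯.cell i))) := by
      refine MemLp.of_bound (𝒯.measurable_hatGrad i v).aestronglyMeasurable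
        (√(d * (𝒯.size i ^ 2)⁻¹)) ?_
      exact ae_restrict_of_forall_mem (measurableSet_cyl (𝒯.measurableSet_cell i)) fun z hz =>
        Real.le_sqrt_of_sq_le (hβ i v z hz)
    have h2 := (hG.boundary i v).memLp_grad.add h1
    refine h2.ae_eq (Filter.Eventually.of_forall fun z => ?_)
    simp
  refine weightBound_of_grad hd hκ₀ hγ (fun i v => (hGm i v).1.aemeasurable)
    (by positivity) fun θ g hθ i v c I hI hIm => ?_
  obtain ⟨φ, gφ, hφ, -, hg⟩ := (hG.boundary i v).exists_H10 (𝒯.measurableSet_cell i)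
    (𝒯.isBounded_cell i)
  have hφ1 := hG.abs_sub_hat_le hd hκ₀ hκm hκ i v hφ hg (hGm i v)
  refine (hφ.caccioppoli (𝒯.measurableSet_cell i) (𝒯.isBounded_cell i) hκ₀ hκ₁
    (hκm.mono_set (hcyl i)) (fun z hz => hκ z (hcyl i hz)) hφ1 hg (hGm i v) (hβ i v)
    (hG.eq i v) hθ c hI hIm).trans ?_
  have hh := 𝒯.size_pos hd i
  have h1 : 2 * ENNReal.ofReal (d * (𝒯.size i ^ 2)⁻¹) ≤
      ENNReal.ofReal (2 * d + 8) * (ENNReal.ofReal (𝒯.size i ^ 2))⁻¹ := by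
    rw [← ENNReal.ofReal_inv_of_pos (by positivity), ← ENNReal.ofReal_mul (by positivity),
      ← ENNReal.ofReal_ofNat, ← ENNReal.ofReal_mul (by norm_num), ← mul_assoc]
    gcongr
    linarith
  have h2 : (8 : ℝ≥0∞) ≤ ENNReal.ofReal (2 * d + 8) := by
    rw [← ENNReal.ofReal_ofNat]
    exact ENNReal.ofReal_le_ofReal (by linarith [(Nat.cast_nonneg d : (0 : ℝ) ≤ d)])
  rw [ENNReal.ofReal_mul hκ₁', mul_assoc (ENNReal.ofReal _) (ENNReal.ofReal _), mul_add (ENNReal.ofReal (2 * d + 8)),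
    ← mul_assoc (ENNReal.ofReal (2 * d + 8))]
  gcongr

end Problem

/-! ### From the abstract estimates to the bilinear and the multiscale weight. -/

theorem TimeMesh.ae_mem_interval {T : ℝ} (τ : TimeMesh T) (n : Fin τ.N) :
    ∀ᵐ t ∂(volume.restrict (τ.interval n)), t ∈ Ioo 0 T := by
  have h : τ.openInterval n =ᵐ[volume] τ.interval n := Ioo_ae_eq_Ioc
  rw [← Measure.restrict_congr_set h]
  exact ae_restrict_of_forall_mem measurableSet_Ioo fun t ht => τ.openInterval_subset n ht

theorem TimeMesh.Comparable.mono {T : ℝ} {τ : TimeMesh T} {Ω : Set (Pt d)} (hΩ : MeasurableSet Ω)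
    {κt : STPt d → ℝ} {M M' : ℝ} (h : τ.Comparable Ω κt M) (hκ : ∀ z ∈ cyl T Ω, 0 ≤ κt z)
    (hM : M ≤ M') : τ.Comparable Ω κt M' := fun n => by
  filter_upwards [h n, ae_restrict_mem hΩ] with x hx hxΩ
  filter_upwards [hx] with t ht
  filter_upwards [ht, τ.ae_mem_interval n] with s hs hsT
  exact hs.trans (mul_le_mul_of_nonneg_right hM (hκ _ ⟨hsT, hxΩ⟩))

theorem enorm_scaled_sq_le {α : Type*} {ρ ρ' g : α → ℝ} {q : ℝ} {z : α} (hq : 0 < q)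
    (hρ : 0 < ρ z) (h : q⁻¹ * ρ z ≤ ρ' z) :
    ‖scaled ρ' g z‖ₑ ^ 2 ≤ ENNReal.ofReal q * ‖scaled ρ g z‖ₑ ^ 2 := by
  have hρ' : 0 < ρ' z := lt_of_lt_of_le (by positivity) h
  rw [← ofReal_norm_sq, ← ofReal_norm_sq, ← ENNReal.ofReal_mul hq.le]
  refine ENNReal.ofReal_le_ofReal ?_
  simp only [scaled, norm_mul, mul_pow, norm_inv, inv_pow, Real.norm_eq_abs, sq_abs,
    Real.sq_sqrt hρ.le, Real.sq_sqrt hρ'.le]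
  rw [← mul_assoc]
  gcongr
  rw [inv_le_comm₀ hρ' (by positivity), mul_inv, inv_inv]
  exact h

namespace SpaceMesh

variable {Ω : Set (Pt d)} (𝒯 : SpaceMesh d Ω) {γ : ℝ} {κ : STPt d → ℝ}

theorem mul_le_weight_hatGrad (hd : 0 < d) {i : Fin 𝒯.numCells} {z : STPt d} (hz : z.2 ∈ 𝒯.cell i)
    (hκ : 0 ≤ κ z) {L : ℝ} (hL : ∀ k, 𝒯.side i k ≤ L) :
    (4 ^ d * L ^ 2)⁻¹ * κ z ≤ 𝒯.weight κ 𝒯.hatGrad z := by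
  obtain ⟨v, hv⟩ := 𝒯.exists_le_norm_hatGrad_sq i z ⟨0, hd⟩
  rw [𝒯.weight_eq _ _ hz]
  have hs := 𝒯.side_pos i ⟨0, hd⟩
  have hs' := hL ⟨0, hd⟩
  calc (4 ^ d * L ^ 2)⁻¹ * κ z ≤ κ z * ‖𝒯.hatGrad i v z‖ ^ 2 := by
        rw [mul_comm]
        gcongr
        refine le_trans ?_ hv
        gcongr
    _ ≤ _ := Finset.single_le_sum (f := fun v => κ z * ‖𝒯.hatGrad i v z‖ ^ 2)
        (fun _ _ => by positivity) (Finset.mem_univ v)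

theorem weight_hatGrad_le (hd : 0 < d) {i : Fin 𝒯.numCells} {z : STPt d} (hz : z.2 ∈ 𝒯.cell i)
    (hκ : 0 ≤ κ z) :
    𝒯.weight κ 𝒯.hatGrad z ≤ 2 ^ d * (κ z * (d * (𝒯.size i ^ 2)⁻¹)) := by
  rw [𝒯.weight_eq _ _ hz]
  calc ∑ v, κ z * ‖𝒯.hatGrad i v z‖ ^ 2
      ≤ ∑ v : Fin d → Bool, κ z * (d * (𝒯.size i ^ 2)⁻¹) := by
        gcongr with v
        exact 𝒯.norm_hatGrad_sq_le v hz (𝒯.size_pos hd i) (𝒯.size_le_side i)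
    _ = _ := by simp

end SpaceMesh

namespace Problem

variable {κ₀ κ₁ : ℝ} {P : Problem d κ₀ κ₁} {𝒯 : SpaceMesh d P.Ω} {τ : TimeMesh P.T} {γ : ℝ}

theorem ae_mem_cell (𝒯 : SpaceMesh d P.Ω) : ∀ᵐ x ∂(volume.restrict P.Ω), ∃ i, x ∈ 𝒯.cell i := by
  rw [ae_restrict_iff' P.isOpen.measurableSet]
  filter_upwards [measure_eq_zero_iff_ae_notMem.1 𝒯.volume_diff_cells] with x hx hxΩ
  by_contra h
  exact hx ⟨hxΩ, fun h' => h (mem_iUnion.1 h')⟩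

/-- The nodal gradients do not depend on time and κ varies at most by κ₁/κ₀. The constant is larger
than this ratio because it comes from upper and lower bounds of the weight on an element. -/
theorem comparable_hatGrad (hd : 0 < d) (hκ₀ : 0 < κ₀) (hγ : 𝒯.ShapeRegular γ) :
    τ.Comparable P.Ω (𝒯.weight P.κ 𝒯.hatGrad) (κ₁ / κ₀ * (2 ^ d * d * 4 ^ d * γ ^ 2)) := fun n => by
  have hγ1 := hγ.one_le hd P.isConnected.nonempty
  filter_upwards [ae_mem_cell 𝒯] with x ⟨i, hi⟩
  filter_upwards [τ.ae_mem_interval n] with t ht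
  filter_upwards [τ.ae_mem_interval n] with s hs
  have h1 := P.κ_mem (t, x) ⟨ht, 𝒯.cell_subset i hi⟩
  have h2 := P.κ_mem (s, x) ⟨hs, 𝒯.cell_subset i hi⟩
  have hh := 𝒯.size_pos hd i
  have hκ₁ : 0 < κ₁ := hκ₀.trans_le (h1.1.trans h1.2)
  have h3 := 𝒯.weight_hatGrad_le hd (z := (t, x)) hi (hκ₀.le.trans h1.1)
  have h4 := 𝒯.mul_le_weight_hatGrad hd (z := (s, x)) hi (hκ₀.le.trans h2.1) (hγ.side_le hd i)
  calc _ ≤ 2 ^ d * (κ₁ * (d * (𝒯.size i ^ 2)⁻¹)) := by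
        refine h3.trans ?_
        gcongr
        exact h1.2
    _ = κ₁ / κ₀ * (2 ^ d * d * 4 ^ d * γ ^ 2) * ((4 ^ d * (γ * 𝒯.size i) ^ 2)⁻¹ * κ₀) := by
        have : γ ≠ 0 := by positivity
        field_simp
    _ ≤ κ₁ / κ₀ * (2 ^ d * d * 4 ^ d * γ ^ 2) *
          ((4 ^ d * (γ * 𝒯.size i) ^ 2)⁻¹ * P.κ (s, x)) := by
        gcongr
        exact h2.1
    _ ≤ _ := by gcongr

theorem wnorm_le_of_ae {ρ ρ' g : STPt d → ℝ} {L : ℝ} (hL : 0 < L)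
    (hρ : ∀ᵐ z ∂(volume.restrict P.Q), (L ^ 2)⁻¹ * ρ z ≤ ρ' z) :
    P.wnorm ρ' g ≤ ENNReal.ofReal L * P.wnorm ρ g := by
  unfold wnorm
  have h1 : ENNReal.ofReal L = (ENNReal.ofReal L ^ 2) ^ (1 / 2 : ℝ) := by
    rw [← ENNReal.rpow_natCast, ← ENNReal.rpow_mul]
    norm_num
  rw [h1, ← ENNReal.mul_rpow_of_nonneg _ _ (by norm_num),
    ← lintegral_const_mul' _ _ (by finiteness)]
  gcongr 1
  refine lintegral_mono_ae ?_
  filter_upwards [hρ] with z hz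
  rw [← mul_assoc]
  gcongr
  rw [← ENNReal.inv_le_inv, inv_inv, ENNReal.mul_inv (by simp [hL]) (by simp), inv_inv,
    ← ENNReal.ofReal_pow hL.le, ← ENNReal.ofReal_inv_of_pos (by positivity),
    ← ENNReal.ofReal_mul (by positivity)]
  exact ENNReal.ofReal_le_ofReal hz

theorem wnorm_κ_ne_top (hκ₀ : 0 < κ₀) {g : STPt d → ℝ} (hg : MemLp g 2 (volume.restrict P.Q)) :
    P.wnorm P.κ g ≠ ∞ := by
  rw [wnorm_ne_top_iff]
  have h : ∫⁻ z in P.Q, ENNReal.ofReal (g z ^ 2) ≠ ∞ := by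
    have := (memLp_two_iff hg.1).1 hg
    simpa [← ofReal_norm_sq] using this
  refine ne_top_of_le_ne_top (ENNReal.mul_ne_top (a := (ENNReal.ofReal κ₀)⁻¹) (by simp [hκ₀]) h) ?_
  rw [← lintegral_const_mul' _ _ (by simp [hκ₀])]
  refine setLIntegral_mono' P.measurableSet_Q fun z hz => ?_
  gcongr
  exact (P.κ_mem z hz).1

/-- This lower bound converts norms with weight κ̃⁻¹ into H times norms with weight κ⁻¹, the source
of the factor H before ∂ₜu. -/
theorem ae_mul_κ_le_weight_hatGrad (hd : 0 < d) (hκ₀ : 0 < κ₀) :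
    ∀ᵐ z ∂(volume.restrict P.Q), ((2 ^ d * 𝒯.H) ^ 2)⁻¹ * P.κ z ≤ 𝒯.weight P.κ 𝒯.hatGrad z := by
  have h : ∀ᵐ z : STPt d, z.2 ∈ P.Ω → ∃ i, z.2 ∈ 𝒯.cell i :=
    ae_of_ae_space ((ae_restrict_iff' P.isOpen.measurableSet).1 (ae_mem_cell 𝒯))
  rw [ae_restrict_iff' P.measurableSet_Q]
  filter_upwards [h] with z hz hzQ
  obtain ⟨i, hi⟩ := hz hzQ.2
  convert 𝒯.mul_le_weight_hatGrad hd hi (κ_nonneg hκ₀ hzQ) (𝒯.side_le_H i) using 3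
  rw [mul_pow, ← pow_mul, mul_comm d, pow_mul]
  norm_num

/-- The error estimate for the bilinear partition of unity. -/
theorem error_le_bilinear (hd : 0 < d) (hκ₀ : 0 < κ₀) (hκ₁ : κ₀ ≤ κ₁) (hγ : 𝒯.ShapeRegular γ)
    {u v : STFun d} {S : Set (STFun d)} (hu : P.IsWeakSolution u)
    (hv : P.IsGlobalSolution (𝒯.weight P.κ 𝒯.hatGrad) 𝒯 τ S v)
    (hS : P.V₀ (𝒯.weight P.κ 𝒯.hatGrad) ⊆ S) :
    P.normV (𝒯.weight P.κ 𝒯.hatGrad) (u - v) ≤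
      ENNReal.ofReal (20 * errorConst κ₀ κ₁ (κ₁ / κ₀ * (2 ^ d * d * 4 ^ d * γ ^ 2))
        √(2 ^ d * |κ₁| * d * (poincareConst d γ + 2)) ^ 2 * (2 ^ d * |γ|) * (𝒯.H + √τ.dt)) *
          P.wnorm P.κ P.f + ENNReal.ofReal (2 ^ d * 𝒯.H) * P.wnorm P.κ u.dt := by
  have hγ1 := hγ.one_le hd P.isConnected.nonempty
  have hH := 𝒯.H_pos hd P.isConnected.nonempty
  have hκ₁' := hκ₀.trans_le hκ₁
  have hW := weightBound_hatGrad (P := P) hd hκ₀ hγ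
  have hle : ∀ g, P.wnorm (𝒯.weight P.κ 𝒯.hatGrad) g ≤ ENNReal.ofReal (2 ^ d * 𝒯.H) * P.wnorm P.κ g :=
    fun g => wnorm_le_of_ae (by positivity) (ae_mul_κ_le_weight_hatGrad hd hκ₀)
  have hfin : ∀ g, MemLp g 2 (volume.restrict P.Q) → P.wnorm (𝒯.weight P.κ 𝒯.hatGrad) g ≠ ∞ :=
    fun g hg => ne_top_of_le_ne_top
      (ENNReal.mul_ne_top ENNReal.ofReal_ne_top (wnorm_κ_ne_top hκ₀ hg)) (hle g)
  have hf := wnorm_κ_ne_top hκ₀ P.memLp_f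
  have hfm : AEMeasurable P.f (volume.restrict P.Q) := P.memLp_f.1.aemeasurable
  set F := l2 (volume.restrict P.Q) (scaled P.κ P.f) with hF
  have hF0 : 0 ≤ F := l2_nonneg _
  have hwf : P.wnorm P.κ P.f = ENNReal.ofReal F := wnorm_eq P.aemeasurable_κ hfm hf
  -- On each element the local lower bound of the weight gives h⁻²κ̃⁻¹ ≤ (2^d γ)² κ⁻¹. The local
  -- size cancels, so elements of very different sizes are allowed.
  have hΦ : ∑ n, ∑ i, (ENNReal.ofReal (𝒯.size i ^ 2))⁻¹ * ∫⁻ z in τ.openInterval n ×ˢ 𝒯.cell i,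
      ‖scaled (𝒯.weight P.κ 𝒯.hatGrad) P.f z‖ₑ ^ 2 ≤ ENNReal.ofReal ((2 ^ d * γ * F) ^ 2) := by
    have hF2 : ENNReal.ofReal (F ^ 2) = ∫⁻ z in P.Q, ‖scaled P.κ P.f z‖ₑ ^ 2 :=
      l2_sq (memLp_scaled P.aemeasurable_κ hfm (wnorm_ne_top_iff.1 hf))
    rw [mul_pow, ENNReal.ofReal_mul (by positivity), hF2, P.lintegral_cells 𝒯 τ, Finset.mul_sum]
    refine Finset.sum_le_sum fun n _ => ?_
    rw [Finset.mul_sum]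
    refine Finset.sum_le_sum fun i _ => ?_
    have hh := 𝒯.size_pos hd i
    rw [← lintegral_const_mul' _ _ (by simp [hh.ne']), ← lintegral_const_mul' _ _ (by finiteness)]
    refine setLIntegral_mono' (measurableSet_Ioo.prod (𝒯.measurableSet_cell i)) fun z hz => ?_
    have hzQ : z ∈ P.Q := ⟨τ.openInterval_subset n hz.1, 𝒯.cell_subset i hz.2⟩
    have hκz : 0 < P.κ z := hκ₀.trans_le (P.κ_mem z hzQ).1
    refine (mul_le_mul_right (enorm_scaled_sq_le (by positivity) hκz
      (𝒯.mul_le_weight_hatGrad hd hz.2 hκz.le (hγ.side_le hd i))) _).trans_eq ?_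
    rw [← mul_assoc, ← ENNReal.ofReal_inv_of_pos (by positivity), ← ENNReal.ofReal_mul (by positivity)]
    congr 2
    rw [mul_pow, mul_pow, ← pow_mul, mul_comm d, pow_mul]
    field_simp
    norm_num
  refine (error_le_of_comparable hκ₀ hW hu hv hS (hfin _ hu.mem.memLp_dt) (hfin _ P.memLp_f)
    (by positivity) (comparable_hatGrad hd hκ₀ hγ) hH.le (by positivity) hΦ).trans ?_
  refine add_le_add (le_of_eq ?_) (hle _)
  rw [hwf, ← ENNReal.ofReal_mul (by positivity), abs_of_pos (by positivity : 0 < γ)]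
  congr 1
  ring

/-- The error estimate for the multiscale partition of unity. -/
theorem error_le_multiscale (hd : 0 < d) (hκ₀ : 0 < κ₀) (hκ₁ : κ₀ ≤ κ₁) (hγ : 𝒯.QuasiUniform γ)
    {κc : STPt d → ℝ} (hκm : AEMeasurable κc (volume.restrict P.Q))
    (hκ : ∀ z ∈ P.Q, κc z ∈ Icc κ₀ κ₁)
    {χ : Fin 𝒯.numCells → (Fin d → Bool) → STPt d → ℝ}
    {G : Fin 𝒯.numCells → (Fin d → Bool) → STPt d → Pt d} (hG : 𝒯.IsMultiscaleBasis P.T κc χ G)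
    {M : ℝ} (hM : τ.dt ≤ M * 𝒯.H ^ 2 ∨ τ.Comparable P.Ω (𝒯.weight P.κ G) M)
    {u v : STFun d} {S : Set (STFun d)} (hu : P.IsWeakSolution u)
    (hv : P.IsGlobalSolution (𝒯.weight P.κ G) 𝒯 τ S v) (hS : P.V₀ (𝒯.weight P.κ G) ⊆ S)
    {C : ℝ} (hC : C = 2 ^ d * |κ₁| * (κ₁ / κ₀ * (2 * d + 8))) {C₀ : ℝ}
    (h1 : √(C * (poincareConst d γ + 1) + 2 * C ^ 2 * (|M| * γ ^ 2) ^ 2) * ((√κ₀)⁻¹ + 1) ≤ C₀)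
    (h2 : 20 * errorConst κ₀ κ₁ (max M 1) √(C * (poincareConst d γ + 2)) ^ 2 * |γ| ≤ C₀)
    (h0 : 0 < C₀) :
    P.normV (𝒯.weight P.κ G) (u - v) ≤
      ENNReal.ofReal (C₀ * (1 + √(τ.dt / 𝒯.H ^ 2))) * P.wnorm (𝒯.weight P.κ G) P.f +
        P.wnorm (𝒯.weight P.κ G) u.dt := by
  have hγ1 := hγ.shapeRegular.one_le hd P.isConnected.nonempty
  have hH := 𝒯.H_pos hd P.isConnected.nonempty
  have hW := weightBound_multiscale (P := P) hd hκ₀ hκ₁ hγ.shapeRegular hκm hκ hG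
  rw [← hC] at hW
  have hC1 : 0 < C₀ * (1 + √(τ.dt / 𝒯.H ^ 2)) := by positivity
  by_cases hE : P.wnorm (𝒯.weight P.κ G) u.dt = ∞
  · simp [hE]
  -- If the norm of f is infinite, the right side is infinite because C₀ is strictly positive.
  by_cases hF : P.wnorm (𝒯.weight P.κ G) P.f = ∞
  · rw [hF, ENNReal.mul_top (by simpa using hC1), top_add]
    exact le_top
  have hfm : AEMeasurable P.f (volume.restrict P.Q) := P.memLp_f.1.aemeasurable
  have hHi : ∀ i, (ENNReal.ofReal (𝒯.size i ^ 2))⁻¹ ≤ ENNReal.ofReal ((γ / 𝒯.H) ^ 2) := fun i => by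
    have hh := 𝒯.size_pos hd i
    have := hγ.H_le hd i
    rw [← ENNReal.ofReal_inv_of_pos (by positivity), ← inv_pow]
    gcongr
    rw [le_div_iff₀ hH, inv_mul_le_iff₀ hh]
    linarith
  rcases hM with hM | hM
  · refine (error_le_of_dt_le hκ₀ hW hu hv hS hE hF (M := |M| * γ ^ 2) (fun i => ?_)
      (by positivity)).trans ?_
    · have := hγ.H_le hd i
      calc τ.dt ≤ M * 𝒯.H ^ 2 := hM
        _ ≤ |M| * (γ * 𝒯.size i) ^ 2 := by
            gcongr
            exact le_abs_self M
        _ = _ := by ring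
    · gcongr ENNReal.ofReal ?_ * _ + _
      refine h1.trans (le_mul_of_one_le_right h0.le ?_)
      linarith [Real.sqrt_nonneg (τ.dt / 𝒯.H ^ 2)]
  -- M is an arbitrary real number; the estimate needs a positive comparability constant.
  · have hM' := hM.mono P.isOpen.measurableSet hW.nonneg (le_max_left M 1)
    set F := l2 (volume.restrict P.Q) (scaled (𝒯.weight P.κ G) P.f) with hFd
    have hF0 : 0 ≤ F := l2_nonneg _
    have hwf : P.wnorm (𝒯.weight P.κ G) P.f = ENNReal.ofReal F := wnorm_eq hW.aemeas hfm hF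
    -- Quasi-uniformity replaces every h⁻¹ by γ/H. The product of this with H + √Δt is γ(1 + √Δt/H),
    -- the factor in the theorem.
    have hΦ : ∑ n, ∑ i, (ENNReal.ofReal (𝒯.size i ^ 2))⁻¹ * ∫⁻ z in τ.openInterval n ×ˢ 𝒯.cell i,
        ‖scaled (𝒯.weight P.κ G) P.f z‖ₑ ^ 2 ≤ ENNReal.ofReal ((γ / 𝒯.H * F) ^ 2) := by
      have hF2 : ENNReal.ofReal (F ^ 2) = ∫⁻ z in P.Q, ‖scaled (𝒯.weight P.κ G) P.f z‖ₑ ^ 2 :=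
        l2_sq (memLp_scaled hW.aemeas hfm (wnorm_ne_top_iff.1 hF))
      rw [mul_pow, ENNReal.ofReal_mul (by positivity), hF2, P.lintegral_cells 𝒯 τ, Finset.mul_sum]
      gcongr with n
      rw [Finset.mul_sum]
      gcongr with i
      exact hHi i
    refine (error_le_of_comparable hκ₀ hW hu hv hS hE hF (by positivity) hM' hH.le
      (by positivity) hΦ).trans ?_
    gcongr
    rw [hwf, ← ENNReal.ofReal_mul (by positivity)]
    refine ENNReal.ofReal_le_ofReal ?_
    rw [Real.sqrt_div' _ (by positivity), Real.sqrt_sq hH.le]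
    rw [abs_of_pos (by positivity : 0 < γ)] at h2
    calc _ = 20 * errorConst κ₀ κ₁ (max M 1) √(C * (poincareConst d γ + 2)) ^ 2 * γ *
          (1 + √τ.dt / 𝒯.H) * F := by field_simp
      _ ≤ _ := by gcongr

end Problem

end

end SpaceTimeNLMC

/-! ### The theorem: collecting the constants. -/

theorem mainTheorem2 (d : ℕ) (hd : d = 2 ∨ d = 3) (κ₀ κ₁ : ℝ) (hκ₀ : 0 < κ₀) (hκ₁ : κ₀ ≤ κ₁)
    (γ : ℝ) :
    -- multiscale partition of unity, generated by `κc` (`κc = P.κ`, or a time-independent field)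
    (∀ M : ℝ, ∃ C₀ : ℝ, 0 < C₀ ∧
      ∀ (P : SpaceTimeNLMC.Problem d κ₀ κ₁) (𝒯 : SpaceTimeNLMC.SpaceMesh d P.Ω)
        (τ : SpaceTimeNLMC.TimeMesh P.T)
        (κc : SpaceTimeNLMC.STPt d → ℝ)
        (χ : Fin 𝒯.numCells → (Fin d → Bool) → SpaceTimeNLMC.STPt d → ℝ)
        (G : Fin 𝒯.numCells → (Fin d → Bool) → SpaceTimeNLMC.STPt d → SpaceTimeNLMC.Pt d)
        (κt : SpaceTimeNLMC.STPt d → ℝ) (S : Set (SpaceTimeNLMC.STFun d))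
        (u uglo : SpaceTimeNLMC.STFun d),
        𝒯.QuasiUniform γ →
        AEMeasurable κc (MeasureTheory.volume.restrict P.Q) →
        (∀ z ∈ P.Q, κc z ∈ Set.Icc κ₀ κ₁) →
        𝒯.IsMultiscaleBasis P.T κc χ G →
        κt = 𝒯.weight P.κ G →
        (τ.dt ≤ M * 𝒯.H ^ 2 ∨ τ.Comparable P.Ω κt M) →
        P.V₀ κt ⊆ S → S ⊆ P.V_d κt τ →
        P.IsWeakSolution u →
        P.IsGlobalSolution κt 𝒯 τ S uglo →
        P.normV κt (u - uglo) ≤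
          ENNReal.ofReal (C₀ * (1 + √(τ.dt / 𝒯.H ^ 2))) * P.wnorm κt P.f
            + P.wnorm κt u.dt) ∧
    -- bilinear partition of unity
    (∃ C : ℝ, 0 < C ∧
      ∀ (P : SpaceTimeNLMC.Problem d κ₀ κ₁) (𝒯 : SpaceTimeNLMC.SpaceMesh d P.Ω)
        (τ : SpaceTimeNLMC.TimeMesh P.T)
        (κt : SpaceTimeNLMC.STPt d → ℝ) (S : Set (SpaceTimeNLMC.STFun d))
        (u uglo : SpaceTimeNLMC.STFun d),
        𝒯.ShapeRegular γ →
        κt = 𝒯.weight P.κ 𝒯.hatGrad →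
        P.V₀ κt ⊆ S → S ⊆ P.V_d κt τ →
        P.IsWeakSolution u →
        P.IsGlobalSolution κt 𝒯 τ S uglo →
        P.normV κt (u - uglo) ≤
          ENNReal.ofReal (C * (𝒯.H + √τ.dt)) * P.wnorm P.κ P.f
            + ENNReal.ofReal (C * 𝒯.H) * P.wnorm P.κ u.dt) := by
  have hd0 : 0 < d := by omega
  refine ⟨fun M => ?_, ?_⟩
  · obtain ⟨C, hC⟩ : ∃ C, C = 2 ^ d * |κ₁| * (κ₁ / κ₀ * (2 * d + 8)) := ⟨_, rfl⟩
    -- The two entries are the constants of the short-step and the comparable regime; the 1 makes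
    -- the result positive. Absolute values appear because M and γ range over all real numbers.
    refine ⟨max (max (√(C * (SpaceTimeNLMC.poincareConst d γ + 1) +
        2 * C ^ 2 * (|M| * γ ^ 2) ^ 2) * ((√κ₀)⁻¹ + 1))
      (20 * SpaceTimeNLMC.Problem.errorConst κ₀ κ₁ (max M 1)
        √(C * (SpaceTimeNLMC.poincareConst d γ + 2)) ^ 2 * |γ|)) 1, lt_max_of_lt_right one_pos, ?_⟩
    rintro P 𝒯 τ κc χ G κt S u uglo hγ hκm hκ hG rfl hM hS - hu hv
    exact SpaceTimeNLMC.Problem.error_le_multiscale hd0 hκ₀ hκ₁ hγ hκm hκ hG hM hu hv hS hC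
      ((le_max_left _ _).trans (le_max_left _ _)) ((le_max_right _ _).trans (le_max_left _ _))
      (lt_max_of_lt_right one_pos)
  -- The summand 2^d serves the term with ∂ₜu, the rest the term with f; their sum dominates both.
  · refine ⟨20 * SpaceTimeNLMC.Problem.errorConst κ₀ κ₁ (κ₁ / κ₀ * (2 ^ d * d * 4 ^ d * γ ^ 2))
        √(2 ^ d * |κ₁| * d * (SpaceTimeNLMC.poincareConst d γ + 2)) ^ 2 * (2 ^ d * |γ|) + 2 ^ d,
      by positivity, ?_⟩
    rintro P 𝒯 τ κt S u uglo hγ rfl hS - hu hv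
    have hH := 𝒯.H_pos hd0 P.isConnected.nonempty
    refine (SpaceTimeNLMC.Problem.error_le_bilinear hd0 hκ₀ hκ₁ hγ hu hv hS).trans ?_
    gcongr
    · exact le_add_of_nonneg_right (by positivity)
    · exact le_add_of_nonneg_left (by positivity)
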